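/- Let $(M,g)$ be a smooth, connected, complete Riemannian manifold without boundary, of dimension $m\ge 2$, with Riemannian measure $\mathrm{dvol}$, and let $2\le p<\infty$. For $u\in L^p(M)$ let $\nabla u$, $\operatorname{Hess}(u)=Ddu$ ($D$ the Levi-Civita connection) and $\Delta u=\operatorname{trace}_g\operatorname{Hess}(u)=\operatorname{div}\nabla u$ be the gradient, Hessian and Laplacian of $u$ in the sense of distributions, and let $$\widetilde W^{2,p}(M)=\{u\in L^p(M):\ \Delta u\in L^p(M)\}.$$ All $L^p$-norms are taken over $M$ with respect to $\mathrm{dvol}$, and pointwise norms of vectors and $2$-tensors are those induced by $g$. Assume that there is a constant $C>0$ such that for every $u\in\widetilde W^{2,p}(M)$ one has $|\operatorname{Hess}(u)|\in L^p(M)$ and $$\|\operatorname{Hess}(u)\|_{L^p}\le C\{\|u\|_{L^p}+\|\Delta u\|_{L^p}\}.$$ Then there is a constant $C'>0$ such that for every $u\in\widetilde W^{2,p}(M)$ one has $|\nabla u|\in L^p(M)$ and $$\|\nabla u\|_{L^p}\le C'\{\|u\|_{L^p}+\|\Delta u\|_{L^p}\}.$$ -/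

import Mathlib

open MeasureTheory Bundle Manifold
open scoped ENNReal ContDiff Topology

noncomputable section

namespace RiemannianSobolev

/-- The model space `ℝ^m` with its Euclidean structure. -/
abbrev Eucl (m : ℕ) : Type := EuclideanSpace ℝ (Fin m)

/-- The partial derivative `∂_i F (y)` of a function on `ℝ^m`. -/
def partialDeriv {m : ℕ} (i : Fin m) (F : Eucl m → ℝ) (y : Eucl m) : ℝ :=
  fderiv ℝ F y (EuclideanSpace.single i 1)

/-! ### The metric in local coordinates

`M` is a manifold modelled on `ℝ^m` whose tangent spaces carry inner products `g_x`. For `c : M`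
we work in the chart `chartAt _ c` around `c`; its image `(chartAt _ c).target` is an open subset
of `ℝ^m`. The functions below are meaningful on that open set. -/

section Coordinates

variable (m : ℕ) {M : Type*} [TopologicalSpace M] [ChartedSpace (Eucl m) M]

/-- The coordinate vector field `∂_i` of the chart around `c`, at the point with coordinates `y`. -/
def coordVector (c : M) (i : Fin m) (y : Eucl m) :
    TangentSpace (𝓡 m) ((chartAt (Eucl m) c).symm y) :=
  mfderiv 𝓘(ℝ, Eucl m) (𝓡 m) (chartAt (Eucl m) c).symm y
    (EuclideanSpace.single i (1 : ℝ) : Eucl m)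

variable [RiemannianBundle (fun x : M ↦ TangentSpace (𝓡 m) x)]

/-- The matrix of metric coefficients `g_ij = g(∂_i, ∂_j)`. -/
def metricMatrix (c : M) (y : Eucl m) : Matrix (Fin m) (Fin m) ℝ :=
  Matrix.of fun i j ↦ inner ℝ (coordVector m c i y) (coordVector m c j y)

/-- The inverse coefficients `g^{ij}`. -/
def metricInv (c : M) (i j : Fin m) (y : Eucl m) : ℝ :=
  (metricMatrix m c y)⁻¹ i j

/-- The Riemannian density `√det(g_ij)`. -/
def volDensity (c : M) (y : Eucl m) : ℝ :=
  √(metricMatrix m c y).det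

/-- The Christoffel symbols of the Levi-Civita connection,
`Γ^k_ij = ½ ∑_l g^{kl} (∂_i g_jl + ∂_j g_il - ∂_l g_ij)`. -/
def christoffel (c : M) (k i j : Fin m) (y : Eucl m) : ℝ :=
  (1 / 2) * ∑ l : Fin m, metricInv m c k l y *
    (partialDeriv i (fun z ↦ metricMatrix m c z j l) y
      + partialDeriv j (fun z ↦ metricMatrix m c z i l) y
      - partialDeriv l (fun z ↦ metricMatrix m c z i j) y)

/-! ### The Riemannian measure -/

/-- The measure `√det(g_ij) dx^1 ⋯ dx^m` on the domain of the chart around `c`, as a measure on `M`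
(it gives no mass to the complement of this domain). -/
def chartVolume [MeasurableSpace M] (c : M) : Measure M :=
  Measure.map (chartAt (Eucl m) c).symm
    ((volume.restrict (chartAt (Eucl m) c).target).withDensity
      fun y ↦ ENNReal.ofReal (volDensity m c y))

/-- The Riemannian measure `dvol`. The measures `chartVolume m c` agree on the overlaps of the chart
domains, and `dvol` is the measure obtained by gluing them, that is, their supremum. -/
def riemannianVolume (M : Type*) [TopologicalSpace M] [ChartedSpace (Eucl m) M]
    [RiemannianBundle (fun x : M ↦ TangentSpace (𝓡 m) x)] [MeasurableSpace M] : Measure M :=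
  ⨆ c : M, chartVolume m c

end Coordinates

/-! ### Distributional differential operators

A test function in the chart around `c` is a smooth function on `ℝ^m` whose support is a compact
subset of the image of the chart. Distributions on `M` are determined by their restrictions to the
chart domains, so that it is enough to test there. -/

section Distributions

variable (m : ℕ) {M : Type*} [TopologicalSpace M] [ChartedSpace (Eucl m) M]

/-- `η` is a test function on the image of the chart around `c`. -/
structure IsChartTest (c : M) (η : Eucl m → ℝ) : Prop where
  smooth : ContDiff ℝ ∞ η
  compact : HasCompactSupport η
  support_subset : tsupport η ⊆ (chartAt (Eucl m) c).target

variable [RiemannianBundle (fun x : M ↦ TangentSpace (𝓡 m) x)]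

/-- `f = Δu` in the sense of distributions (`u` and `f` locally integrable), where
`Δu = (√det g)⁻¹ ∑_{i,j} ∂_i (√det g g^{ij} ∂_j u)`; for a test function `η` supported in a chart
this reads `∫ f η dvol = ∫ u Δη dvol`, written out in coordinates. -/
def IsWeakLaplacian (u f : M → ℝ) : Prop :=
  ∀ (c : M) (η : Eucl m → ℝ), IsChartTest m c η →
    ∫ y, f ((chartAt (Eucl m) c).symm y) * η y * volDensity m c y
      = ∫ y, u ((chartAt (Eucl m) c).symm y) *
          ∑ i : Fin m, ∑ j : Fin m,
            partialDeriv i (fun z ↦ volDensity m c z * metricInv m c i j z * partialDeriv j η z) y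

/-- `X = ∇u` in the sense of distributions, for a locally integrable vector field `X`:
in local coordinates `g(X, ∂_i) = ∂_i u`. -/
structure IsWeakGradient (u : M → ℝ) (X : ∀ x : M, TangentSpace (𝓡 m) x) : Prop where
  locallyIntegrable (c : M) (i : Fin m) :
    LocallyIntegrableOn
      (fun y ↦ (inner ℝ (X ((chartAt (Eucl m) c).symm y)) (coordVector m c i y) : ℝ))
      (chartAt (Eucl m) c).target
  integral_eq (c : M) (η : Eucl m → ℝ) (hη : IsChartTest m c η) (i : Fin m) :
    ∫ y, (inner ℝ (X ((chartAt (Eucl m) c).symm y)) (coordVector m c i y) : ℝ) * η y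
      = - ∫ y, u ((chartAt (Eucl m) c).symm y) * partialDeriv i η y

/-- `h = Hess(u) = Ddu` in the sense of distributions, for a locally integrable `(0,2)`-tensor
field `h`: in local coordinates `h(∂_i, ∂_j) = ∂_i ∂_j u - ∑_k Γ^k_ij ∂_k u`. No regularity of the
distributional gradient of `u` is presupposed. -/
structure IsWeakHessian (u : M → ℝ)
    (h : ∀ x : M, TangentSpace (𝓡 m) x →L[ℝ] TangentSpace (𝓡 m) x →L[ℝ] ℝ) : Prop where
  locallyIntegrable (c : M) (i j : Fin m) :
    LocallyIntegrableOn
      (fun y ↦ h ((chartAt (Eucl m) c).symm y) (coordVector m c i y) (coordVector m c j y))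
      (chartAt (Eucl m) c).target
  integral_eq (c : M) (η : Eucl m → ℝ) (hη : IsChartTest m c η) (i j : Fin m) :
    ∫ y, h ((chartAt (Eucl m) c).symm y) (coordVector m c i y) (coordVector m c j y) * η y
      = ∫ y, u ((chartAt (Eucl m) c).symm y) *
          (partialDeriv i (partialDeriv j η) y
            + ∑ k : Fin m, partialDeriv k (fun z ↦ christoffel m c k i j z * η z) y)

end Distributions

/-! ### Pointwise norms and the space `W̃^{2,p}` -/

/-- The (Hilbert–Schmidt) norm `|h|` of a bilinear form on a finite-dimensional inner product space:
`|h|² = ∑_{a,b} h(e_a, e_b)²` for an orthonormal basis `(e_a)`. -/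
def tensorNorm {V : Type*} [NormedAddCommGroup V] [InnerProductSpace ℝ V] [FiniteDimensional ℝ V]
    (h : V →L[ℝ] V →L[ℝ] ℝ) : ℝ :=
  √(∑ a, ∑ b, (h (stdOrthonormalBasis ℝ V a) (stdOrthonormalBasis ℝ V b)) ^ 2)

instance {m : ℕ} {M : Type*} [TopologicalSpace M] [ChartedSpace (Eucl m) M] (x : M) :
    FiniteDimensional ℝ (TangentSpace (𝓡 m) x) :=
  inferInstanceAs (FiniteDimensional ℝ (Eucl m))

section Space

variable (m : ℕ) {M : Type*} [TopologicalSpace M] [ChartedSpace (Eucl m) M]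
  [RiemannianBundle (fun x : M ↦ TangentSpace (𝓡 m) x)] [MeasurableSpace M]

/-- `u ∈ W̃^{2,p}(M)` with distributional Laplacian `Δu = f`: `u` and `f` are in `L^p(M)`. -/
structure MemSobolevTilde (p : ℝ≥0∞) (u f : M → ℝ) : Prop where
  memLp : MemLp u p (riemannianVolume m M)
  memLp_laplacian : MemLp f p (riemannianVolume m M)
  isWeakLaplacian : IsWeakLaplacian m u f

end Space

end RiemannianSobolev

end

/-!
The gradient estimate follows from the Hessian estimate and an inequality
`‖∇u‖_p ≤ D (‖u‖_p + ‖Hess u‖_p)`, which holds on every complete Riemannian manifold with a constant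
depending only on `m` and `p` (`exists_eLpNorm_gradient_le`).

For smooth `u` of compact support this inequality is an integration by parts. The divergence of
`u |∇u|^(p - 2) ∇u` is `|∇u|^p` plus terms bounded by `(m + p - 2) |u| |Hess u| |∇u|^(p - 2)`.
The divergence integrates to zero, and Young's inequality absorbs the power of `|∇u|` into the left
hand side. The condition `p ≥ 2` enters here: the exponent `p - 2` is not negative. In general, the
argument has to deal with three points.

*Local regularity.* The distributional Hessian says nothing about the gradient a priori. As `p ≥ 2`,
both `u` and `Hess u` are locally square integrable. In a chart, the sum of the diagonal components
of the Hessian equation is an equation for the flat Laplacian of `u`, with a right hand side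
`f - ∑ ∂_k (b_k u)`, where `f` is locally square integrable and the `b_k` are smooth. The Caccioppoli
inequality (`caccioppoli`) for differences of mollifications shows that the gradients of the
mollifications converge locally in `L²` (`exists_tendsto_partialDeriv_mollify`), and their limits in
the different charts glue to a weak gradient (`exists_isWeakGradient`). The Hessian equation then
controls the second derivatives `∂_i ∂_j u`, so that mollification approximates `u` together with its
gradient and its Hessian, locally in `L²` (`exists_smooth_approximation_hessian`).

*The nonlinear weight.* Convergence in `L²` is not enough to pass to the limit in `|∇u|^(p - 2)`.
The weight is replaced by `a(|∇u|²)` where `a` is a bounded approximation of `s ^ ((p - 2) / 2)` such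
that `s a'(s)` is bounded (`regularizedPower`). Then all the coefficients of the identity are
bounded, and the identity `∫ div (φ u a(|∇u|²) ∇u) = 0` survives the limit
(`integral_energyForm`). The bound of `s a'(s) / a(s)` does not depend on the regularization, so that
the pointwise estimate (`cutoff_pow_mul_le_energyForm`, from the Young inequalities
`mul_mul_weight_le` and `cutoff_mul_weight_le`) does not depend on it either.

*Cutoff functions.* The function `φ` is a power of a 1-Lipschitz function of the distance to a point.
It has compact support since closed balls are compact, by the Hopf–Rinow theorem
(`properSpace_of_complete`). It is differentiable almost everywhere, by Rademacher's theorem in the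
charts, and the divergence theorem holds for it. Only first derivatives of the cutoff functions
appear, so that no curvature assumption is needed.

Fatou's lemma removes the regularization and the cutoff function at once (`lintegral_norm_rpow_le`).
-/

open MeasureTheory Bundle Manifold
open scoped ENNReal ContDiff Topology

noncomputable section

set_option linter.unusedSectionVars false

namespace RiemannianSobolev

/-! ### Coordinate vectors and metric coefficients -/

section Charts

variable {m : ℕ} {M : Type*} [TopologicalSpace M] [ChartedSpace (Eucl m) M]

/-- The differential of the inverse chart. -/
def chartDeriv (c : M) (y : Eucl m) :
    Eucl m →L[ℝ] TangentSpace (𝓡 m) ((chartAt (Eucl m) c).symm y) :=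
  mfderiv 𝓘(ℝ, Eucl m) (𝓡 m) (chartAt (Eucl m) c).symm y

theorem coordVector_eq (c : M) (i : Fin m) (y : Eucl m) :
    coordVector m c i y = chartDeriv c y (EuclideanSpace.single i 1) := rfl

theorem chartDeriv_apply (c : M) (y v : Eucl m) :
    chartDeriv c y v = ∑ i, v i • coordVector m c i y := by
  have : v = ∑ i, v i • (EuclideanSpace.single i (1:ℝ) : Eucl m) := by
    ext j; simp [Finset.sum_apply, Pi.single_apply]
  conv_lhs => rw [this]
  simp only [map_sum, map_smul]
  rfl

variable [IsManifold (𝓡 m) ∞ M]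

theorem mdifferentiableAt_chart_symm (c : M) {y : Eucl m} (hy : y ∈ (chartAt (Eucl m) c).target) :
    MDifferentiableAt 𝓘(ℝ, Eucl m) (𝓡 m) (chartAt (Eucl m) c).symm y :=
  ((contMDiffOn_chart_symm (I := 𝓡 m) (n := ∞) (x := c)).contMDiffAt
    ((chartAt (Eucl m) c).open_target.mem_nhds hy)).mdifferentiableAt (by simp)

theorem mdifferentiableAt_chart (c : M) {x : M} (hx : x ∈ (chartAt (Eucl m) c).source) :
    MDifferentiableAt (𝓡 m) 𝓘(ℝ, Eucl m) (chartAt (Eucl m) c) x :=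
  ((contMDiffOn_chart (I := 𝓡 m) (n := ∞) (x := c)).contMDiffAt
    ((chartAt (Eucl m) c).open_source.mem_nhds hx)).mdifferentiableAt (by simp)

theorem chartDeriv_injective (c : M) {y : Eucl m} (hy : y ∈ (chartAt (Eucl m) c).target) :
    Function.Injective (chartDeriv c y) := by
  have h1 := mdifferentiableAt_chart_symm c hy
  have h2 := mdifferentiableAt_chart c ((chartAt (Eucl m) c).map_target hy)
  have h3 : mfderiv 𝓘(ℝ, Eucl m) 𝓘(ℝ, Eucl m)
      ((chartAt (Eucl m) c) ∘ (chartAt (Eucl m) c).symm) y = ContinuousLinearMap.id ℝ (Eucl m) := by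
    rw [Filter.EventuallyEq.mfderiv_eq (f := id)]
    · exact mfderiv_id
    · filter_upwards [(chartAt (Eucl m) c).open_target.mem_nhds hy] with z hz
      exact (chartAt (Eucl m) c).right_inv hz
  rw [mfderiv_comp y h2 h1] at h3
  intro v w hvw
  have := congrArg (fun L : Eucl m →L[ℝ] Eucl m ↦ L v) h3
  have h' := congrArg (fun L : Eucl m →L[ℝ] Eucl m ↦ L w) h3
  simp only [ContinuousLinearMap.id_apply] at this h'
  rw [← this, ← h']
  exact congrArg (mfderiv (𝓡 m) 𝓘(ℝ, Eucl m) (chartAt (Eucl m) c) _) hvw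

theorem contMDiffOn_coordVector (c : M) (i : Fin m) :
    ContMDiffOn 𝓘(ℝ, Eucl m) (𝓡 m).tangent ∞
      (fun y ↦ (⟨(chartAt (Eucl m) c).symm y, coordVector m c i y⟩ :
        TangentBundle (𝓡 m) M)) (chartAt (Eucl m) c).target := by
  have h := (contMDiffOn_chart_symm (I := 𝓡 m) (n := ∞) (x := c)).contMDiffOn_tangentMapWithin
    (m := ∞) (by simp) (chartAt (Eucl m) c).open_target.uniqueMDiffOn
  have h2 : ContMDiff 𝓘(ℝ, Eucl m) 𝓘(ℝ, Eucl m).tangent ∞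
      (fun y ↦ (⟨y, (EuclideanSpace.single i (1:ℝ) : Eucl m)⟩ :
        TangentBundle 𝓘(ℝ, Eucl m) (Eucl m))) := by
    intro y
    rw [contMDiffAt_totalSpace]
    refine ⟨contMDiffAt_id, ?_⟩
    simp
    exact contMDiffAt_const
  refine (h.comp h2.contMDiffOn (fun y hy ↦ hy)).congr ?_
  intro y hy
  simp only [Function.comp, tangentMapWithin]
  rw [mfderivWithin_of_isOpen (chartAt (Eucl m) c).open_target hy]
  rfl

variable [RiemannianBundle (fun x : M ↦ TangentSpace (𝓡 m) x)]

theorem contDiffOn_metricMatrix [IsContMDiffRiemannianBundle (𝓡 m) ∞ (Eucl m)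
      (fun x : M ↦ TangentSpace (𝓡 m) x)] (c : M) (i j : Fin m) :
    ContDiffOn ℝ ∞ (fun y ↦ metricMatrix m c y i j) (chartAt (Eucl m) c).target := by
  rw [← contMDiffOn_iff_contDiffOn]
  exact (contMDiffOn_coordVector c i).inner_bundle (contMDiffOn_coordVector c j)

omit [IsManifold (𝓡 m) ∞ M] in
theorem inner_chartDeriv (c : M) (y v w : Eucl m) :
    inner ℝ (chartDeriv c y v) (chartDeriv c y w)
      = ∑ i, ∑ j, v i * w j * metricMatrix m c y i j := by
  simp only [chartDeriv_apply, sum_inner, inner_sum, real_inner_smul_left, real_inner_smul_right,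
    metricMatrix, Matrix.of_apply]
  rw [Finset.sum_comm]
  refine Finset.sum_congr rfl fun i _ ↦ Finset.sum_congr rfl fun j _ ↦ ?_
  ring

theorem posDef_metricMatrix (c : M) {y : Eucl m} (hy : y ∈ (chartAt (Eucl m) c).target) :
    (metricMatrix m c y).PosDef := by
  refine Matrix.PosDef.of_dotProduct_mulVec_pos ?_ ?_
  · ext i j
    exact real_inner_comm (coordVector m c i y) (coordVector m c j y)
  · intro v hv
    set V : Eucl m := WithLp.toLp 2 v
    have hV : V ≠ 0 := by
      intro h; apply hv; ext i; exact congrArg (fun w : Eucl m ↦ w i) h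
    have h0 : chartDeriv c y V ≠ 0 := fun h ↦ hV (chartDeriv_injective c hy (by simpa using h))
    have h1 := real_inner_self_pos.2 h0
    rw [inner_chartDeriv] at h1
    refine h1.trans_eq ?_
    symm
    simp only [dotProduct, Matrix.mulVec, Finset.mul_sum]
    refine Finset.sum_congr rfl fun i _ ↦ Finset.sum_congr rfl fun j _ ↦ ?_
    change v i * (_ * v j) = v i * v j * _
    ring

end Charts

/-! ### Changes of coordinates -/

section Transition

variable {m : ℕ} {M : Type*} [TopologicalSpace M] [ChartedSpace (Eucl m) M]

/-- The change of coordinates from the chart around `c` to the chart around `c'`. -/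
def transition (c c' : M) (y : Eucl m) : Eucl m :=
  chartAt (Eucl m) c' ((chartAt (Eucl m) c).symm y)

/-- The open set of coordinates `y` in the chart around `c` of points in the domain of the chart
around `c'`. -/
def overlap (c c' : M) : Set (Eucl m) :=
  (chartAt (Eucl m) c).target ∩ (chartAt (Eucl m) c).symm ⁻¹' (chartAt (Eucl m) c').source

theorem isOpen_overlap (c c' : M) : IsOpen (overlap (m := m) c c') :=
  (chartAt (Eucl m) c).symm.isOpen_inter_preimage (chartAt (Eucl m) c').open_source

theorem chart_symm_transition (c c' : M) {y : Eucl m} (hy : y ∈ overlap c c') :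
    (chartAt (Eucl m) c').symm (transition c c' y) = (chartAt (Eucl m) c).symm y :=
  (chartAt (Eucl m) c').left_inv hy.2

variable [IsManifold (𝓡 m) ∞ M]

theorem contDiffOn_transition (c c' : M) :
    ContDiffOn ℝ ∞ (transition c c') (overlap (m := m) c c') := by
  rw [← contMDiffOn_iff_contDiffOn]
  refine (contMDiffOn_chart (I := 𝓡 m) (n := ∞) (x := c')).comp
    ((contMDiffOn_chart_symm (I := 𝓡 m) (n := ∞) (x := c)).mono Set.inter_subset_left)
    (fun y hy ↦ hy.2)

theorem differentiableAt_transition (c c' : M) {y : Eucl m} (hy : y ∈ overlap c c') :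
    DifferentiableAt ℝ (transition c c') y :=
  ((contDiffOn_transition c c').contDiffAt ((isOpen_overlap c c').mem_nhds hy)).differentiableAt
    (by simp)

/-- The equality is stated in the model space, in which both tangent spaces are realised. -/
theorem chartDeriv_transition (c c' : M) {y : Eucl m} (hy : y ∈ overlap c c') (v : Eucl m) :
    (chartDeriv c y v : Eucl m)
      = (chartDeriv c' (transition c c' y) (fderiv ℝ (transition c c') y v) : Eucl m) := by
  have hmem : transition c c' y ∈ (chartAt (Eucl m) c').target :=
    (chartAt (Eucl m) c').map_source hy.2
  have h1 := mdifferentiableAt_chart_symm c' hmem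
  have h2 := (differentiableAt_transition c c' hy).mdifferentiableAt
  have h3 := mfderiv_comp y h1 h2
  have h4 : ((chartAt (Eucl m) c').symm ∘ transition c c') =ᶠ[𝓝 y] (chartAt (Eucl m) c).symm := by
    filter_upwards [(isOpen_overlap c c').mem_nhds hy] with z hz
    exact chart_symm_transition c c' hz
  have h5 := h4.mfderiv_eq (I := 𝓘(ℝ, Eucl m)) (I' := 𝓡 m)
  rw [h3, mfderiv_eq_fderiv] at h5
  exact (congrArg (fun L : Eucl m →L[ℝ] Eucl m ↦ L v) h5).symm

variable [RiemannianBundle (fun x : M ↦ TangentSpace (𝓡 m) x)]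

omit [IsManifold (𝓡 m) ∞ M] in
theorem inner_tangent_congr {x x' : M} (h : x = x') (a b : Eucl m) :
    @inner ℝ (TangentSpace (𝓡 m) x) _ a b = @inner ℝ (TangentSpace (𝓡 m) x') _ a b := by
  subst h; rfl

theorem metricMatrix_transition (c c' : M) {y : Eucl m} (hy : y ∈ overlap c c') (i j : Fin m) :
    metricMatrix m c y i j = ∑ k, ∑ l,
      fderiv ℝ (transition c c') y (EuclideanSpace.single i 1) k *
        fderiv ℝ (transition c c') y (EuclideanSpace.single j 1) l *
          metricMatrix m c' (transition c c' y) k l := by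
  rw [← inner_chartDeriv]
  refine Eq.trans ?_ (inner_tangent_congr (chart_symm_transition c c' hy).symm _ _)
  exact congrArg₂ (fun a b : Eucl m ↦
    @inner ℝ (TangentSpace (𝓡 m) ((chartAt (Eucl m) c).symm y)) _ a b)
    (chartDeriv_transition c c' hy _) (chartDeriv_transition c c' hy _)

theorem volDensity_transition (c c' : M) {y : Eucl m} (hy : y ∈ overlap c c') :
    volDensity m c y
      = |(fderiv ℝ (transition c c') y).det| * volDensity m c' (transition c c' y) := by
  set b := (EuclideanSpace.basisFun (Fin m) ℝ).toBasis
  set L := fderiv ℝ (transition c c') y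
  have h1 : metricMatrix m c y = (LinearMap.toMatrix b b L.toLinearMap).transpose *
      metricMatrix m c' (transition c c' y) * LinearMap.toMatrix b b L.toLinearMap := by
    ext i j
    rw [metricMatrix_transition c c' hy]
    simp only [Matrix.mul_apply, Matrix.transpose_apply, LinearMap.toMatrix_apply, Finset.sum_mul]
    rw [Finset.sum_comm]
    refine Finset.sum_congr rfl fun k _ ↦ Finset.sum_congr rfl fun l _ ↦ ?_
    simp [b, L]
    ring
  have h2 : L.det = (LinearMap.toMatrix b b L.toLinearMap).det := (LinearMap.det_toMatrix b _).symm
  rw [volDensity, volDensity, h1, Matrix.det_mul, Matrix.det_mul, Matrix.det_transpose, ← h2,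
    mul_right_comm, ← pow_two, Real.sqrt_mul (sq_nonneg _), Real.sqrt_sq_eq_abs]

theorem volDensity_pos (c : M) {y : Eucl m} (hy : y ∈ (chartAt (Eucl m) c).target) :
    0 < volDensity m c y :=
  Real.sqrt_pos.2 (posDef_metricMatrix c hy).det_pos

theorem contDiffOn_volDensity [IsContMDiffRiemannianBundle (𝓡 m) ∞ (Eucl m)
      (fun x : M ↦ TangentSpace (𝓡 m) x)] (c : M) :
    ContDiffOn ℝ ∞ (volDensity m c) (chartAt (Eucl m) c).target := by
  refine ContDiffOn.sqrt ?_ (fun y hy ↦ (posDef_metricMatrix c hy).det_pos.ne')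
  simp only [Matrix.det_apply]
  refine ContDiffOn.sum fun σ _ ↦ ContDiffOn.const_smul _ (contDiffOn_prod fun i _ ↦
    contDiffOn_metricMatrix c _ _)

end Transition

/-! ### The Riemannian measure of a chart domain -/

section Volume

variable {m : ℕ} {M : Type*} [TopologicalSpace M] [ChartedSpace (Eucl m) M]
  [MeasurableSpace M] [BorelSpace M]

theorem aemeasurable_chart_symm (c : M) :
    AEMeasurable (chartAt (Eucl m) c).symm (volume.restrict (chartAt (Eucl m) c).target) :=
  (chartAt (Eucl m) c).continuousOn_symm.aemeasurable (chartAt (Eucl m) c).open_target.measurableSet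

theorem measurableSet_chart_preimage (c : M) {S : Set M} (hS : MeasurableSet S) :
    MeasurableSet ((chartAt (Eucl m) c).target ∩ (chartAt (Eucl m) c).symm ⁻¹' S) := by
  have h := (chartAt (Eucl m) c).continuousOn_symm.domRestrict.measurable hS
  have := (MeasurableEmbedding.subtype_coe
    (chartAt (Eucl m) c).open_target.measurableSet).measurableSet_image.2 h
  convert this using 1
  ext y
  simp [and_comm]

variable [RiemannianBundle (fun x : M ↦ TangentSpace (𝓡 m) x)]

theorem chartVolume_apply (c : M) {S : Set M} (hS : MeasurableSet S) :
    chartVolume m c S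
      = ∫⁻ y in (chartAt (Eucl m) c).target ∩ (chartAt (Eucl m) c).symm ⁻¹' S,
          ENNReal.ofReal (volDensity m c y) := by
  rw [chartVolume, Measure.map_apply_of_aemeasurable
    ((aemeasurable_chart_symm c).mono_ac (withDensity_absolutelyContinuous _ _)) hS]
  rw [withDensity_apply', Measure.restrict_restrict' (chartAt (Eucl m) c).open_target.measurableSet,
    Set.inter_comm]

variable [IsManifold (𝓡 m) ∞ M]

/-- By the change of variables formula, the measures `√det(g_ij) dy` of two charts agree on the
intersection of their domains. -/
theorem chartVolume_apply_eq (c c' : M) {S : Set M} (hS : MeasurableSet S)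
    (hc : S ⊆ (chartAt (Eucl m) c).source) (hc' : S ⊆ (chartAt (Eucl m) c').source) :
    chartVolume m c S = chartVolume m c' S := by
  rw [chartVolume_apply c hS, chartVolume_apply c' hS]
  set A := (chartAt (Eucl m) c).target ∩ (chartAt (Eucl m) c).symm ⁻¹' S
  have hA : A ⊆ overlap c c' := fun y hy ↦ ⟨hy.1, hc' hy.2⟩
  have hAm : MeasurableSet A := measurableSet_chart_preimage c hS
  have him : (chartAt (Eucl m) c').target ∩ (chartAt (Eucl m) c').symm ⁻¹' S
      = transition c c' '' A := by
    ext z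
    constructor
    · rintro ⟨hz, hz'⟩
      refine ⟨transition c' c z, ⟨(chartAt (Eucl m) c).map_source (hc hz'), ?_⟩, ?_⟩
      · rw [Set.mem_preimage, chart_symm_transition c' c ⟨hz, hc hz'⟩]; exact hz'
      · rw [transition, chart_symm_transition c' c ⟨hz, hc hz'⟩]
        exact (chartAt (Eucl m) c').right_inv hz
    · rintro ⟨y, hy, rfl⟩
      refine ⟨(chartAt (Eucl m) c').map_source (hA hy).2, ?_⟩
      rw [Set.mem_preimage, chart_symm_transition c c' (hA hy)]; exact hy.2
  have hinj : Set.InjOn (transition (m := m) c c') A := by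
    intro y hy z hz h
    have := congrArg (chartAt (Eucl m) c').symm h
    rw [chart_symm_transition c c' (hA hy), chart_symm_transition c c' (hA hz)] at this
    exact (chartAt (Eucl m) c).symm.injOn hy.1 hz.1 this
  rw [him, lintegral_image_eq_lintegral_abs_det_fderiv_mul volume hAm
    (fun y hy ↦ ((differentiableAt_transition c c' (hA hy)).hasFDerivAt).hasFDerivWithinAt) hinj]
  refine setLIntegral_congr_fun hAm fun y hy ↦ ?_
  rw [volDensity_transition c c' (hA hy), ENNReal.ofReal_mul (abs_nonneg _)]

variable [SecondCountableTopology M]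

/-- The Riemannian measure is glued from the measures `chartVolume`, which agree on overlaps. -/
theorem riemannianVolume_apply (c : M) {S : Set M} (hS : MeasurableSet S)
    (hc : S ⊆ (chartAt (Eucl m) c).source) : riemannianVolume m M S = chartVolume m c S := by
  refine le_antisymm ?_ (Measure.le_iff'.1 (le_iSup (chartVolume m (M := M)) c) S)
  obtain ⟨s, hs, hsU⟩ := TopologicalSpace.isOpen_iUnion_countable
    (fun c : M ↦ (chartAt (Eucl m) c).source) (fun c ↦ (chartAt (Eucl m) c).open_source)
  have : Nonempty M := ⟨c⟩
  have hne : s.Nonempty := by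
    by_contra h
    rw [Set.not_nonempty_iff_eq_empty] at h
    have : c ∈ ⋃ c : M, (chartAt (Eucl m) c).source := Set.mem_iUnion.2 ⟨c, mem_chart_source _ c⟩
    rw [← hsU, h] at this
    simp at this
  obtain ⟨d, hd⟩ := hs.exists_eq_range hne
  have hcov : ⋃ n, (chartAt (Eucl m) (d n)).source = Set.univ := by
    rw [hd, Set.biUnion_range] at hsU
    rw [hsU]
    exact Set.eq_univ_of_forall fun x ↦ Set.mem_iUnion.2 ⟨x, mem_chart_source _ x⟩
  -- the measure `ν` glued along a countable partition of `M` into pieces of chart domains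
  -- dominates every `chartVolume`, hence also their supremum
  set A : ℕ → Set M := disjointed fun n ↦ (chartAt (Eucl m) (d n)).source
  have hAm : ∀ n, MeasurableSet (A n) := MeasurableSet.disjointed
    fun n ↦ (chartAt (Eucl m) (d n)).open_source.measurableSet
  have hAs : ∀ n, A n ⊆ (chartAt (Eucl m) (d n)).source := disjointed_subset _
  have hAU : ⋃ n, A n = Set.univ := by rw [iUnion_disjointed, hcov]
  have hdecomp : ∀ (μ : Measure M) {S : Set M}, MeasurableSet S → μ S = ∑' n, μ (S ∩ A n) := by
    intro μ S hS
    rw [← measure_iUnion, ← Set.inter_iUnion, hAU, Set.inter_univ]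
    · intro i j hij
      exact (disjoint_disjointed _ hij).mono Set.inter_subset_right Set.inter_subset_right
    · exact fun n ↦ hS.inter (hAm n)
  set ν : Measure M := Measure.sum fun n ↦ (chartVolume m (d n)).restrict (A n)
  have hν : ∀ {S : Set M}, MeasurableSet S → ν S = ∑' n, chartVolume m (d n) (S ∩ A n) := by
    intro S hS
    rw [Measure.sum_apply _ hS]
    exact tsum_congr fun n ↦ Measure.restrict_apply hS
  have hle : riemannianVolume m M ≤ ν := by
    refine iSup_le fun c' ↦ Measure.le_iff.2 fun T hT ↦ ?_
    have hO : MeasurableSet (chartAt (Eucl m) c').source :=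
      (chartAt (Eucl m) c').open_source.measurableSet
    have h0 : chartVolume m c' T = chartVolume m c' (T ∩ (chartAt (Eucl m) c').source) := by
      rw [chartVolume_apply c' hT, chartVolume_apply c' (hT.inter hO)]
      congr 2
      ext y
      simp only [Set.mem_inter_iff, Set.mem_preimage]
      exact ⟨fun h ↦ ⟨h.1, h.2, (chartAt (Eucl m) c').map_target h.1⟩, fun h ↦ ⟨h.1, h.2.1⟩⟩
    rw [h0, hν hT, hdecomp _ (hT.inter hO)]
    refine ENNReal.tsum_le_tsum fun n ↦ ?_
    rw [chartVolume_apply_eq c' (d n) ((hT.inter hO).inter (hAm n)) (fun x hx ↦ hx.1.2)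
      (fun x hx ↦ hAs n hx.2)]
    exact measure_mono (Set.inter_subset_inter_left _ Set.inter_subset_left)
  refine (Measure.le_iff'.1 hle S).trans ?_
  rw [hν hS, hdecomp (chartVolume m c) hS]
  refine ENNReal.tsum_le_tsum fun n ↦ ?_
  rw [chartVolume_apply_eq c (d n) (hS.inter (hAm n)) (fun x hx ↦ hc hx.1) (fun x hx ↦ hAs n hx.2)]

theorem riemannianVolume_restrict_source (c : M) :
    (riemannianVolume m M).restrict (chartAt (Eucl m) c).source = chartVolume m c := by
  have hO : MeasurableSet (chartAt (Eucl m) c).source :=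
    (chartAt (Eucl m) c).open_source.measurableSet
  ext T hT
  rw [Measure.restrict_apply hT, riemannianVolume_apply c (hT.inter hO) Set.inter_subset_right,
    chartVolume_apply c hT, chartVolume_apply c (hT.inter hO)]
  congr 2
  ext y
  simp only [Set.mem_inter_iff, Set.mem_preimage]
  exact ⟨fun h ↦ ⟨h.1, h.2.1⟩, fun h ↦ ⟨h.1, h.2, (chartAt (Eucl m) c).map_target h.1⟩⟩

end Volume

/-! ### Integration in coordinates -/

section VolumeIntegral

variable {m : ℕ} {M : Type*} [TopologicalSpace M] [ChartedSpace (Eucl m) M]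
  [MeasurableSpace M] [BorelSpace M]

theorem measurableEmbedding_chart_symm (c : M) :
    MeasurableEmbedding ((chartAt (Eucl m) c).target.domRestrict (chartAt (Eucl m) c).symm) :=
  (chartAt (Eucl m) c).symm.isOpenEmbedding_restrict.measurableEmbedding

variable [RiemannianBundle (fun x : M ↦ TangentSpace (𝓡 m) x)]

/-- The Riemannian measure of a chart domain, in coordinates. -/
def coordVolume (c : M) : Measure (Eucl m) :=
  (volume.restrict (chartAt (Eucl m) c).target).withDensity
    fun y ↦ ENNReal.ofReal (volDensity m c y)

theorem chartVolume_eq_map (c : M) :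
    chartVolume m c = Measure.map
      ((chartAt (Eucl m) c).target.domRestrict (chartAt (Eucl m) c).symm)
      ((coordVolume c).comap Subtype.val) := by
  have hT := (chartAt (Eucl m) c).open_target.measurableSet
  have h1 : (coordVolume (m := m) c) = Measure.map Subtype.val
      ((coordVolume c).comap (Subtype.val : (chartAt (Eucl m) c).target → Eucl m)) := by
    rw [(MeasurableEmbedding.subtype_coe hT).map_comap, Subtype.range_coe, coordVolume,
      restrict_withDensity hT, Measure.restrict_restrict hT, Set.inter_self]
  have h2 : AEMeasurable (chartAt (Eucl m) c).symm (coordVolume (m := m) c) :=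
    (aemeasurable_chart_symm c).mono_ac (withDensity_absolutelyContinuous _ _)
  rw [h1] at h2
  have h3 := AEMeasurable.map_map_of_aemeasurable h2 measurable_subtype_coe.aemeasurable
  rw [← h1] at h3
  exact h3

variable [IsManifold (𝓡 m) ∞ M] [IsContMDiffRiemannianBundle (𝓡 m) ∞ (Eucl m)
      (fun x : M ↦ TangentSpace (𝓡 m) x)]

theorem aemeasurable_volDensity (c : M) :
    AEMeasurable (fun y ↦ volDensity m c y) (volume.restrict (chartAt (Eucl m) c).target) :=
  (contDiffOn_volDensity c).continuousOn.aemeasurable (chartAt (Eucl m) c).open_target.measurableSet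

theorem ae_coordVolume (c : M) :
    ae (coordVolume (m := m) c) = ae (volume.restrict (chartAt (Eucl m) c).target) := by
  refine le_antisymm (withDensity_absolutelyContinuous _ _).ae_le ?_
  refine (withDensity_absolutelyContinuous' (aemeasurable_volDensity c).ennreal_ofReal ?_).ae_le
  refine (ae_restrict_iff' (chartAt (Eucl m) c).open_target.measurableSet).2 (.of_forall ?_)
  intro y hy
  simpa using volDensity_pos c hy

variable [SecondCountableTopology M]

theorem restrict_source_eq_map (c : M) :
    (riemannianVolume m M).restrict (chartAt (Eucl m) c).source = Measure.map
      ((chartAt (Eucl m) c).target.domRestrict (chartAt (Eucl m) c).symm)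
      ((coordVolume c).comap Subtype.val) := by
  rw [riemannianVolume_restrict_source, chartVolume_eq_map]

theorem coordVolume_restrict (c : M) :
    (coordVolume c).restrict (chartAt (Eucl m) c).target = coordVolume (m := m) c := by
  have hT := (chartAt (Eucl m) c).open_target.measurableSet
  rw [coordVolume, restrict_withDensity hT, Measure.restrict_restrict hT, Set.inter_self]

theorem integral_source (c : M) (F : M → ℝ) :
    ∫ x in (chartAt (Eucl m) c).source, F x ∂(riemannianVolume m M)
      = ∫ y in (chartAt (Eucl m) c).target,
          volDensity m c y * F ((chartAt (Eucl m) c).symm y) := by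
  have hT := (chartAt (Eucl m) c).open_target.measurableSet
  rw [restrict_source_eq_map, (measurableEmbedding_chart_symm c).integral_map]
  have := integral_subtype_comap (μ := coordVolume (m := m) c) hT
    (fun y ↦ F ((chartAt (Eucl m) c).symm y))
  refine this.trans ?_
  rw [coordVolume_restrict, coordVolume, integral_withDensity_eq_integral_toReal_smul₀
    (aemeasurable_volDensity c).ennreal_ofReal (by simp)]
  refine integral_congr_ae (.of_forall fun y ↦ ?_)
  simp [volDensity, ENNReal.toReal_ofReal]

theorem lintegral_source (c : M) (F : M → ℝ≥0∞) :
    ∫⁻ x in (chartAt (Eucl m) c).source, F x ∂(riemannianVolume m M)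
      = ∫⁻ y in (chartAt (Eucl m) c).target,
          ENNReal.ofReal (volDensity m c y) * F ((chartAt (Eucl m) c).symm y) := by
  have hT := (chartAt (Eucl m) c).open_target.measurableSet
  rw [restrict_source_eq_map, (measurableEmbedding_chart_symm c).lintegral_map]
  have := lintegral_subtype_comap (μ := coordVolume (m := m) c) hT
    (fun y ↦ F ((chartAt (Eucl m) c).symm y))
  refine this.trans ?_
  rw [coordVolume_restrict, coordVolume, lintegral_withDensity_eq_lintegral_mul_non_measurable₀ _
    (aemeasurable_volDensity c).ennreal_ofReal (by simp)]
  rfl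

theorem ae_source_iff (c : M) (P : M → Prop) :
    (∀ᵐ x ∂((riemannianVolume m M).restrict (chartAt (Eucl m) c).source), P x)
      ↔ ∀ᵐ y ∂(volume.restrict (chartAt (Eucl m) c).target), P ((chartAt (Eucl m) c).symm y) := by
  have hT := (chartAt (Eucl m) c).open_target.measurableSet
  rw [restrict_source_eq_map, (measurableEmbedding_chart_symm c).ae_map_iff, ← ae_coordVolume,
    ← coordVolume_restrict, ← map_comap_subtype_coe hT,
    (MeasurableEmbedding.subtype_coe hT).ae_map_iff, (MeasurableEmbedding.subtype_coe hT).comap_map]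
  rfl

theorem aestronglyMeasurable_source_iff {β : Type*} [TopologicalSpace β]
    [TopologicalSpace.PseudoMetrizableSpace β]
    (c : M) (F : M → β) :
    AEStronglyMeasurable F ((riemannianVolume m M).restrict (chartAt (Eucl m) c).source)
      ↔ AEStronglyMeasurable (fun y ↦ F ((chartAt (Eucl m) c).symm y))
          (volume.restrict (chartAt (Eucl m) c).target) := by
  have hT := (chartAt (Eucl m) c).open_target.measurableSet
  rw [restrict_source_eq_map, (measurableEmbedding_chart_symm c).aestronglyMeasurable_map_iff]
  have h1 : AEStronglyMeasurable (fun y ↦ F ((chartAt (Eucl m) c).symm y))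
          (volume.restrict (chartAt (Eucl m) c).target) ↔
      AEStronglyMeasurable (fun y ↦ F ((chartAt (Eucl m) c).symm y)) (coordVolume (m := m) c) :=
    ⟨fun h ↦ h.mono_ac (by rw [← Measure.ae_le_iff_absolutelyContinuous, ae_coordVolume]),
      fun h ↦ h.mono_ac (by rw [← Measure.ae_le_iff_absolutelyContinuous, ae_coordVolume])⟩
  rw [h1, ← coordVolume_restrict, ← map_comap_subtype_coe hT,
    (MeasurableEmbedding.subtype_coe hT).aestronglyMeasurable_map_iff,
    (MeasurableEmbedding.subtype_coe hT).comap_map]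
  rfl

end VolumeIntegral

/-! ### The Hopf–Rinow theorem -/

section HopfRinow

/-- A Riemannian manifold is a length space: a point at distance less than `L` from `x` can be
approached by first going a distance at most `r`. -/
theorem exists_dist_le_dist_le (m : ℕ) {M : Type*} [MetricSpace M] [ChartedSpace (Eucl m) M]
    [IsManifold (𝓡 m) ∞ M] [RiemannianBundle (fun x : M ↦ TangentSpace (𝓡 m) x)]
    [IsContMDiffRiemannianBundle (𝓡 m) ∞ (Eucl m) (fun x : M ↦ TangentSpace (𝓡 m) x)]
    [IsRiemannianManifold (𝓡 m) M]
    {x y : M} {r L : ℝ} (hr : 0 ≤ r) (hrL : r ≤ L)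
    (h : dist x y < L) : ∃ z : M, dist x z ≤ r ∧ dist z y ≤ L - r := by
  by_cases hxy : dist x y ≤ r
  · exact ⟨y, hxy, by simpa using hrL⟩
  push Not at hxy
  have hL : 0 < L := dist_nonneg.trans_lt h
  have he : riemannianEDist (𝓡 m) x y < ENNReal.ofReal L := by
    rw [← IsRiemannianManifold.out (I := 𝓡 m) x y, edist_dist]
    exact (ENNReal.ofReal_lt_ofReal_iff hL).2 h
  obtain ⟨γ, hγ0, hγ1, hγ, hlen⟩ := exists_lt_of_riemannianEDist_lt he
  have hcont : ContinuousOn (fun t ↦ dist x (γ t)) (Set.Icc 0 1) :=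
    continuous_dist.comp_continuousOn (continuousOn_const.prodMk hγ.continuousOn)
  obtain ⟨t, ht, htr⟩ : ∃ t ∈ Set.Icc (0:ℝ) 1, dist x (γ t) = r := by
    have := intermediate_value_Icc zero_le_one hcont
    exact this ⟨by simpa [hγ0] using hr, by simpa [hγ1] using hxy.le⟩
  refine ⟨γ t, htr.le, ?_⟩
  have h1 := riemannianEDist_le_pathELength (hγ.mono (Set.Icc_subset_Icc le_rfl ht.2)) hγ0 rfl ht.1
  have h2 := riemannianEDist_le_pathELength (hγ.mono (Set.Icc_subset_Icc ht.1 le_rfl)) rfl hγ1 ht.2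
  have h3 := (add_le_add h1 h2).trans_lt ((pathELength_add ht.1 ht.2).trans_lt hlen)
  rw [← IsRiemannianManifold.out (I := 𝓡 m), ← IsRiemannianManifold.out (I := 𝓡 m), edist_dist,
    edist_dist, ← ENNReal.ofReal_add dist_nonneg dist_nonneg,
    ENNReal.ofReal_lt_ofReal_iff hL] at h3
  linarith

/-- The Hopf-Rinow theorem: closed balls of a complete Riemannian manifold are compact. -/
theorem properSpace_of_complete (m : ℕ) {M : Type*} [MetricSpace M] [ChartedSpace (Eucl m) M]
    [IsManifold (𝓡 m) ∞ M] [RiemannianBundle (fun x : M ↦ TangentSpace (𝓡 m) x)]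
    [IsContMDiffRiemannianBundle (𝓡 m) ∞ (Eucl m) (fun x : M ↦ TangentSpace (𝓡 m) x)]
    [IsRiemannianManifold (𝓡 m) M]
    [CompleteSpace M] : ProperSpace M := by
  have : LocallyCompactSpace M := ChartedSpace.locallyCompactSpace (Eucl m) M
  refine ⟨fun x ↦ ?_⟩
  -- if the radii of compact balls were bounded, with supremum `s`, the ball of radius `s` and then
  -- a slightly larger one would be compact
  set S : Set ℝ := {r | 0 ≤ r ∧ IsCompact (Metric.closedBall x r)}
  have hdown : ∀ r ∈ S, ∀ r' ≤ r, IsCompact (Metric.closedBall x r') := fun r hr r' h ↦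
    hr.2.of_isClosed_subset Metric.isClosed_closedBall (Metric.closedBall_subset_closedBall h)
  have h0 : (0:ℝ) ∈ S := ⟨le_rfl, by simp⟩
  by_contra! hcon
  obtain ⟨R, hR⟩ := hcon
  have hbdd : BddAbove S := ⟨R, fun r hr ↦ by
    by_contra! h
    exact hR (hdown r hr R h.le)⟩
  set s := sSup S
  have hs0 : 0 ≤ s := le_csSup hbdd h0
  have hlt : ∀ r < s, IsCompact (Metric.closedBall x r) := fun r hr ↦ by
    obtain ⟨r', hr', h⟩ := exists_lt_of_lt_csSup ⟨0, h0⟩ hr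
    exact hdown r' hr' r h.le
  -- the ball of radius `s` is totally bounded, as it lies close to a slightly smaller ball
  have hs : IsCompact (Metric.closedBall x s) := by
    refine isCompact_iff_totallyBounded_isComplete.2 ⟨?_, Metric.isClosed_closedBall.isComplete⟩
    rcases hs0.eq_or_lt with h | h
    · rw [← h]; simp
    rw [Metric.totallyBounded_iff]
    intro ε hε
    set δ := min (ε / 4) s
    have hδ : 0 < δ := lt_min (by positivity) h
    obtain ⟨t, ht, hcov⟩ := Metric.totallyBounded_iff.1 (hlt (s - δ) (by linarith)).totallyBounded
      (ε / 4) (by positivity)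
    refine ⟨t, ht, fun y hy ↦ ?_⟩
    rw [Metric.mem_closedBall, dist_comm] at hy
    obtain ⟨z, hz1, hz2⟩ := exists_dist_le_dist_le m (x := x) (y := y) (r := s - δ)
      (L := s + δ) (by linarith [min_le_right (ε / 4) s]) (by linarith) (by linarith)
    have hz : z ∈ Metric.closedBall x (s - δ) := by rwa [Metric.mem_closedBall, dist_comm]
    obtain ⟨w, hw, hzw⟩ := Set.mem_iUnion₂.1 (hcov hz)
    refine Set.mem_iUnion₂.2 ⟨w, hw, ?_⟩
    rw [Metric.mem_ball] at hzw ⊢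
    have := dist_triangle y z w
    rw [dist_comm y z] at this
    linarith [min_le_left (ε / 4) s]
  -- a larger ball lies in a compact neighbourhood of the ball of radius `s`
  obtain ⟨δ, hδ, hc⟩ := hs.exists_isCompact_cthickening
  have hbig : IsCompact (Metric.closedBall x (s + δ / 2)) := by
    refine hc.of_isClosed_subset Metric.isClosed_closedBall fun y hy ↦ ?_
    rw [Metric.mem_closedBall, dist_comm] at hy
    obtain ⟨z, hz1, hz2⟩ := exists_dist_le_dist_le m (x := x) (y := y) (r := s)
      (L := s + δ) hs0 (by linarith) (by linarith)
    refine Metric.mem_cthickening_of_dist_le y z δ _ ?_ (by rw [dist_comm]; linarith)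
    rwa [Metric.mem_closedBall, dist_comm]
  have : s + δ / 2 ≤ s := le_csSup hbdd ⟨by positivity, hbig⟩
  linarith

end HopfRinow

/-! ### Lipschitz functions on a Riemannian manifold -/

section Differential

variable {m : ℕ} {M : Type*} [TopologicalSpace M] [ChartedSpace (Eucl m) M]

/-- The differential of a real function, as a covector (zero where the function is not
differentiable). -/
def differential (φ : M → ℝ) (x : M) : TangentSpace (𝓡 m) x →L[ℝ] ℝ :=
  mfderiv (𝓡 m) 𝓘(ℝ, ℝ) φ x

end Differential

section Lipschitz

variable {m : ℕ} {M : Type*} [MetricSpace M] [ChartedSpace (Eucl m) M] [IsManifold (𝓡 m) ∞ M]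
    [RiemannianBundle (fun x : M ↦ TangentSpace (𝓡 m) x)]
    [IsContMDiffRiemannianBundle (𝓡 m) ∞ (Eucl m) (fun x : M ↦ TangentSpace (𝓡 m) x)]
    [IsRiemannianManifold (𝓡 m) M]

theorem continuousOn_norm_chartDeriv (c : M) (v : Eucl m) :
    ContinuousOn (fun y ↦ ‖chartDeriv c y v‖) (chartAt (Eucl m) c).target := by
  have : (fun y ↦ ‖chartDeriv c y v‖) =
      fun y ↦ √(∑ i, ∑ j, v i * v j * metricMatrix m c y i j) := by
    ext y
    rw [← inner_chartDeriv, norm_eq_sqrt_real_inner]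
  rw [this]
  refine ContinuousOn.sqrt (continuousOn_finsetSum _ fun i _ ↦ continuousOn_finsetSum _ fun j _ ↦
    continuousOn_const.mul (contDiffOn_metricMatrix c i j).continuousOn)

/-- The distance of two points in a chart is at most the length of the coordinate segment. -/
theorem dist_chart_symm_le (c : M) {y z : Eucl m} {B : ℝ}
    (hseg : segment ℝ y z ⊆ (chartAt (Eucl m) c).target)
    (hB : ∀ w ∈ segment ℝ y z, ‖chartDeriv c w (z - y)‖ ≤ B) :
    dist ((chartAt (Eucl m) c).symm y) ((chartAt (Eucl m) c).symm z) ≤ B := by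
  have hB0 : 0 ≤ B := (norm_nonneg _).trans (hB y (left_mem_segment ℝ y z))
  -- the image of the segment is a competitor for the Riemannian distance
  set γ : ℝ → M := fun t ↦ (chartAt (Eucl m) c).symm (AffineMap.lineMap y z t)
  have hmem : ∀ t ∈ Set.Icc (0:ℝ) 1, AffineMap.lineMap y z t ∈ segment ℝ y z := by
    intro t ht
    rw [segment_eq_image_lineMap]
    exact ⟨t, ht, rfl⟩
  have hline : ContDiff ℝ ∞ (fun t : ℝ ↦ (AffineMap.lineMap y z t : Eucl m)) := by
    simp only [AffineMap.lineMap_apply_module']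
    fun_prop
  have hγ : ContMDiffOn 𝓘(ℝ, ℝ) (𝓡 m) 1 γ (Set.Icc 0 1) := by
    refine ((contMDiffOn_chart_symm (I := 𝓡 m) (n := ∞) (x := c)).of_le (by simp)).comp
      (hline.contMDiff.of_le (by simp)).contMDiffOn (fun t ht ↦ hseg (hmem t ht))
  have h1 := riemannianEDist_le_pathELength hγ rfl rfl zero_le_one
  rw [pathELength_eq_lintegral_mfderiv_Icc, ← IsRiemannianManifold.out (I := 𝓡 m)] at h1
  have h2 : ∫⁻ t in Set.Icc (0:ℝ) 1, ‖mfderiv 𝓘(ℝ, ℝ) (𝓡 m) γ t 1‖ₑ ≤ ENNReal.ofReal B := by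
    calc _ ≤ ∫⁻ t in Set.Icc (0:ℝ) 1, ENNReal.ofReal B := by
          refine setLIntegral_mono' measurableSet_Icc fun t ht ↦ ?_
          have h3 : mfderiv 𝓘(ℝ, ℝ) (𝓡 m) γ t (1:ℝ) =
              chartDeriv c (AffineMap.lineMap y z t) (z - y) := by
            have h4 := mdifferentiableAt_chart_symm c (hseg (hmem t ht))
            have h5 : HasDerivAt (fun t : ℝ ↦ (AffineMap.lineMap y z t : Eucl m)) (z - y) t :=
              AffineMap.hasDerivAt_lineMap
            have h6 := mfderiv_comp (I := 𝓘(ℝ, ℝ)) (I' := 𝓘(ℝ, Eucl m)) (I'' := 𝓡 m) t h4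
              h5.differentiableAt.mdifferentiableAt
            refine (congrArg (fun L : ℝ →L[ℝ] Eucl m ↦ L 1) h6).trans ?_
            rw [mfderiv_eq_fderiv]
            have h7 : fderiv ℝ (fun t : ℝ ↦ (AffineMap.lineMap y z t : Eucl m)) t 1 = z - y := by
              rw [fderiv_apply_one_eq_deriv, h5.deriv]
            exact congrArg (chartDeriv c (AffineMap.lineMap y z t)) h7
          refine (le_of_eq (congrArg (fun v : TangentSpace (𝓡 m) (γ t) ↦ ‖v‖ₑ) h3)).trans ?_
          rw [← ofReal_norm]
          exact ENNReal.ofReal_le_ofReal (hB _ (hmem t ht))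
      _ = ENNReal.ofReal B := by simp
  have h3 := h1.trans h2
  rw [edist_dist, ENNReal.ofReal_le_ofReal_iff hB0] at h3
  simpa [γ] using h3

theorem differential_chartDeriv {φ : M → ℝ} (c : M) {y : Eucl m}
    (hy : y ∈ (chartAt (Eucl m) c).target)
    (hd : MDifferentiableAt (𝓡 m) 𝓘(ℝ, ℝ) φ ((chartAt (Eucl m) c).symm y)) (v : Eucl m) :
    differential φ _ (chartDeriv c y v) = fderiv ℝ (φ ∘ (chartAt (Eucl m) c).symm) y v := by
  have h2 := mfderiv_comp y hd (mdifferentiableAt_chart_symm c hy)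
  rw [mfderiv_eq_fderiv] at h2
  exact (congrArg (fun L : Eucl m →L[ℝ] ℝ ↦ L v) h2).symm

/-- The differential of a Lipschitz function, measured in the Riemannian norm, is bounded by the
Lipschitz constant. -/
theorem abs_differential_chartDeriv_le {φ : M → ℝ} {C : NNReal} (hφ : LipschitzWith C φ) (c : M)
    {y : Eucl m} (hy : y ∈ (chartAt (Eucl m) c).target) (v : Eucl m) :
    |differential φ _ (chartDeriv c y v)|
      ≤ C * ‖chartDeriv c y v‖ := by
  by_cases hd : MDifferentiableAt (𝓡 m) 𝓘(ℝ, ℝ) φ ((chartAt (Eucl m) c).symm y)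
  swap
  · rw [differential, mfderiv_zero_of_not_mdifferentiableAt hd]
    exact (abs_zero (α := ℝ)).le.trans (by positivity)
  have h1 := mdifferentiableAt_chart_symm c hy
  have hd2 : DifferentiableAt ℝ (φ ∘ (chartAt (Eucl m) c).symm) y :=
    (hd.comp y h1).differentiableAt
  rw [differential_chartDeriv c hy hd]
  have hline : HasDerivAt (fun t : ℝ ↦ (φ ∘ (chartAt (Eucl m) c).symm) (y + t • v))
      (fderiv ℝ (φ ∘ (chartAt (Eucl m) c).symm) y v) 0 := by
    have := hd2.hasFDerivAt.hasLineDerivAt v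
    simpa [HasLineDerivAt] using this
  -- the difference quotients along `v` are bounded by the length of the coordinate segment, and the
  -- norms of its tangent vectors are close to that of `chartDeriv c y v`
  refine le_of_forall_pos_le_add fun ε hε ↦ ?_
  have hcont := (continuousOn_norm_chartDeriv c v).continuousAt
    ((chartAt (Eucl m) c).open_target.mem_nhds hy)
  obtain ⟨r, hr, hball⟩ := Metric.eventually_nhds_iff_ball.1
    ((hcont.eventually (gt_mem_nhds (show ‖chartDeriv c y v‖ < ‖chartDeriv c y v‖ + ε / (C + 1) by
      have : 0 < ε / ((C:ℝ) + 1) := by positivity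
      linarith))).and ((chartAt (Eucl m) c).open_target.mem_nhds hy))
  have hlim := hline.tendsto_slope_zero.abs
  refine le_of_tendsto hlim ?_
  have hsmall : ∀ᶠ t : ℝ in 𝓝[≠] 0, y + t • v ∈ Metric.ball y r := by
    have : Filter.Tendsto (fun t : ℝ ↦ y + t • v) (𝓝 0) (𝓝 (y + (0:ℝ) • v)) := by
      apply Continuous.tendsto; fun_prop
    rw [zero_smul, add_zero] at this
    exact (this.mono_left nhdsWithin_le_nhds) (Metric.ball_mem_nhds y hr)
  filter_upwards [hsmall, self_mem_nhdsWithin] with t ht ht0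
  have hseg : segment ℝ y (y + t • v) ⊆ Metric.ball y r :=
    (convex_ball y r).segment_subset (Metric.mem_ball_self hr) ht
  have h4 : dist ((chartAt (Eucl m) c).symm y) ((chartAt (Eucl m) c).symm (y + t • v)) ≤
      |t| * (‖chartDeriv c y v‖ + ε / (C + 1)) := by
    refine dist_chart_symm_le c (fun w hw ↦ (hball w (hseg hw)).2) fun w hw ↦ ?_
    rw [add_sub_cancel_left, map_smul, norm_smul, Real.norm_eq_abs]
    gcongr
    exact (hball w (hseg hw)).1.le
  have h5 := (hφ.dist_le_mul ((chartAt (Eucl m) c).symm (y + t • v)) ((chartAt (Eucl m) c).symm y))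
  rw [dist_comm] at h4
  have ht' : 0 < |t| := abs_pos.2 ht0
  rw [zero_add, zero_smul, add_zero, smul_eq_mul, abs_mul, abs_inv, ← div_eq_inv_mul,
    div_le_iff₀ ht']
  rw [Real.dist_eq] at h5
  calc _ ≤ _ := h5
    _ ≤ C * (|t| * (‖chartDeriv c y v‖ + ε / (C + 1))) := by gcongr
    _ = |t| * (C * ‖chartDeriv c y v‖ + (C / (C + 1)) * ε) := by ring
    _ ≤ |t| * (C * ‖chartDeriv c y v‖ + 1 * ε) := by
        gcongr
        exact (div_le_one (by positivity)).2 (by linarith)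
    _ = _ := by ring

/-- A Lipschitz function on `M` is Lipschitz in coordinates near a compact subset of a chart. -/
theorem exists_lipschitz_eqOn {φ : M → ℝ} {C : NNReal} (hφ : LipschitzWith C φ) (c : M)
    {K : Set (Eucl m)} (hK : IsCompact K) (hKc : K ⊆ (chartAt (Eucl m) c).target) :
    ∃ (C' : NNReal) (f : Eucl m → ℝ), LipschitzWith C' f ∧
      Set.EqOn f (fun y ↦ φ ((chartAt (Eucl m) c).symm y)) K := by
  -- the coordinate vectors are bounded on a convex neighbourhood, where segments bound the distance
  have hloc : LocallyLipschitzOn K (fun y ↦ φ ((chartAt (Eucl m) c).symm y)) := by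
    intro y hy
    obtain ⟨r, hr, hball⟩ := Metric.nhds_basis_closedBall.mem_iff.1
      ((chartAt (Eucl m) c).open_target.mem_nhds (hKc hy))
    have hbd : ∀ i, ∃ B, ∀ w ∈ Metric.closedBall y r, ‖coordVector m c i w‖ ≤ B := by
      intro i
      obtain ⟨B, hB⟩ := (isCompact_closedBall y r).bddAbove_image
        ((continuousOn_norm_chartDeriv c (EuclideanSpace.single i 1)).mono hball)
      exact ⟨B, fun w hw ↦ hB ⟨w, hw, rfl⟩⟩
    choose B hB using hbd
    have hB0 : ∀ i, 0 ≤ B i := fun i ↦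
      (norm_nonneg _).trans (hB i y (Metric.mem_closedBall_self hr.le))
    refine ⟨(C * ∑ i, B i).toNNReal, Metric.closedBall y r,
      mem_nhdsWithin_of_mem_nhds (Metric.closedBall_mem_nhds y hr), ?_⟩
    have hnn : 0 ≤ (C : ℝ) * ∑ i, B i := mul_nonneg C.2 (Finset.sum_nonneg fun i _ ↦ hB0 i)
    refine LipschitzOnWith.of_dist_le_mul fun z hz w hw ↦ ?_
    rw [Real.coe_toNNReal _ hnn, mul_assoc]
    refine (hφ.dist_le_mul _ _).trans ?_
    gcongr
    have hseg := (convex_closedBall y r).segment_subset hz hw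
    refine dist_chart_symm_le c (hseg.trans hball) fun x hx ↦ ?_
    rw [chartDeriv_apply, Finset.sum_mul]
    refine (norm_sum_le _ _).trans (Finset.sum_le_sum fun i _ ↦ ?_)
    rw [norm_smul, mul_comm, dist_comm, dist_eq_norm]
    refine mul_le_mul (hB i x (hseg hx)) (PiLp.norm_apply_le _ i) (norm_nonneg _) (hB0 i)
  obtain ⟨C', hC'⟩ := hloc.exists_lipschitzOnWith_of_compact hK
  obtain ⟨f, hf, hfe⟩ := hC'.extend_real
  exact ⟨C', f, hf, hfe.symm⟩

end Lipschitz

/-! ### Mollification -/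

section Mollify

variable {m : ℕ}

/-- Smooth bump functions on `ℝ^m`, supported in the ball of radius `1 / (n + 1)`. -/
def bump (m n : ℕ) : ContDiffBump (0 : Eucl m) :=
  ⟨1 / (2 * (n + 1)), 1 / (n + 1), by positivity, by
    rw [div_lt_div_iff₀ (by positivity) (by positivity)]
    have : (0:ℝ) ≤ n := Nat.cast_nonneg n
    linarith⟩

/-- The normalised bump functions. -/
def kernel (m n : ℕ) : Eucl m → ℝ := (bump m n).normed volume

/-- The convolution of `f` with the `n`-th normalised bump function. -/
def mollify (n : ℕ) (f : Eucl m → ℝ) (x : Eucl m) : ℝ :=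
  ∫ z, kernel m n (x - z) * f z

theorem contDiff_kernel (n : ℕ) : ContDiff ℝ ∞ (kernel m n) := (bump m n).contDiff_normed

theorem hasCompactSupport_kernel (n : ℕ) : HasCompactSupport (kernel m n) :=
  (bump m n).hasCompactSupport_normed

theorem kernel_nonneg (n : ℕ) (x : Eucl m) : 0 ≤ kernel m n x := (bump m n).nonneg_normed x

theorem integral_kernel (n : ℕ) : ∫ x, kernel m n x = 1 := (bump m n).integral_normed

theorem tsupport_kernel (n : ℕ) : tsupport (kernel m n) = Metric.closedBall 0 (1 / (n + 1)) :=
  (bump m n).tsupport_normed_eq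

theorem mollify_eq_convolution (n : ℕ) (f : Eucl m → ℝ) :
    mollify n f = convolution (kernel m n) f (ContinuousLinearMap.lsmul ℝ ℝ) volume := by
  ext x
  rw [convolution_eq_swap]
  rfl

theorem mollify_congr_ae (n : ℕ) {f g : Eucl m → ℝ} (h : f =ᵐ[volume] g) :
    mollify n f = mollify n g := by
  ext x
  refine integral_congr_ae ?_
  filter_upwards [h] with z hz
  rw [hz]

theorem contDiff_mollify (n : ℕ) {f : Eucl m → ℝ} (hf : LocallyIntegrable f) :
    ContDiff ℝ ∞ (mollify n f) := by
  rw [mollify_eq_convolution]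
  exact (hasCompactSupport_kernel n).contDiff_convolution_left _ (contDiff_kernel n) hf

theorem integrable_kernel_mul (n : ℕ) {f : Eucl m → ℝ} (hf : LocallyIntegrable f) (x : Eucl m) :
    Integrable (fun z ↦ kernel m n (x - z) * f z) := by
  refine hf.integrable_smul_left_of_hasCompactSupport (g := fun z ↦ kernel m n (x - z)) ?_ ?_
  · exact (contDiff_kernel n).continuous.comp (by fun_prop)
  · exact (hasCompactSupport_kernel n).comp_homeomorph (Homeomorph.subLeft x)

theorem mollify_sub (n : ℕ) {f g : Eucl m → ℝ} (hf : LocallyIntegrable f)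
    (hg : LocallyIntegrable g) : mollify n (f - g) = mollify n f - mollify n g := by
  ext x
  simp only [mollify, Pi.sub_apply, mul_sub]
  exact integral_sub (integrable_kernel_mul n hf x) (integrable_kernel_mul n hg x)

theorem partialDeriv_integral_kernel {k f : Eucl m → ℝ} (hk : ContDiff ℝ ∞ k)
    (hkc : HasCompactSupport k) (hf : LocallyIntegrable f) (i : Fin m) :
    partialDeriv i (fun x ↦ ∫ z, k (x - z) * f z)
      = fun x ↦ ∫ z, partialDeriv i k (x - z) * f z := by
  ext x
  have h := hkc.hasFDerivAt_convolution_left (μ := volume)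
    (ContinuousLinearMap.lsmul ℝ ℝ) (hk.of_le (by simp)) hf x
  have h0 : (fun x ↦ ∫ z, k (x - z) * f z)
      = convolution k f (ContinuousLinearMap.lsmul ℝ ℝ) volume := by
    ext x
    rw [convolution_eq_swap]
    rfl
  rw [h0, partialDeriv, h.fderiv, convolution_eq_swap, ContinuousLinearMap.integral_apply]
  · rfl
  · exact ((hkc.fderiv ℝ).convolutionExists_left _
      (hk.continuous_fderiv (by simp)) hf x).integrable_swap

theorem eLpNorm_two_sq {α : Type*} [MeasurableSpace α] {μ : Measure α} (f : α → ℝ) :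
    eLpNorm f 2 μ ^ 2 = ∫⁻ x, ‖f x‖ₑ ^ 2 ∂μ := by
  have := eLpNorm_nnreal_pow_eq_lintegral (f := f) (μ := μ) (p := 2) (by simp)
  simpa using this

/-- Mollification is an average of translates, hence a contraction of `L²`, by Jensen's inequality
and Fubini's theorem. -/
theorem eLpNorm_mollify_le (n : ℕ) {f : Eucl m → ℝ} (hf : AEStronglyMeasurable f volume) :
    eLpNorm (mollify n f) 2 volume ≤ eLpNorm f 2 volume := by
  wlog hfm : StronglyMeasurable f generalizing f
  · rw [mollify_congr_ae n hf.ae_eq_mk, eLpNorm_congr_ae hf.ae_eq_mk]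
    exact this hf.stronglyMeasurable_mk.aestronglyMeasurable hf.stronglyMeasurable_mk
  set k : Eucl m → ℝ≥0∞ := fun t ↦ ENNReal.ofReal (kernel m n t)
  have hk : Measurable k := (contDiff_kernel n).continuous.measurable.ennreal_ofReal
  set ν : Measure (Eucl m) := volume.withDensity k
  have hν : IsProbabilityMeasure ν := by
    refine ⟨?_⟩
    rw [withDensity_apply _ MeasurableSet.univ, Measure.restrict_univ,
      ← ofReal_integral_eq_lintegral_ofReal, integral_kernel, ENNReal.ofReal_one]
    · exact (bump m n).integrable_normed
    · exact .of_forall (kernel_nonneg n)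
  have hpt : ∀ x, ‖mollify n f x‖ₑ ^ 2 ≤ ∫⁻ t, ‖f (x - t)‖ₑ ^ 2 ∂ν := by
    intro x
    have h1 : ‖mollify n f x‖ₑ ≤ ∫⁻ t, ‖f (x - t)‖ₑ ∂ν := by
      rw [lintegral_withDensity_eq_lintegral_mul _ hk (by fun_prop),
        mollify_eq_convolution]
      refine (enorm_integral_le_lintegral_enorm _).trans (lintegral_mono fun t ↦ ?_)
      rw [ContinuousLinearMap.lsmul_apply, enorm_smul, Pi.mul_apply,
        Real.enorm_of_nonneg (kernel_nonneg n t)]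
    have h2 := eLpNorm_le_eLpNorm_of_exponent_le (μ := ν) (f := fun t ↦ f (x - t))
      (p := 1) (q := 2) (by norm_num)
      (hfm.measurable.comp (measurable_const.sub measurable_id)).aestronglyMeasurable
    rw [eLpNorm_one_eq_lintegral_enorm] at h2
    calc _ ≤ _ := pow_le_pow_left' (h1.trans h2) 2
      _ = _ := eLpNorm_two_sq _
  rw [← ENNReal.pow_le_pow_left_iff two_ne_zero, eLpNorm_two_sq, eLpNorm_two_sq]
  calc _ ≤ ∫⁻ x, (∫⁻ t, ‖f (x - t)‖ₑ ^ 2 ∂ν) ∂volume := lintegral_mono hpt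
    _ = ∫⁻ t, (∫⁻ x, ‖f (x - t)‖ₑ ^ 2 ∂volume) ∂ν := by
        rw [lintegral_lintegral_swap]
        exact ((hfm.measurable.comp (measurable_fst.sub measurable_snd)).enorm.pow_const
          2).aemeasurable
    _ = ∫⁻ t, (∫⁻ x, ‖f x‖ₑ ^ 2 ∂volume) ∂ν := by
        refine lintegral_congr fun t ↦ ?_
        exact lintegral_sub_right_eq_self (fun x ↦ ‖f x‖ₑ ^ 2) t
    _ = _ := by simp

theorem tendsto_eLpNorm_mollify_sub {f : Eucl m → ℝ} (hf : MemLp f 2 volume) :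
    Filter.Tendsto (fun n ↦ eLpNorm (mollify n f - f) 2 volume) Filter.atTop (𝓝 0) := by
  -- first for continuous functions with compact support, which are uniformly continuous
  have hcc : ∀ g : Eucl m → ℝ, Continuous g → HasCompactSupport g →
      Filter.Tendsto (fun n ↦ eLpNorm (mollify n g - g) 2 volume) Filter.atTop (𝓝 0) := by
    intro g hg hgc
    set K := Metric.cthickening 1 (tsupport g)
    have hK : IsCompact K := hgc.isCompact.cthickening
    have hvK : volume K ≠ ⊤ := hK.measure_lt_top.ne
    have hunif := hgc.uniformContinuous_of_continuous hg
    have hbound : ∀ δ > (0:ℝ), ∀ᶠ n in Filter.atTop,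
        eLpNorm (mollify n g - g) 2 volume ≤ ENNReal.ofReal δ * volume K ^ (1 / (2:ℝ)) := by
      intro δ hδ
      obtain ⟨r, hr, hgr⟩ := Metric.uniformContinuous_iff.1 hunif δ hδ
      have hlim : Filter.Tendsto (fun n : ℕ ↦ 1 / ((n : ℝ) + 1)) Filter.atTop (𝓝 0) :=
        tendsto_one_div_add_atTop_nhds_zero_nat
      filter_upwards [hlim.eventually (gt_mem_nhds hr), hlim.eventually (gt_mem_nhds zero_lt_one)]
        with n hn hn1
      have hpt : ∀ x, ‖(mollify n g - g) x‖ ≤ δ := by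
        intro x
        have := (bump m n).dist_normed_convolution_le (μ := volume) (g := g) (x₀ := x) (ε := δ)
          hg.aestronglyMeasurable (fun z hz ↦ (hgr (lt_trans hz hn)).le)
        rw [Pi.sub_apply, ← dist_eq_norm, mollify_eq_convolution]
        exact this
      have hsupp : ∀ x, x ∉ K → (mollify n g - g) x = 0 := by
        intro x hx
        have hz : ∀ z, z ∈ tsupport g → ¬ dist x z ≤ 1 := fun z hz h ↦
          hx (Metric.mem_cthickening_of_dist_le x z 1 _ hz h)
        have hgx : g x = 0 := by
          by_contra h
          exact hz x (subset_tsupport g h) (by simp)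
        rw [Pi.sub_apply, hgx, sub_zero, mollify]
        refine integral_eq_zero_of_ae (.of_forall fun z ↦ ?_)
        by_cases hzs : z ∈ tsupport g
        · have : x - z ∉ tsupport (kernel m n) := by
            rw [tsupport_kernel, mem_closedBall_zero_iff, ← dist_eq_norm]
            exact fun h ↦ hz z hzs (h.trans hn1.le)
          simp [image_eq_zero_of_notMem_tsupport this]
        · simp [image_eq_zero_of_notMem_tsupport hzs]
      have hind : mollify n g - g = K.indicator (mollify n g - g) := by
        ext x
        by_cases hx : x ∈ K
        · rw [Set.indicator_of_mem hx]
        · rw [Set.indicator_of_notMem hx, hsupp x hx]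
      rw [hind, eLpNorm_indicator_eq_eLpNorm_restrict hK.measurableSet]
      refine (eLpNorm_le_of_ae_bound (.of_forall hpt)).trans ?_
      rw [Measure.restrict_apply_univ, mul_comm]
      simp
    rw [ENNReal.tendsto_nhds_zero]
    intro ε hε
    by_cases hεt : ε = ⊤
    · exact .of_forall fun n ↦ hεt ▸ le_top
    set V := (volume K ^ (1 / (2:ℝ))).toReal
    have hV : volume K ^ (1 / (2:ℝ)) = ENNReal.ofReal V :=
      (ENNReal.ofReal_toReal (ENNReal.rpow_ne_top_of_nonneg (by norm_num) hvK)).symm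
    have hε' : 0 < ε.toReal := ENNReal.toReal_pos hε.ne' hεt
    have hV0 : 0 ≤ V := ENNReal.toReal_nonneg
    filter_upwards [hbound (ε.toReal / (V + 1)) (by positivity)] with n hn
    refine hn.trans ?_
    rw [hV, ← ENNReal.ofReal_mul (by positivity), ← ENNReal.ofReal_toReal hεt]
    refine ENNReal.ofReal_le_ofReal ?_
    rw [ENNReal.ofReal_toReal hεt, div_mul_eq_mul_div, div_le_iff₀ (by positivity)]
    nlinarith
  -- the general case by density, since mollification is a contraction
  rw [ENNReal.tendsto_nhds_zero]
  intro ε hε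
  have hε3 : ε / 3 ≠ 0 := (ENNReal.div_pos hε.ne' (by simp)).ne'
  obtain ⟨g, hgc, hfg, hg, hgL⟩ := hf.exists_hasCompactSupport_eLpNorm_sub_le (by simp) hε3
  filter_upwards [(ENNReal.tendsto_nhds_zero.1 (hcc g hg hgc)) (ε / 3) (pos_iff_ne_zero.2 hε3)]
    with n hn
  have hfl := hf.locallyIntegrable (by norm_num)
  have hgl := hgL.locallyIntegrable (by norm_num)
  have hdec : mollify n f - f = mollify n (f - g) + ((mollify n g - g) + (g - f)) := by
    rw [mollify_sub n hfl hgl]; abel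
  have hm : ∀ {h : Eucl m → ℝ}, LocallyIntegrable h → AEStronglyMeasurable (mollify n h) volume :=
    fun hh ↦ (contDiff_mollify n hh).continuous.aestronglyMeasurable
  have h1 : eLpNorm (mollify n (f - g)) 2 volume ≤ ε / 3 :=
    (eLpNorm_mollify_le n (hf.1.sub hgL.1)).trans hfg
  have h2 : eLpNorm (g - f) 2 volume ≤ ε / 3 := by rwa [eLpNorm_sub_comm]
  calc eLpNorm (mollify n f - f) 2 volume
      ≤ eLpNorm (mollify n (f - g)) 2 volume
        + (eLpNorm (mollify n g - g) 2 volume + eLpNorm (g - f) 2 volume) := by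
        rw [hdec]
        refine (eLpNorm_add_le (hm (hfl.sub hgl)) (((hm hgl).sub hgL.1).add (hgL.1.sub hf.1))
          (by norm_num)).trans ?_
        gcongr
        exact eLpNorm_add_le ((hm hgl).sub hgL.1) (hgL.1.sub hf.1) (by norm_num)
    _ ≤ ε / 3 + (ε / 3 + ε / 3) := by gcongr
    _ = ε := by rw [← add_assoc]; exact ENNReal.add_thirds ε

end Mollify

/-! ### Partial derivatives of mollifications -/

section PartialDeriv

variable {m : ℕ}

theorem partialDeriv_mul {f g : Eucl m → ℝ} {x : Eucl m} (hf : DifferentiableAt ℝ f x)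
    (hg : DifferentiableAt ℝ g x) (i : Fin m) :
    partialDeriv i (fun z ↦ f z * g z) x = f x * partialDeriv i g x + g x * partialDeriv i f x := by
  simp [partialDeriv, fderiv_fun_mul hf hg]

theorem partialDeriv_sub {f g : Eucl m → ℝ} {x : Eucl m} (hf : DifferentiableAt ℝ f x)
    (hg : DifferentiableAt ℝ g x) (i : Fin m) :
    partialDeriv i (fun z ↦ f z - g z) x = partialDeriv i f x - partialDeriv i g x := by
  simp [partialDeriv, fderiv_fun_sub hf hg]

theorem contDiff_partialDeriv {f : Eucl m → ℝ} (hf : ContDiff ℝ ∞ f) (i : Fin m) :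
    ContDiff ℝ ∞ (partialDeriv i f) :=
  (hf.fderiv_right (m := ∞) (by simp)).clm_apply contDiff_const

theorem continuous_partialDeriv {f : Eucl m → ℝ} (hf : ContDiff ℝ 1 f) (i : Fin m) :
    Continuous (partialDeriv i f) :=
  (hf.continuous_fderiv (by simp)).clm_apply continuous_const

theorem tsupport_partialDeriv_subset (f : Eucl m → ℝ) (i : Fin m) :
    tsupport (partialDeriv i f) ⊆ tsupport f :=
  tsupport_fderiv_apply_subset ℝ _

theorem hasCompactSupport_partialDeriv {f : Eucl m → ℝ} (hf : HasCompactSupport f) (i : Fin m) :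
    HasCompactSupport (partialDeriv i f) :=
  hf.fderiv_apply (𝕜 := ℝ) _

theorem partialDeriv_comp_sub {f : Eucl m → ℝ} (hf : Differentiable ℝ f) (x z : Eucl m)
    (i : Fin m) : partialDeriv i (fun w ↦ f (x - w)) z = - partialDeriv i f (x - z) := by
  have h := (hf (x - z)).hasFDerivAt.comp z ((hasFDerivAt_id z).const_sub x)
  have h' : fderiv ℝ (fun w ↦ f (x - w)) z = _ := h.fderiv
  rw [partialDeriv, h']
  simp [partialDeriv]

theorem integral_partialDeriv_eq_zero {W : Eucl m → ℝ} (hW : ContDiff ℝ 1 W)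
    (hc : HasCompactSupport W) (i : Fin m) : ∫ x, partialDeriv i W x = 0 := by
  have h1 : Integrable (partialDeriv i W) :=
    (continuous_partialDeriv hW i).integrable_of_hasCompactSupport
      (hasCompactSupport_partialDeriv hc i)
  have h2 : Integrable W := hW.continuous.integrable_of_hasCompactSupport hc
  have h := integral_mul_fderiv_eq_neg_fderiv_mul_of_integrable (μ := (volume : Measure (Eucl m)))
    (𝕜 := ℝ) (f := fun _ ↦ 1) (g := W) (v := EuclideanSpace.single i 1) (by simp)
    (by simp only [one_mul]; exact h1) (by simpa using h2)
    (fun x _ ↦ by fun_prop) (fun x _ ↦ (hW.differentiable (by simp)) x)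
  simpa [partialDeriv] using h

/-- Smooth functions with compact support in `O`. -/
structure IsTest (O : Set (Eucl m)) (η : Eucl m → ℝ) : Prop where
  smooth : ContDiff ℝ ∞ η
  compact : HasCompactSupport η
  support_subset : tsupport η ⊆ O

theorem isTest_kernel (n : ℕ) {O : Set (Eucl m)} {x : Eucl m}
    (hx : Metric.closedBall x (1 / (n + 1)) ⊆ O) : IsTest O (fun z ↦ kernel m n (x - z)) := by
  refine ⟨(contDiff_kernel n).comp (by fun_prop),
    (hasCompactSupport_kernel n).comp_homeomorph (Homeomorph.subLeft x), ?_⟩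
  refine subset_trans (fun z hz ↦ ?_) hx
  have h1 := tsupport_comp_subset_preimage (kernel m n) (f := fun z ↦ x - z) (by fun_prop) hz
  rw [Set.mem_preimage, tsupport_kernel, mem_closedBall_zero_iff, ← dist_eq_norm, dist_comm] at h1
  exact h1

/-- Mollification commutes with weak derivatives, away from the boundary. -/
theorem partialDeriv_mollify_of_weak {O : Set (Eucl m)} {f g : Eucl m → ℝ} {i : Fin m}
    (hf : LocallyIntegrable f)
    (h : ∀ η, IsTest O η → ∫ z, g z * η z = - ∫ z, f z * partialDeriv i η z) (n : ℕ) {x : Eucl m}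
    (hx : Metric.closedBall x (1 / (n + 1)) ⊆ O) :
    partialDeriv i (mollify n f) x = mollify n g x := by
  have h1 := h _ (isTest_kernel n hx)
  have h2 := congrFun (partialDeriv_integral_kernel (contDiff_kernel (m := m) n)
    (hasCompactSupport_kernel n) hf i) x
  calc _ = _ := h2
    _ = - ∫ z, f z * partialDeriv i (fun z ↦ kernel m n (x - z)) z := by
      rw [← integral_neg]
      refine integral_congr_ae (.of_forall fun z ↦ ?_)
      simp only [partialDeriv_comp_sub ((contDiff_kernel n).differentiable (by simp))]
      ring
    _ = _ := by
      rw [← h1]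
      exact integral_congr_ae (.of_forall fun z ↦ mul_comm _ _)

theorem partialDeriv_partialDeriv_mollify (n : ℕ) {f : Eucl m → ℝ} (hf : LocallyIntegrable f)
    (i j : Fin m) : partialDeriv i (partialDeriv j (mollify n f)) =
      fun x ↦ ∫ z, partialDeriv i (partialDeriv j (kernel m n)) (x - z) * f z := by
  have h2 := partialDeriv_integral_kernel (contDiff_kernel (m := m) n)
    (hasCompactSupport_kernel n) hf j
  have h3 : mollify n f = fun x ↦ ∫ z, kernel m n (x - z) * f z := rfl
  rw [h3, h2, partialDeriv_integral_kernel (contDiff_partialDeriv (contDiff_kernel n) j)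
    (hasCompactSupport_partialDeriv (hasCompactSupport_kernel n) j) hf]

theorem partialDeriv_partialDeriv_comp_sub {f : Eucl m → ℝ} (hf : ContDiff ℝ ∞ f) (x z : Eucl m)
    (i j : Fin m) :
    partialDeriv i (partialDeriv j (fun w ↦ f (x - w))) z
      = partialDeriv i (partialDeriv j f) (x - z) := by
  have h1 : partialDeriv j (fun w ↦ f (x - w)) = fun z ↦ - partialDeriv j f (x - z) := by
    ext z; exact partialDeriv_comp_sub (hf.differentiable (by simp)) x z j
  have h2 := partialDeriv_comp_sub
    ((contDiff_partialDeriv hf j).differentiable (by simp)) x z i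
  rw [h1]
  simp only [partialDeriv] at h2 ⊢
  rw [fderiv_fun_neg]
  simp only [neg_apply]
  rw [h2, neg_neg]

/-- Mollification turns the weak equation `∂_i ∂_j u = f` into a classical one. -/
theorem partialDeriv_partialDeriv_mollify_of_weak {O : Set (Eucl m)} {u f : Eucl m → ℝ}
    {i j : Fin m} (hu : LocallyIntegrable u)
    (h : ∀ η, IsTest O η → ∫ z, f z * η z = ∫ z, u z * partialDeriv i (partialDeriv j η) z)
    (n : ℕ) {x : Eucl m} (hx : Metric.closedBall x (1 / (n + 1)) ⊆ O) :
    partialDeriv i (partialDeriv j (mollify n u)) x = mollify n f x := by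
  rw [partialDeriv_partialDeriv_mollify n hu]
  calc _ = ∫ z, u z * partialDeriv i (partialDeriv j (fun z ↦ kernel m n (x - z))) z := by
        refine integral_congr_ae (.of_forall fun z ↦ ?_)
        simp only [partialDeriv_partialDeriv_comp_sub (contDiff_kernel n)]
        ring
    _ = _ := by
      rw [← h _ (isTest_kernel n hx)]
      exact integral_congr_ae (.of_forall fun z ↦ mul_comm _ _)

/-- Mollification turns the weak equation `Δ u = f + div B` into a classical one. -/
theorem laplacian_mollify_of_weak {O : Set (Eucl m)} {u f : Eucl m → ℝ} {B : Fin m → Eucl m → ℝ}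
    (hu : LocallyIntegrable u) (hB : ∀ k, LocallyIntegrable (B k))
    (h : ∀ η, IsTest O η → ∫ z, f z * η z =
      (∑ i, ∫ z, u z * partialDeriv i (partialDeriv i η) z)
        + ∑ k, ∫ z, B k z * partialDeriv k η z)
    (n : ℕ) {x : Eucl m} (hx : Metric.closedBall x (1 / (n + 1)) ⊆ O) :
    ∑ i, partialDeriv i (partialDeriv i (mollify n u)) x
      = mollify n f x + ∑ k, partialDeriv k (mollify n (B k)) x := by
  have h1 : mollify n f x = _ :=
    (integral_congr_ae (.of_forall fun z ↦ mul_comm _ _)).trans (h _ (isTest_kernel n hx))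
  have h2 : ∀ k, partialDeriv k (mollify n (B k)) x
      = - ∫ z, B k z * partialDeriv k (fun z ↦ kernel m n (x - z)) z := by
    intro k
    have h2 := congrFun (partialDeriv_integral_kernel (contDiff_kernel (m := m) n)
      (hasCompactSupport_kernel n) (hB k) k) x
    refine h2.trans ?_
    rw [← integral_neg]
    refine integral_congr_ae (.of_forall fun z ↦ ?_)
    simp only [partialDeriv_comp_sub ((contDiff_kernel n).differentiable (by simp))]
    ring
  have h3 : ∀ i, partialDeriv i (partialDeriv i (mollify n u)) x
      = ∫ z, u z * partialDeriv i (partialDeriv i (fun z ↦ kernel m n (x - z))) z := by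
    intro i
    rw [partialDeriv_partialDeriv_mollify n hu]
    refine integral_congr_ae (.of_forall fun z ↦ ?_)
    simp only [partialDeriv_partialDeriv_comp_sub (contDiff_kernel n)]
    ring
  rw [h1, Finset.sum_congr rfl fun k _ ↦ h2 k, Finset.sum_congr rfl fun k _ ↦ h3 k,
    Finset.sum_neg_distrib]
  ring

end PartialDeriv

/-! ### The Caccioppoli inequality -/

section Energy

variable {m : ℕ}

/-- The Caccioppoli inequality for `Δ v = f + div B`. -/
theorem caccioppoli {φ v f : Eucl m → ℝ} {B : Fin m → Eucl m → ℝ} {A : ℝ}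
    (hφ : ContDiff ℝ ∞ φ) (hφc : HasCompactSupport φ) (hv : ContDiff ℝ ∞ v)
    (hB : ∀ k, ContDiff ℝ ∞ (B k)) (hA : ∀ x, φ x ^ 2 ≤ A)
    (hA' : ∀ k x, partialDeriv k φ x ^ 2 ≤ A)
    (hv2 : Integrable fun x ↦ v x ^ 2) (hf2 : Integrable fun x ↦ f x ^ 2)
    (hB2 : ∀ k, Integrable fun x ↦ B k x ^ 2)
    (heq : ∀ x ∈ tsupport φ, ∑ i, partialDeriv i (partialDeriv i v) x
      = f x + ∑ k, partialDeriv k (B k) x) :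
    ∫ x, φ x ^ 2 * ∑ k, partialDeriv k v x ^ 2 ≤ 2 * (A * (2 + 5 * m)) *
      ((∫ x, v x ^ 2) + (∫ x, f x ^ 2) + ∑ k, ∫ x, B k x ^ 2) := by
  -- `W = φ² v (∇v - B)` has compact support, and its divergence is `φ² |∇v|²` up to terms that
  -- Young's inequality controls
  set W : Fin m → Eucl m → ℝ := fun k x ↦ φ x ^ 2 * (v x * (partialDeriv k v x - B k x))
  have hW : ∀ k, ContDiff ℝ ∞ (W k) := fun k ↦
    (hφ.pow 2).mul (hv.mul ((contDiff_partialDeriv hv k).sub (hB k)))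
  have hWc : ∀ k, HasCompactSupport (W k) := fun k ↦ by
    refine HasCompactSupport.mul_right ?_
    exact hφc.comp_left (g := fun t : ℝ ↦ t ^ 2) (by simp)
  have hWi : ∀ k, Integrable (partialDeriv k (W k)) := fun k ↦
    (contDiff_partialDeriv (hW k) k).continuous.integrable_of_hasCompactSupport
      (hasCompactSupport_partialDeriv (hWc k) k)
  have hW0 : ∫ x, ∑ k, partialDeriv k (W k) x = 0 := by
    rw [integral_finsetSum _ fun k _ ↦ hWi k]
    exact Finset.sum_eq_zero fun k _ ↦
      integral_partialDeriv_eq_zero ((hW k).of_le (by simp)) (hWc k) k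
  have hdW : ∀ k x, partialDeriv k (W k) x
      = φ x ^ 2 * v x * (partialDeriv k (partialDeriv k v) x - partialDeriv k (B k) x)
        + (partialDeriv k v x - B k x) *
          (φ x ^ 2 * partialDeriv k v x + 2 * φ x * partialDeriv k φ x * v x) := by
    intro k x
    have d1 := (hφ.differentiable (by simp)) x
    have d2 := (hv.differentiable (by simp)) x
    have d3 := ((contDiff_partialDeriv hv k).differentiable (by simp)) x
    have d4 := ((hB k).differentiable (by simp)) x
    have e1 : partialDeriv k (fun z ↦ φ z ^ 2) x = 2 * φ x * partialDeriv k φ x := by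
      simp only [pow_two]; rw [partialDeriv_mul d1 d1]; ring
    simp only [W]
    rw [partialDeriv_mul (f := fun z ↦ φ z ^ 2) (g := fun z ↦ v z * (partialDeriv k v z - B k z))
      (d1.pow 2) (d2.mul (d3.sub d4)),
      partialDeriv_mul (g := fun z ↦ partialDeriv k v z - B k z) d2 (d3.sub d4),
      partialDeriv_sub d3 d4, e1]
    ring
  have hsum : ∀ x, ∑ k, partialDeriv k (W k) x = φ x ^ 2 * v x * f x
      + ∑ k, (partialDeriv k v x - B k x) *
          (φ x ^ 2 * partialDeriv k v x + 2 * φ x * partialDeriv k φ x * v x) := by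
    intro x
    simp only [hdW, Finset.sum_add_distrib, ← Finset.mul_sum, Finset.sum_sub_distrib]
    by_cases hx : x ∈ tsupport φ
    · rw [heq x hx]; ring
    · simp [image_eq_zero_of_notMem_tsupport hx]
  have hpt : ∀ x, φ x ^ 2 * ∑ k, partialDeriv k v x ^ 2 ≤ 2 * ∑ k, partialDeriv k (W k) x
      + 2 * (A * (2 + 5 * m)) * (v x ^ 2 + f x ^ 2 + ∑ k, B k x ^ 2) := by
    intro x
    have hA0 : 0 ≤ A := (sq_nonneg _).trans (hA x)
    have hk : ∀ k, φ x ^ 2 * partialDeriv k v x ^ 2 ≤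
        2 * ((partialDeriv k v x - B k x) *
          (φ x ^ 2 * partialDeriv k v x + 2 * φ x * partialDeriv k φ x * v x))
        + 2 * (A * (5 * v x ^ 2 + 2 * B k x ^ 2)) := by
      intro k
      have h1 := mul_le_mul_of_nonneg_right (hA' k x) (sq_nonneg (v x))
      have h2 := mul_le_mul_of_nonneg_right (hA x) (sq_nonneg (B k x))
      nlinarith [sq_nonneg (φ x * partialDeriv k v x + 4 * (partialDeriv k φ x * v x)),
        sq_nonneg (φ x * partialDeriv k v x - 2 * (φ x * B k x)),
        sq_nonneg (φ x * B k x - partialDeriv k φ x * v x)]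
    have hs := Finset.sum_le_sum fun k (_ : k ∈ Finset.univ) ↦ hk k
    simp only [← Finset.mul_sum, Finset.sum_add_distrib, Finset.sum_const, Finset.card_univ,
      Fintype.card_fin, nsmul_eq_mul] at hs
    rw [hsum x]
    have h3 : - (φ x ^ 2 * v x * f x) ≤ A * (v x ^ 2 + f x ^ 2) := by
      have h4 := mul_le_mul_of_nonneg_right (hA x) (add_nonneg (sq_nonneg (v x)) (sq_nonneg (f x)))
      nlinarith [mul_nonneg (sq_nonneg (φ x)) (sq_nonneg (v x + f x)),
        mul_nonneg (sq_nonneg (φ x)) (sq_nonneg (v x)),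
        mul_nonneg (sq_nonneg (φ x)) (sq_nonneg (f x))]
    have hB0 : 0 ≤ ∑ k, B k x ^ 2 := Finset.sum_nonneg fun k _ ↦ sq_nonneg _
    have h5 : 0 ≤ A * m * (∑ k, B k x ^ 2) := by positivity
    have h6 : 0 ≤ A * m * f x ^ 2 := by positivity
    have h7 : 0 ≤ A * v x ^ 2 := by positivity
    have h8 : 0 ≤ A * f x ^ 2 := by positivity
    nlinarith [hs, h3, h5, h6, h7, h8, mul_nonneg hA0 hB0]
  have hBs : Integrable fun x ↦ ∑ k, B k x ^ 2 := integrable_finsetSum _ fun k _ ↦ hB2 k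
  have hWs : Integrable fun x ↦ ∑ k, partialDeriv k (W k) x :=
    integrable_finsetSum _ fun k _ ↦ hWi k
  have hR : Integrable fun x ↦ v x ^ 2 + f x ^ 2 + ∑ k, B k x ^ 2 := (hv2.add hf2).add hBs
  have hL : Integrable fun x ↦ φ x ^ 2 * ∑ k, partialDeriv k v x ^ 2 := by
    refine Continuous.integrable_of_hasCompactSupport ?_ ?_
    · exact (hφ.continuous.pow 2).mul (continuous_finsetSum _ fun k _ ↦
        (contDiff_partialDeriv hv k).continuous.pow 2)
    · refine HasCompactSupport.mul_right ?_
      exact hφc.comp_left (g := fun t : ℝ ↦ t ^ 2) (by simp)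
  refine (integral_mono hL ((hWs.const_mul 2).add (hR.const_mul _)) hpt).trans_eq ?_
  simp only [Pi.add_apply]
  rw [integral_add (hWs.const_mul 2) (hR.const_mul _), integral_const_mul, hW0,
    integral_const_mul, integral_add (f := fun x ↦ v x ^ 2 + f x ^ 2) (hv2.add hf2) hBs,
    integral_add hv2 hf2,
    integral_finsetSum _ fun k _ ↦ hB2 k]
  ring

end Energy

/-! ### Local existence of the gradient -/

section LocalGradient

variable {m : ℕ}

theorem integral_sq_eq {α : Type*} [MeasurableSpace α] {μ : Measure α} {f : α → ℝ}
    (hf : MemLp f 2 μ) : ∫ x, f x ^ 2 ∂μ = (eLpNorm f 2 μ).toReal ^ 2 := by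
  rw [← ENNReal.toReal_pow, eLpNorm_two_sq, integral_eq_lintegral_of_nonneg_ae
    (.of_forall fun x ↦ sq_nonneg _) (hf.1.pow 2)]
  congr 1
  refine lintegral_congr fun x ↦ ?_
  rw [← ofReal_norm, ← ENNReal.ofReal_pow (norm_nonneg _), Real.norm_eq_abs, sq_abs]

theorem memLp_mollify (n : ℕ) {f : Eucl m → ℝ} (hf : MemLp f 2 volume) :
    MemLp (mollify n f) 2 volume :=
  ⟨(contDiff_mollify n (hf.locallyIntegrable (by norm_num))).continuous.aestronglyMeasurable,
    (eLpNorm_mollify_le n hf.1).trans_lt hf.2⟩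

theorem dist_toLp_eq {α : Type*} [MeasurableSpace α] {μ : Measure α} {f g : α → ℝ}
    (hf : MemLp f 2 μ) (hg : MemLp g 2 μ) :
    dist (hf.toLp f) (hg.toLp g) ^ 2 = ∫ x, (f x - g x) ^ 2 ∂μ := by
  rw [dist_edist, Lp.edist_toLp_toLp, ← integral_sq_eq (hf.sub hg)]
  rfl

theorem tendsto_integral_mollify_sub_sq {f : Eucl m → ℝ} (hf : MemLp f 2 volume) :
    Filter.Tendsto (fun n : ℕ × ℕ ↦ ∫ x, (mollify n.1 f x - mollify n.2 f x) ^ 2)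
      Filter.atTop (𝓝 0) := by
  have h1 : Filter.Tendsto (fun n ↦ (memLp_mollify n hf).toLp _) Filter.atTop
      (𝓝 (hf.toLp f)) := by
    rw [tendsto_iff_edist_tendsto_0]
    simp only [Lp.edist_toLp_toLp]
    exact tendsto_eLpNorm_mollify_sub hf
  have h2 := (cauchySeq_iff_tendsto_dist_atTop_0.1 h1.cauchySeq).pow 2
  simpa only [dist_toLp_eq, ne_eq, OfNat.ofNat_ne_zero, not_false_eq_true, zero_pow] using h2

theorem eventually_closedBall_subset {K O : Set (Eucl m)} (hK : IsCompact K) (hO : IsOpen O)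
    (hKO : K ⊆ O) : ∀ᶠ n : ℕ in Filter.atTop,
      ∀ x ∈ K, Metric.closedBall x (1 / ((n:ℝ) + 1)) ⊆ O := by
  obtain ⟨δ, hδ, h⟩ := hK.exists_cthickening_subset_open hO hKO
  filter_upwards [(tendsto_one_div_add_atTop_nhds_zero_nat (𝕜 := ℝ)).eventually (gt_mem_nhds hδ)]
    with n hn x hx y hy
  exact h (Metric.mem_cthickening_of_dist_le y x δ K hx (hy.trans hn.le))

theorem exists_sq_bound {φ : Eucl m → ℝ} (hφ : ContDiff ℝ ∞ φ) (hφc : HasCompactSupport φ) :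
    ∃ A : ℝ, (∀ x, φ x ^ 2 ≤ A) ∧ ∀ k x, partialDeriv k φ x ^ 2 ≤ A := by
  obtain ⟨a, ha⟩ := hφ.continuous.bounded_above_of_compact_support hφc
  have h := fun k ↦ (contDiff_partialDeriv hφ k).continuous.bounded_above_of_compact_support
    (hasCompactSupport_partialDeriv hφc k)
  choose b hb using h
  have hsq : ∀ {s t : ℝ}, ‖s‖ ≤ t → s ^ 2 ≤ t ^ 2 := fun h ↦ by
    rw [← sq_abs]; exact pow_le_pow_left₀ (abs_nonneg _) h 2
  have hs : 0 ≤ ∑ k, b k ^ 2 := Finset.sum_nonneg fun k _ ↦ sq_nonneg _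
  refine ⟨a ^ 2 + ∑ k, b k ^ 2, fun x ↦ ?_, fun k x ↦ ?_⟩
  · linarith [hsq (ha x)]
  · have := Finset.single_le_sum (f := fun k ↦ b k ^ 2) (fun k _ ↦ sq_nonneg _) (Finset.mem_univ k)
    linarith [hsq (hb k x), sq_nonneg a]

/-- A weak solution `u` of `Δ u = f + div B` with square integrable `u`, `f`, `B` has a square
integrable gradient locally, and the mollifications of `u` converge to `u` together with their
gradients. The cutoff function `φ` localises. -/
theorem exists_tendsto_partialDeriv_mollify {O : Set (Eucl m)} (hO : IsOpen O)
    {u f : Eucl m → ℝ} {B : Fin m → Eucl m → ℝ}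
    (hu : MemLp u 2 volume) (hf : MemLp f 2 volume) (hB : ∀ k, MemLp (B k) 2 volume)
    (h : ∀ η, IsTest O η → ∫ z, f z * η z =
      (∑ i, ∫ z, u z * partialDeriv i (partialDeriv i η) z)
        + ∑ k, ∫ z, B k z * partialDeriv k η z)
    {φ : Eucl m → ℝ} (hφ : IsTest O φ) (k : Fin m) :
    ∃ G : Eucl m → ℝ, MemLp G 2 volume ∧
      Filter.Tendsto (fun n ↦ eLpNorm (fun x ↦ φ x * partialDeriv k (mollify n u) x - G x) 2 volume)
        Filter.atTop (𝓝 0) := by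
  have hul := hu.locallyIntegrable (by norm_num)
  have hBl := fun k ↦ (hB k).locallyIntegrable (by norm_num)
  have hfl := hf.locallyIntegrable (by norm_num)
  have hP : ∀ n, MemLp (fun x ↦ φ x * partialDeriv k (mollify n u) x) 2 volume := fun n ↦
    (hφ.smooth.continuous.mul
      (contDiff_partialDeriv (contDiff_mollify n hul) k).continuous).memLp_of_hasCompactSupport
      hφ.compact.mul_right
  obtain ⟨A, hA, hA'⟩ := exists_sq_bound hφ.smooth hφ.compact
  set e : ℕ × ℕ → ℝ := fun n ↦ 2 * (A * (2 + 5 * m)) *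
      ((∫ x, (mollify n.1 u x - mollify n.2 u x) ^ 2)
        + (∫ x, (mollify n.1 f x - mollify n.2 f x) ^ 2)
        + ∑ k, ∫ x, (mollify n.1 (B k) x - mollify n.2 (B k) x) ^ 2)
  have he : Filter.Tendsto e Filter.atTop (𝓝 0) := by
    have := (((tendsto_integral_mollify_sub_sq hu).add (tendsto_integral_mollify_sub_sq hf)).add
      (tendsto_finsetSum Finset.univ fun k _ ↦ tendsto_integral_mollify_sub_sq (hB k))).const_mul
      (2 * (A * (2 + 5 * m)))
    simpa using this
  -- the Caccioppoli inequality for the difference of two mollifications shows that `φ ∂_k u_n` is a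
  -- Cauchy sequence in `L²`
  have hle : ∀ᶠ n : ℕ × ℕ in Filter.atTop,
      dist ((hP n.1).toLp _) ((hP n.2).toLp _) ^ 2 ≤ e n := by
    have hev := eventually_closedBall_subset hφ.compact.isCompact hO hφ.support_subset
    rw [← Filter.prod_atTop_atTop_eq]
    filter_upwards [hev.prod_mk hev] with n hn
    rw [dist_toLp_eq]
    have hd : ∀ j x, partialDeriv j (fun z ↦ mollify n.1 u z - mollify n.2 u z) x
        = partialDeriv j (mollify n.1 u) x - partialDeriv j (mollify n.2 u) x := fun j x ↦
      partialDeriv_sub (((contDiff_mollify n.1 hul).differentiable (by simp)) x)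
        (((contDiff_mollify n.2 hul).differentiable (by simp)) x) j
    have hdB : ∀ j x, partialDeriv j (fun z ↦ mollify n.1 (B j) z - mollify n.2 (B j) z) x
        = partialDeriv j (mollify n.1 (B j)) x - partialDeriv j (mollify n.2 (B j)) x := fun j x ↦
      partialDeriv_sub (((contDiff_mollify n.1 (hBl j)).differentiable (by simp)) x)
        (((contDiff_mollify n.2 (hBl j)).differentiable (by simp)) x) j
    have hv : ContDiff ℝ ∞ fun z ↦ mollify n.1 u z - mollify n.2 u z :=
      (contDiff_mollify n.1 hul).sub (contDiff_mollify n.2 hul)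
    have hc := caccioppoli (φ := φ) (v := fun z ↦ mollify n.1 u z - mollify n.2 u z)
      (f := fun z ↦ mollify n.1 f z - mollify n.2 f z)
      (B := fun j z ↦ mollify n.1 (B j) z - mollify n.2 (B j) z) hφ.smooth hφ.compact hv
      (fun j ↦ (contDiff_mollify n.1 (hBl j)).sub (contDiff_mollify n.2 (hBl j))) hA hA'
      ((memLp_mollify n.1 hu).sub (memLp_mollify n.2 hu)).integrable_sq
      ((memLp_mollify n.1 hf).sub (memLp_mollify n.2 hf)).integrable_sq
      (fun j ↦ ((memLp_mollify n.1 (hB j)).sub (memLp_mollify n.2 (hB j))).integrable_sq) ?_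
    · refine le_trans ?_ hc
      refine integral_mono_of_nonneg (.of_forall fun x ↦ sq_nonneg _) ?_ (.of_forall fun x ↦ ?_)
      · refine Continuous.integrable_of_hasCompactSupport ?_ ?_
        · exact (hφ.smooth.continuous.pow 2).mul (continuous_finsetSum _ fun j _ ↦
            (contDiff_partialDeriv hv j).continuous.pow 2)
        · refine HasCompactSupport.mul_right ?_
          exact hφ.compact.comp_left (g := fun t : ℝ ↦ t ^ 2) (by simp)
      · have := Finset.single_le_sum (f := fun j ↦
          partialDeriv j (fun z ↦ mollify n.1 u z - mollify n.2 u z) x ^ 2)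
          (fun j _ ↦ sq_nonneg _) (Finset.mem_univ k)
        have h2 := mul_le_mul_of_nonneg_left this (sq_nonneg (φ x))
        refine le_trans (le_of_eq ?_) h2
        simp only [hd]
        ring
    · intro x hx
      have e1 := laplacian_mollify_of_weak hul hBl h n.1 (hn.1 x hx)
      have e2 := laplacian_mollify_of_weak hul hBl h n.2 (hn.2 x hx)
      have e3 : ∀ i, partialDeriv i (partialDeriv i
          (fun z ↦ mollify n.1 u z - mollify n.2 u z)) x =
          partialDeriv i (partialDeriv i (mollify n.1 u)) x
            - partialDeriv i (partialDeriv i (mollify n.2 u)) x := by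
        intro i
        have : partialDeriv i (fun z ↦ mollify n.1 u z - mollify n.2 u z) = fun z ↦
          partialDeriv i (mollify n.1 u) z - partialDeriv i (mollify n.2 u) z := funext (hd i)
        rw [this]
        exact partialDeriv_sub
          (((contDiff_partialDeriv (contDiff_mollify n.1 hul) i).differentiable (by simp)) x)
          (((contDiff_partialDeriv (contDiff_mollify n.2 hul) i).differentiable (by simp)) x) i
      simp only [e3, hdB, Finset.sum_sub_distrib]
      rw [e1, e2]
      ring
  have hcauchy : CauchySeq fun n ↦ (hP n).toLp _ := by
    rw [cauchySeq_iff_tendsto_dist_atTop_0]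
    have h1 : Filter.Tendsto (fun n : ℕ × ℕ ↦ dist ((hP n.1).toLp _) ((hP n.2).toLp _) ^ 2)
        Filter.atTop (𝓝 0) :=
      squeeze_zero' (.of_forall fun n ↦ sq_nonneg _) hle he
    have h2 := h1.sqrt
    simpa only [Real.sqrt_sq dist_nonneg, Real.sqrt_zero] using h2
  obtain ⟨G, hG⟩ := cauchySeq_tendsto_of_complete hcauchy
  refine ⟨G, Lp.memLp G, ?_⟩
  rw [tendsto_iff_edist_tendsto_0] at hG
  refine hG.congr fun n ↦ ?_
  rw [Lp.edist_def]
  refine eLpNorm_congr_ae ?_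
  filter_upwards [(hP n).coeFn_toLp] with x hx
  simp [hx]

end LocalGradient

/-! ### Comparison of the Riemannian and the Lebesgue measure on compact sets -/

section VolumeComparison

variable {m : ℕ} {M : Type*} [TopologicalSpace M] [ChartedSpace (Eucl m) M]
  [MeasurableSpace M] [BorelSpace M]
  [RiemannianBundle (fun x : M ↦ TangentSpace (𝓡 m) x)]
  [IsManifold (𝓡 m) ∞ M] [IsContMDiffRiemannianBundle (𝓡 m) ∞ (Eucl m)
      (fun x : M ↦ TangentSpace (𝓡 m) x)]
  [SecondCountableTopology M]

theorem eLpNorm_source (c : M) (p : ℝ≥0∞) (F : M → ℝ) :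
    eLpNorm F p ((riemannianVolume m M).restrict (chartAt (Eucl m) c).source)
      = eLpNorm (fun y ↦ F ((chartAt (Eucl m) c).symm y)) p (coordVolume (m := m) c) := by
  have hT := (chartAt (Eucl m) c).open_target.measurableSet
  rw [restrict_source_eq_map, (measurableEmbedding_chart_symm c).eLpNorm_map_measure,
    ← coordVolume_restrict, ← map_comap_subtype_coe hT,
    (MeasurableEmbedding.subtype_coe hT).eLpNorm_map_measure, 
    (MeasurableEmbedding.subtype_coe hT).comap_map]
  rfl

theorem isCompact_chart_symm_image {c : M} {K : Set (Eucl m)} (hK : IsCompact K)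
    (hKc : K ⊆ (chartAt (Eucl m) c).target) : IsCompact ((chartAt (Eucl m) c).symm '' K) :=
  hK.image_of_continuousOn ((chartAt (Eucl m) c).continuousOn_symm.mono hKc)

theorem chart_symm_image_subset {c : M} {K : Set (Eucl m)}
    (hKc : K ⊆ (chartAt (Eucl m) c).target) :
    (chartAt (Eucl m) c).symm '' K ⊆ (chartAt (Eucl m) c).source := by
  rintro _ ⟨y, hy, rfl⟩
  exact (chartAt (Eucl m) c).map_target (hKc hy)

theorem mem_chart_symm_image_iff {c : M} {K : Set (Eucl m)}
    (hKc : K ⊆ (chartAt (Eucl m) c).target) {y : Eucl m} (hy : y ∈ (chartAt (Eucl m) c).target) :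
    (chartAt (Eucl m) c).symm y ∈ (chartAt (Eucl m) c).symm '' K ↔ y ∈ K := by
  constructor
  · rintro ⟨z, hz, h⟩
    rwa [← (chartAt (Eucl m) c).symm.injOn (hKc hz) hy h]
  · exact fun h ↦ ⟨y, h, rfl⟩

theorem ae_mem_target_coordVolume (c : M) :
    ∀ᵐ y ∂(coordVolume (m := m) c), y ∈ (chartAt (Eucl m) c).target := by
  rw [ae_coordVolume]
  exact ae_restrict_mem (chartAt (Eucl m) c).open_target.measurableSet

variable [T2Space M]

theorem eLpNorm_chart_image {c : M} {K : Set (Eucl m)} (hK : IsCompact K)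
    (hKc : K ⊆ (chartAt (Eucl m) c).target) (p : ℝ≥0∞) (F : M → ℝ) :
    eLpNorm F p ((riemannianVolume m M).restrict ((chartAt (Eucl m) c).symm '' K))
      = eLpNorm (fun y ↦ F ((chartAt (Eucl m) c).symm y)) p
          ((coordVolume (m := m) c).restrict K) := by
  have hm : MeasurableSet ((chartAt (Eucl m) c).symm '' K) :=
    (isCompact_chart_symm_image hK hKc).measurableSet
  have h1 : (riemannianVolume m M).restrict ((chartAt (Eucl m) c).symm '' K)
      = ((riemannianVolume m M).restrict (chartAt (Eucl m) c).source).restrict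
          ((chartAt (Eucl m) c).symm '' K) := by
    rw [Measure.restrict_restrict hm, Set.inter_eq_left.2 (chart_symm_image_subset hKc)]
  rw [h1, ← eLpNorm_indicator_eq_eLpNorm_restrict hm, eLpNorm_source,
    ← eLpNorm_indicator_eq_eLpNorm_restrict hK.measurableSet]
  refine eLpNorm_congr_ae ?_
  filter_upwards [ae_mem_target_coordVolume c] with y hy
  by_cases hyK : y ∈ K
  · rw [Set.indicator_of_mem hyK, Set.indicator_of_mem ((mem_chart_symm_image_iff hKc hy).2 hyK)]
  · rw [Set.indicator_of_notMem hyK,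
      Set.indicator_of_notMem (fun h ↦ hyK ((mem_chart_symm_image_iff hKc hy).1 h))]

theorem restrict_le_coordVolume {c : M} {K : Set (Eucl m)} (hK : IsCompact K)
    (hKc : K ⊆ (chartAt (Eucl m) c).target) :
    ∃ C : ℝ≥0∞, C ≠ ⊤ ∧ volume.restrict K ≤ C • (coordVolume (m := m) c).restrict K := by
  rcases K.eq_empty_or_nonempty with rfl | hne
  · exact ⟨0, by simp, by simp⟩
  obtain ⟨y₀, hy₀, hmin⟩ := hK.exists_isMinOn hne ((contDiffOn_volDensity c).continuousOn.mono hKc)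
  have hw := volDensity_pos c (hKc hy₀)
  refine ⟨(ENNReal.ofReal (volDensity m c y₀))⁻¹, by simpa using hw, ?_⟩
  have hw' : ENNReal.ofReal (volDensity m c y₀) ≠ 0 := by simpa using hw
  refine Measure.le_iff.2 fun S hS ↦ ?_
  rw [Measure.smul_apply, smul_eq_mul, Measure.restrict_apply hS, Measure.restrict_apply hS,
    coordVolume, withDensity_apply _ (hS.inter hK.measurableSet),
    Measure.restrict_restrict (hS.inter hK.measurableSet), Set.inter_assoc,
    Set.inter_eq_left.2 hKc]
  have : ENNReal.ofReal (volDensity m c y₀) * volume (S ∩ K)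
      ≤ ∫⁻ y in S ∩ K, ENNReal.ofReal (volDensity m c y) := by
    rw [← setLIntegral_const]
    exact setLIntegral_mono' (hS.inter hK.measurableSet) fun y hy ↦
      ENNReal.ofReal_le_ofReal (hmin hy.2)
  calc volume (S ∩ K) = (ENNReal.ofReal (volDensity m c y₀))⁻¹ *
        (ENNReal.ofReal (volDensity m c y₀) * volume (S ∩ K)) := by
        rw [← mul_assoc, ENNReal.inv_mul_cancel hw' (by simp), one_mul]
    _ ≤ _ := by gcongr

theorem coordVolume_restrict_le {c : M} {K : Set (Eucl m)} (hK : IsCompact K)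
    (hKc : K ⊆ (chartAt (Eucl m) c).target) :
    ∃ C : ℝ≥0∞, C ≠ ⊤ ∧ (coordVolume (m := m) c).restrict K ≤ C • volume.restrict K := by
  rcases K.eq_empty_or_nonempty with rfl | hne
  · exact ⟨0, by simp, by simp⟩
  obtain ⟨y₀, hy₀, hmax⟩ := hK.exists_isMaxOn hne ((contDiffOn_volDensity c).continuousOn.mono hKc)
  refine ⟨ENNReal.ofReal (volDensity m c y₀), by simp, ?_⟩
  refine Measure.le_iff.2 fun S hS ↦ ?_
  rw [Measure.smul_apply, smul_eq_mul, Measure.restrict_apply hS, Measure.restrict_apply hS,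
    coordVolume, withDensity_apply _ (hS.inter hK.measurableSet),
    Measure.restrict_restrict (hS.inter hK.measurableSet), Set.inter_assoc,
    Set.inter_eq_left.2 hKc, ← setLIntegral_const]
  exact setLIntegral_mono' (hS.inter hK.measurableSet) fun y hy ↦
      ENNReal.ofReal_le_ofReal (hmax hy.2)

theorem eLpNorm_le_of_measure_le {α : Type*} [MeasurableSpace α] {μ ν : Measure α} {C : ℝ≥0∞}
    (hC : C ≠ ⊤) (h : μ ≤ C • ν) (p : ℝ≥0∞) :
    ∃ C' : ℝ≥0∞, C' ≠ ⊤ ∧ ∀ f : α → ℝ, eLpNorm f p μ ≤ C' * eLpNorm f p ν :=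
  ⟨C ^ (1 / p).toReal, ENNReal.rpow_ne_top_of_nonneg ENNReal.toReal_nonneg hC,
    fun f ↦ (eLpNorm_mono_measure f h).trans (eLpNorm_smul_measure_le C f p ν)⟩

/-- On a compact subset of a chart, `L^p`-norms in coordinates are controlled by `L^p`-norms on
`M`. -/
theorem exists_eLpNorm_chart_le {c : M} {K : Set (Eucl m)} (hK : IsCompact K)
    (hKc : K ⊆ (chartAt (Eucl m) c).target) (p : ℝ≥0∞) :
    ∃ C : ℝ≥0∞, C ≠ ⊤ ∧ ∀ F : M → ℝ,
      eLpNorm (fun y ↦ F ((chartAt (Eucl m) c).symm y)) p (volume.restrict K)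
        ≤ C * eLpNorm F p ((riemannianVolume m M).restrict ((chartAt (Eucl m) c).symm '' K)) := by
  obtain ⟨C, hC, hle⟩ := restrict_le_coordVolume hK hKc
  obtain ⟨C', hC', h⟩ := eLpNorm_le_of_measure_le hC hle p
  exact ⟨C', hC', fun F ↦ by rw [eLpNorm_chart_image hK hKc]; exact h _⟩

/-- On a compact subset of a chart, `L^p`-norms on `M` are controlled by `L^p`-norms in
coordinates. -/
theorem exists_eLpNorm_le_chart {c : M} {K : Set (Eucl m)} (hK : IsCompact K)
    (hKc : K ⊆ (chartAt (Eucl m) c).target) (p : ℝ≥0∞) :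
    ∃ C : ℝ≥0∞, C ≠ ⊤ ∧ ∀ F : M → ℝ,
      eLpNorm F p ((riemannianVolume m M).restrict ((chartAt (Eucl m) c).symm '' K))
        ≤ C * eLpNorm (fun y ↦ F ((chartAt (Eucl m) c).symm y)) p (volume.restrict K) := by
  obtain ⟨C, hC, hle⟩ := coordVolume_restrict_le hK hKc
  obtain ⟨C', hC', h⟩ := eLpNorm_le_of_measure_le hC hle p
  exact ⟨C', hC', fun F ↦ by rw [eLpNorm_chart_image hK hKc]; exact h _⟩

theorem memLp_chart {c : M} {K : Set (Eucl m)} (hK : IsCompact K)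
    (hKc : K ⊆ (chartAt (Eucl m) c).target) {p : ℝ≥0∞} {F : M → ℝ}
    (hF : MemLp F p ((riemannianVolume m M).restrict ((chartAt (Eucl m) c).symm '' K))) :
    MemLp (fun y ↦ F ((chartAt (Eucl m) c).symm y)) p (volume.restrict K) := by
  obtain ⟨C, hC, h⟩ := exists_eLpNorm_chart_le (M := M) hK hKc p
  refine ⟨?_, (h F).trans_lt (ENNReal.mul_lt_top hC.lt_top hF.2)⟩
  have hm : MeasurableSet ((chartAt (Eucl m) c).symm '' K) :=
    (isCompact_chart_symm_image hK hKc).measurableSet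
  have h1 := (aestronglyMeasurable_indicator_iff (μ := riemannianVolume m M) hm).2 hF.1
  have h2 := (aestronglyMeasurable_source_iff (m := m) c _).1 h1.restrict
  refine (h2.mono_measure (Measure.restrict_mono_set _ hKc)).congr ?_
  refine (ae_restrict_iff' hK.measurableSet).2 (.of_forall fun y hy ↦ ?_)
  exact Set.indicator_of_mem (Set.mem_image_of_mem _ hy) _

end VolumeComparison

/-! ### Limits of integrals of products -/

section Convergence

variable {α : Type*} [MeasurableSpace α] {μ : Measure α}

theorem eLpNorm_one_mul_le {f g : α → ℝ} (hf : AEStronglyMeasurable f μ)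
    (hg : AEStronglyMeasurable g μ) :
    eLpNorm (fun x ↦ f x * g x) 1 μ ≤ eLpNorm f 2 μ * eLpNorm g 2 μ := by
  have h : eLpNorm (f • g) 1 μ ≤ eLpNorm f 2 μ * eLpNorm g 2 μ :=
    eLpNorm_smul_le_mul_eLpNorm (𝕜 := ℝ) (E := ℝ) (φ := f) (f := g) (p := 2) (q := 2) (r := 1)
      hg hf
  exact h

/-- Products of two `L^2`-convergent sequences and a bounded, pointwise convergent sequence
converge in integral. -/
theorem tendsto_integral_mul_mul {b : ℕ → α → ℝ} {b' : α → ℝ} {f g : ℕ → α → ℝ} {f' g' : α → ℝ}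
    {C : ℝ} (hb : ∀ n, AEStronglyMeasurable (b n) μ) (hbC : ∀ n, ∀ᵐ x ∂μ, |b n x| ≤ C)
    (hbb : ∀ᵐ x ∂μ, Filter.Tendsto (fun n ↦ b n x) Filter.atTop (𝓝 (b' x)))
    (hf : ∀ n, MemLp (f n) 2 μ) (hf' : MemLp f' 2 μ)
    (hff : Filter.Tendsto (fun n ↦ eLpNorm (f n - f') 2 μ) Filter.atTop (𝓝 0))
    (hg : ∀ n, MemLp (g n) 2 μ) (hg' : MemLp g' 2 μ)
    (hgg : Filter.Tendsto (fun n ↦ eLpNorm (g n - g') 2 μ) Filter.atTop (𝓝 0)) :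
    Filter.Tendsto (fun n ↦ ∫ x, b n x * (f n x * g n x) ∂μ) Filter.atTop
      (𝓝 (∫ x, b' x * (f' x * g' x) ∂μ)) := by
  have hb' : AEStronglyMeasurable b' μ := aestronglyMeasurable_of_tendsto_ae _ hb hbb
  have hb'C : ∀ᵐ x ∂μ, |b' x| ≤ C := by
    filter_upwards [hbb, ae_all_iff.2 hbC] with x hx hxC
    exact le_of_tendsto hx.abs (.of_forall hxC)
  have hfg : ∀ n, Integrable (fun x ↦ f n x * g n x) μ := fun n ↦ (hf n).integrable_mul (hg n)
  have hfg' : Integrable (fun x ↦ f' x * g' x) μ := hf'.integrable_mul hg'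
  have hint : ∀ n, Integrable (fun x ↦ b n x * (f n x * g n x)) μ := fun n ↦
    (hfg n).bdd_mul (hb n) (hbC n)
  -- the products `f n * g n` converge in `L^1`
  have hL1 : Filter.Tendsto (fun n ↦ eLpNorm (fun x ↦ f n x * g n x - f' x * g' x) 1 μ)
      Filter.atTop (𝓝 0) := by
    have hbound : ∀ n, eLpNorm (fun x ↦ f n x * g n x - f' x * g' x) 1 μ ≤
        eLpNorm (f n - f') 2 μ * (eLpNorm (g n - g') 2 μ + eLpNorm g' 2 μ)
          + eLpNorm f' 2 μ * eLpNorm (g n - g') 2 μ := by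
      intro n
      have h0 : (fun x ↦ f n x * g n x - f' x * g' x)
          = (fun x ↦ (f n - f') x * g n x) + fun x ↦ f' x * (g n - g') x := by
        ext x; simp only [Pi.add_apply, Pi.sub_apply]; ring
      have h1 : eLpNorm (g n) 2 μ ≤ eLpNorm (g n - g') 2 μ + eLpNorm g' 2 μ := by
        have := eLpNorm_add_le (p := 2) ((hg n).sub hg').1 hg'.1 (by norm_num)
        rwa [sub_add_cancel] at this
      rw [h0]
      refine (eLpNorm_add_le (((hf n).sub hf').1.mul (hg n).1) (hf'.1.mul ((hg n).sub hg').1)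
        le_rfl).trans ?_
      refine add_le_add ((eLpNorm_one_mul_le ((hf n).sub hf').1 (hg n).1).trans ?_)
        (eLpNorm_one_mul_le hf'.1 ((hg n).sub hg').1)
      gcongr
    have hlim : Filter.Tendsto (fun n ↦
        eLpNorm (f n - f') 2 μ * (eLpNorm (g n - g') 2 μ + eLpNorm g' 2 μ)
          + eLpNorm f' 2 μ * eLpNorm (g n - g') 2 μ) Filter.atTop
        (𝓝 (0 * (0 + eLpNorm g' 2 μ) + eLpNorm f' 2 μ * 0)) := by
      refine Filter.Tendsto.add (ENNReal.Tendsto.mul hff (Or.inr ?_)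
        (hgg.add tendsto_const_nhds) (Or.inr (by simp)))
        (ENNReal.Tendsto.const_mul hgg (Or.inr hf'.2.ne))
      simpa using hg'.2.ne
    simp only [zero_mul, mul_zero, add_zero] at hlim
    exact tendsto_of_tendsto_of_tendsto_of_le_of_le tendsto_const_nhds hlim
      (fun _ ↦ zero_le) hbound
  -- by dominated convergence, the bounded factors may be replaced by their limit
  have hDCT : Filter.Tendsto (fun n ↦ ∫⁻ x, ‖(b n x - b' x) * (f' x * g' x)‖ₑ ∂μ)
      Filter.atTop (𝓝 (∫⁻ _, 0 ∂μ)) := by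
    refine tendsto_lintegral_of_dominated_convergence'
      (fun x ↦ ‖(2 * C) * (f' x * g' x)‖ₑ) (fun n ↦ ?_) (fun n ↦ ?_) ?_ ?_
    · exact (((hb n).sub hb').mul hfg'.1).enorm
    · filter_upwards [hbC n, hb'C] with x h1 h2
      rw [enorm_mul, enorm_mul (2 * C)]
      refine mul_le_mul_left ?_ _
      refine enorm_le_iff_norm_le.2 ?_
      rw [Real.norm_eq_abs, Real.norm_eq_abs]
      refine ((abs_sub _ _).trans (by linarith)).trans (le_abs_self (2 * C))
    · exact (hfg'.const_mul (2 * C)).2.ne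
    · filter_upwards [hbb] with x hx
      have h1 : Filter.Tendsto (fun n ↦ (b n x - b' x) * (f' x * g' x)) Filter.atTop (𝓝 0) := by
        simpa using (hx.sub_const (b' x)).mul_const (f' x * g' x)
      simpa using h1.enorm
  rw [lintegral_zero] at hDCT
  refine tendsto_integral_of_L1' _ (hfg'.bdd_mul hb' hb'C).1 (.of_forall hint) ?_
  have hC := fun n ↦ hbC n
  have hfin : Filter.Tendsto (fun n ↦
      ENNReal.ofReal C * eLpNorm (fun x ↦ f n x * g n x - f' x * g' x) 1 μ
        + ∫⁻ x, ‖(b n x - b' x) * (f' x * g' x)‖ₑ ∂μ) Filter.atTop (𝓝 0) := by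
    simpa using (ENNReal.Tendsto.const_mul hL1 (Or.inr ENNReal.ofReal_ne_top)).add hDCT
  refine tendsto_of_tendsto_of_tendsto_of_le_of_le tendsto_const_nhds hfin
      (fun _ ↦ zero_le) fun n ↦ ?_
  have h0 : ((fun x ↦ b n x * (f n x * g n x)) - fun x ↦ b' x * (f' x * g' x))
      = (fun x ↦ b n x * (f n x * g n x - f' x * g' x))
        + fun x ↦ (b n x - b' x) * (f' x * g' x) := by
    ext x; simp only [Pi.add_apply, Pi.sub_apply]; ring
  rw [h0]
  have hm1 : AEStronglyMeasurable (fun x ↦ f n x * g n x - f' x * g' x) μ :=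
    ((hfg n).sub hfg').1
  have hm2 : AEStronglyMeasurable (fun x ↦ b n x * (f n x * g n x - f' x * g' x)) μ :=
    (hb n).mul hm1
  refine (eLpNorm_add_le hm2 (((hb n).sub hb').mul hfg'.1) le_rfl).trans ?_
  refine add_le_add ?_ (eLpNorm_one_eq_lintegral_enorm).le
  rw [eLpNorm_one_eq_lintegral_enorm, eLpNorm_one_eq_lintegral_enorm,
    ← lintegral_const_mul'' _ hm1.enorm]
  refine lintegral_mono_ae ?_
  filter_upwards [hbC n] with x hx
  rw [enorm_mul]
  gcongr
  rw [← ofReal_norm]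
  exact ENNReal.ofReal_le_ofReal hx

theorem tendsto_integral_mul {f : ℕ → α → ℝ} {f' g : α → ℝ}
    (hf : ∀ n, MemLp (f n) 2 μ) (hf' : MemLp f' 2 μ)
    (hff : Filter.Tendsto (fun n ↦ eLpNorm (f n - f') 2 μ) Filter.atTop (𝓝 0))
    (hg : MemLp g 2 μ) :
    Filter.Tendsto (fun n ↦ ∫ x, f n x * g x ∂μ) Filter.atTop (𝓝 (∫ x, f' x * g x ∂μ)) := by
  have := tendsto_integral_mul_mul (μ := μ) (b := fun _ _ ↦ 1) (b' := fun _ ↦ 1) (C := 1)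
    (f := f) (f' := f') (g := fun _ ↦ g) (g' := g)
    (fun n ↦ aestronglyMeasurable_const) (fun n ↦ .of_forall fun x ↦ by simp)
    (.of_forall fun x ↦ tendsto_const_nhds) hf hf' hff (fun n ↦ hg) hg (by simp)
  simpa using this

end Convergence

/-! ### Integration by parts against a test function -/

section Cutoff

variable {m : ℕ}

theorem contDiff_mul_of_tsupport {O : Set (Eucl m)} (hO : IsOpen O) {n : ℕ∞ω} {η f : Eucl m → ℝ}
    (hη : ContDiff ℝ n η) (hs : tsupport η ⊆ O) (hf : ContDiffOn ℝ n f O) :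
    ContDiff ℝ n (fun y ↦ η y * f y) := by
  rw [contDiff_iff_contDiffAt]
  intro y
  by_cases hy : y ∈ tsupport η
  · exact hη.contDiffAt.mul (hf.contDiffAt (hO.mem_nhds (hs hy)))
  · have h0 : (fun y ↦ η y * f y) =ᶠ[𝓝 y] fun _ ↦ 0 := by
      filter_upwards [(isClosed_tsupport η).isOpen_compl.mem_nhds hy] with z hz
      rw [image_eq_zero_of_notMem_tsupport hz, zero_mul]
    exact contDiffAt_const.congr_of_eventuallyEq h0

theorem partialDeriv_eq_zero_of_notMem {η : Eucl m → ℝ} {y : Eucl m} (hy : y ∉ tsupport η)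
    (i : Fin m) : partialDeriv i η y = 0 :=
  image_eq_zero_of_notMem_tsupport fun h ↦ hy (tsupport_partialDeriv_subset η i h)

theorem partialDeriv_mul_of_tsupport {O : Set (Eucl m)} (hO : IsOpen O) {η f : Eucl m → ℝ}
    (hη : ContDiff ℝ 1 η) (hs : tsupport η ⊆ O) (hf : ContDiffOn ℝ 1 f O) (i : Fin m)
    (y : Eucl m) :
    partialDeriv i (fun y ↦ η y * f y) y = η y * partialDeriv i f y + f y * partialDeriv i η y := by
  by_cases hy : y ∈ tsupport η
  · exact partialDeriv_mul ((hη.differentiable (by simp)) y)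
      ((hf.contDiffAt (hO.mem_nhds (hs hy))).differentiableAt (by simp)) i
  · rw [partialDeriv_eq_zero_of_notMem
        (fun h ↦ hy (closure_mono (Function.support_mul_subset_left _ _) h)),
      partialDeriv_eq_zero_of_notMem hy, image_eq_zero_of_notMem_tsupport hy]
    simp

/-- Integration by parts against a test function supported in the domain of smoothness. -/
theorem integral_mul_partialDeriv {O : Set (Eucl m)} (hO : IsOpen O) {η f : Eucl m → ℝ}
    (hη : ContDiff ℝ 1 η) (hηc : HasCompactSupport η) (hs : tsupport η ⊆ O)
    (hf : ContDiffOn ℝ 1 f O) (i : Fin m) :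
    ∫ y, partialDeriv i f y * η y = - ∫ y, f y * partialDeriv i η y := by
  have h0 := integral_partialDeriv_eq_zero (contDiff_mul_of_tsupport hO hη hs hf)
    (hηc.mul_right (f' := f)) i
  have hd := partialDeriv_mul_of_tsupport hO hη hs hf i
  simp only [hd] at h0
  have hc1 : Continuous fun y ↦ partialDeriv i η y * f y := by
    refine continuous_iff_continuousAt.2 fun y ↦ ?_
    by_cases hy : y ∈ tsupport η
    · exact (continuous_partialDeriv hη i).continuousAt.mul
        (hf.continuousOn.continuousAt (hO.mem_nhds (hs hy)))
    · have h0 : (fun y ↦ partialDeriv i η y * f y) =ᶠ[𝓝 y] fun _ ↦ 0 := by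
        filter_upwards [(isClosed_tsupport η).isOpen_compl.mem_nhds hy] with z hz
        rw [partialDeriv_eq_zero_of_notMem hz, zero_mul]
      exact continuousAt_const.congr h0.symm
  have hI1 : Integrable fun y ↦ f y * partialDeriv i η y := by
    simp only [mul_comm (f _)]
    exact hc1.integrable_of_hasCompactSupport (hasCompactSupport_partialDeriv hηc i).mul_right
  have hI : Integrable fun y ↦ η y * partialDeriv i f y + f y * partialDeriv i η y := by
    have : Integrable (partialDeriv i fun y ↦ η y * f y) := (continuous_partialDeriv
      (contDiff_mul_of_tsupport hO hη hs hf) i).integrable_of_hasCompactSupport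
        (hasCompactSupport_partialDeriv (hηc.mul_right (f' := f)) i)
    exact this.congr (.of_forall hd)
  have hI2 : Integrable fun y ↦ partialDeriv i f y * η y := by
    refine (hI.sub hI1).congr (.of_forall fun y ↦ ?_)
    simp only [Pi.sub_apply]; ring
  have h1 : ∫ y, (partialDeriv i f y * η y + f y * partialDeriv i η y) = 0 := by
    rw [← h0]
    refine integral_congr_ae (.of_forall fun y ↦ ?_)
    simp only; ring
  rw [integral_add hI2 hI1] at h1
  linarith

end Cutoff

/-! ### Covectors and vector fields in coordinates -/

section Fields

variable {m : ℕ} {M : Type*} [TopologicalSpace M] [ChartedSpace (Eucl m) M]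
  [RiemannianBundle (fun x : M ↦ TangentSpace (𝓡 m) x)]

/-- Raising an index: the coordinates of the vector dual to the covector with coordinates `ξ`. -/
def raise (c : M) (y : Eucl m) (ξ : Fin m → ℝ) : Eucl m :=
  WithLp.toLp 2 fun i ↦ ∑ j, metricInv m c i j y * ξ j

theorem raise_apply (c : M) (y : Eucl m) (ξ : Fin m → ℝ) (i : Fin m) :
    raise c y ξ i = ∑ j, metricInv m c i j y * ξ j := rfl

/-- The vector field on the domain of the chart around `c` that is dual to the covector field with
components `G`. -/
def coordField (c : M) (G : Fin m → Eucl m → ℝ) (x : M) : TangentSpace (𝓡 m) x :=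
  (chartDeriv c (chartAt (Eucl m) c x) (raise c (chartAt (Eucl m) c x)
    fun j ↦ G j (chartAt (Eucl m) c x)) : Eucl m)

variable [IsManifold (𝓡 m) ∞ M]

theorem metricMatrix_comm (c : M) (y : Eucl m) (i j : Fin m) :
    metricMatrix m c y i j = metricMatrix m c y j i :=
  real_inner_comm (coordVector m c j y) (coordVector m c i y)

theorem sum_metricMatrix_mul_metricInv (c : M) {y : Eucl m}
    (hy : y ∈ (chartAt (Eucl m) c).target) (i k : Fin m) :
    ∑ j, metricMatrix m c y i j * metricInv m c j k y = if i = k then 1 else 0 := by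
  have h := Matrix.mul_nonsing_inv (metricMatrix m c y)
    (posDef_metricMatrix c hy).det_pos.ne'.isUnit
  have := congrFun (congrFun h i) k
  rwa [Matrix.mul_apply, Matrix.one_apply] at this

theorem sum_metricInv_mul_metricMatrix (c : M) {y : Eucl m}
    (hy : y ∈ (chartAt (Eucl m) c).target) (i k : Fin m) :
    ∑ j, metricInv m c i j y * metricMatrix m c y j k = if i = k then 1 else 0 := by
  have h := Matrix.nonsing_inv_mul (metricMatrix m c y)
    (posDef_metricMatrix c hy).det_pos.ne'.isUnit
  have := congrFun (congrFun h i) k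
  rwa [Matrix.mul_apply, Matrix.one_apply] at this

theorem metricInv_comm (c : M) (y : Eucl m) (i j : Fin m) :
    metricInv m c i j y = metricInv m c j i y := by
  have h : (metricMatrix m c y).transpose = metricMatrix m c y := by
    ext i j; exact metricMatrix_comm c y j i
  have h2 := Matrix.transpose_nonsing_inv (metricMatrix m c y)
  rw [h] at h2
  exact (congrFun (congrFun h2 i) j).symm

theorem inner_chartDeriv_raise (c : M) {y : Eucl m} (hy : y ∈ (chartAt (Eucl m) c).target)
    (ξ : Fin m → ℝ) (v : Eucl m) :
    inner ℝ (chartDeriv c y (raise c y ξ)) (chartDeriv c y v) = ∑ i, ξ i * v i := by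
  rw [real_inner_comm, inner_chartDeriv]
  simp only [raise_apply]
  calc ∑ i, ∑ j, v i * (∑ k, metricInv m c j k y * ξ k) * metricMatrix m c y i j
      = ∑ i, v i * ∑ k, (∑ j, metricMatrix m c y i j * metricInv m c j k y) * ξ k := by
        refine Finset.sum_congr rfl fun i _ ↦ ?_
        simp only [Finset.mul_sum, Finset.sum_mul]
        rw [Finset.sum_comm]
        refine Finset.sum_congr rfl fun k _ ↦ Finset.sum_congr rfl fun j _ ↦ ?_
        ring
    _ = ∑ i, ξ i * v i := by
        refine Finset.sum_congr rfl fun i _ ↦ ?_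
        simp only [sum_metricMatrix_mul_metricInv c hy, ite_mul, one_mul, zero_mul,
          Finset.sum_ite_eq, Finset.mem_univ, if_true]
        ring

theorem inner_chartDeriv_raise_coordVector (c : M) {y : Eucl m}
    (hy : y ∈ (chartAt (Eucl m) c).target) (ξ : Fin m → ℝ) (i : Fin m) :
    inner ℝ (chartDeriv c y (raise c y ξ)) (coordVector m c i y) = ξ i := by
  rw [coordVector_eq, inner_chartDeriv_raise c hy]
  simp

theorem norm_sq_chartDeriv_raise (c : M) {y : Eucl m}
    (hy : y ∈ (chartAt (Eucl m) c).target) (ξ : Fin m → ℝ) :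
    ‖chartDeriv c y (raise c y ξ)‖ ^ 2 = ∑ i, ∑ j, metricInv m c i j y * ξ i * ξ j := by
  rw [← real_inner_self_eq_norm_sq, inner_chartDeriv_raise c hy]
  simp only [raise_apply, Finset.mul_sum]
  refine Finset.sum_congr rfl fun i _ ↦ Finset.sum_congr rfl fun j _ ↦ ?_
  ring

theorem chartDeriv_surjective (c : M) {y : Eucl m} (hy : y ∈ (chartAt (Eucl m) c).target) :
    Function.Surjective (chartDeriv c y) :=
  LinearMap.surjective_of_injective (V := Eucl m) (f := (chartDeriv c y).toLinearMap)
    (chartDeriv_injective c hy)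

theorem eq_chartDeriv_raise (c : M) {y : Eucl m} (hy : y ∈ (chartAt (Eucl m) c).target)
    (X : TangentSpace (𝓡 m) ((chartAt (Eucl m) c).symm y)) :
    X = chartDeriv c y (raise c y fun i ↦ inner ℝ X (coordVector m c i y)) := by
  obtain ⟨v, hv⟩ := chartDeriv_surjective c hy
    (X - chartDeriv c y (raise c y fun i ↦ inner ℝ X (coordVector m c i y)))
  rw [← sub_eq_zero, ← inner_self_eq_zero (𝕜 := ℝ)]
  nth_rewrite 2 [← hv]
  rw [chartDeriv_apply c y v, inner_sum]
  refine Finset.sum_eq_zero fun i _ ↦ ?_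
  rw [real_inner_smul_right, inner_sub_left, inner_chartDeriv_raise_coordVector c hy, sub_self,
    mul_zero]

/-- The components of `coordField c' G` in the chart around `c`. -/
theorem inner_coordField (c c' : M) (G : Fin m → Eucl m → ℝ) {y : Eucl m}
    (hy : y ∈ overlap c c') (i : Fin m) :
    inner ℝ (coordField c' G ((chartAt (Eucl m) c).symm y)) (coordVector m c i y)
      = ∑ l, G l (transition c c' y) *
          fderiv ℝ (transition c c') y (EuclideanSpace.single i 1) l := by
  have hz : transition c c' y ∈ (chartAt (Eucl m) c').target :=
    (chartAt (Eucl m) c').map_source hy.2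
  rw [← inner_chartDeriv_raise c' hz]
  refine Eq.trans ?_ (inner_tangent_congr (chart_symm_transition c c' hy).symm _ _)
  exact congrArg (fun b : Eucl m ↦ @inner ℝ (TangentSpace (𝓡 m) ((chartAt (Eucl m) c).symm y)) _
    (coordField c' G ((chartAt (Eucl m) c).symm y)) b) (chartDeriv_transition c c' hy _)

end Fields

/-! ### Weak gradients under changes of coordinates -/

section Transfer

variable {m : ℕ} {M : Type*} [TopologicalSpace M] [T2Space M] [ChartedSpace (Eucl m) M]
  [MeasurableSpace M] [BorelSpace M] [SecondCountableTopology M]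
  [RiemannianBundle (fun x : M ↦ TangentSpace (𝓡 m) x)]
  [IsManifold (𝓡 m) ∞ M] [IsContMDiffRiemannianBundle (𝓡 m) ∞ (Eucl m)
      (fun x : M ↦ TangentSpace (𝓡 m) x)]

theorem transition_image {c c' : M} {S K : Set (Eucl m)} (hS : S ⊆ overlap c c')
    (hSK : ∀ y ∈ S, transition c c' y ∈ K) :
    (chartAt (Eucl m) c).symm '' S ⊆ (chartAt (Eucl m) c').symm '' K := by
  rintro _ ⟨y, hy, rfl⟩
  exact ⟨_, hSK y hy, chart_symm_transition c c' (hS hy)⟩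

/-- Change of variables preserves `L^p`-bounds on compact sets. -/
theorem exists_eLpNorm_transition_le {c c' : M} {S K : Set (Eucl m)} (hS : IsCompact S)
    (hK : IsCompact K) (hKc : K ⊆ (chartAt (Eucl m) c').target)
    (hSc : S ⊆ overlap c c') (hSK : ∀ y ∈ S, transition c c' y ∈ K) (p : ℝ≥0∞) :
    ∃ C : ℝ≥0∞, C ≠ ⊤ ∧ ∀ F : Eucl m → ℝ,
      eLpNorm (fun y ↦ F (transition c c' y)) p (volume.restrict S)
        ≤ C * eLpNorm F p (volume.restrict K) := by
  obtain ⟨C₁, hC₁, h₁⟩ := exists_eLpNorm_chart_le (M := M) hS (fun y hy ↦ (hSc hy).1) p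
  obtain ⟨C₂, hC₂, h₂⟩ := exists_eLpNorm_le_chart (M := M) hK hKc p
  refine ⟨C₁ * C₂, ENNReal.mul_ne_top hC₁ hC₂, fun F ↦ ?_⟩
  refine (h₁ fun x ↦ F (chartAt (Eucl m) c' x)).trans ?_
  rw [mul_assoc]
  gcongr
  refine (eLpNorm_mono_measure _
    (Measure.restrict_mono_set _ (transition_image hSc hSK))).trans ((h₂ _).trans_eq ?_)
  congr 1
  refine eLpNorm_congr_ae ((ae_restrict_iff' hK.measurableSet).2 (.of_forall fun z hz ↦ ?_))
  simp only
  rw [(chartAt (Eucl m) c').right_inv (hKc hz)]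

theorem memLp_transition {c c' : M} {S K : Set (Eucl m)} (hS : IsCompact S)
    (hK : IsCompact K) (hKc : K ⊆ (chartAt (Eucl m) c').target)
    (hSc : S ⊆ overlap c c') (hSK : ∀ y ∈ S, transition c c' y ∈ K) {p : ℝ≥0∞}
    {F : Eucl m → ℝ} (hF : MemLp F p (volume.restrict K)) :
    MemLp (fun y ↦ F (transition c c' y)) p (volume.restrict S) := by
  obtain ⟨C, hC, h⟩ := exists_eLpNorm_transition_le hS hK hKc hSc hSK p
  refine ⟨?_, (h F).trans_lt (ENNReal.mul_lt_top hC.lt_top hF.2)⟩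
  have h1 := (aestronglyMeasurable_indicator_iff hK.measurableSet).2 hF.1
  have h2 : AEStronglyMeasurable (fun x ↦ K.indicator F (chartAt (Eucl m) c' x))
      ((riemannianVolume m M).restrict (chartAt (Eucl m) c').source) := by
    rw [aestronglyMeasurable_source_iff]
    refine h1.restrict.congr ((ae_restrict_iff' (chartAt (Eucl m) c').open_target.measurableSet).2
      (.of_forall fun z hz ↦ ?_))
    simp only
    rw [(chartAt (Eucl m) c').right_inv hz]
  have h3 : AEStronglyMeasurable ((chartAt (Eucl m) c').source.indicator fun x ↦
      K.indicator F (chartAt (Eucl m) c' x)) (riemannianVolume m M) :=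
    (aestronglyMeasurable_indicator_iff (chartAt (Eucl m) c').open_source.measurableSet).2 h2
  have h4 := (aestronglyMeasurable_source_iff (m := m) c _).1 h3.restrict
  refine (h4.mono_measure (Measure.restrict_mono_set _ fun y hy ↦ (hSc hy).1)).congr ?_
  refine (ae_restrict_iff' hS.measurableSet).2 (.of_forall fun y hy ↦ ?_)
  refine (Set.indicator_of_mem (show (chartAt (Eucl m) c).symm y ∈ (chartAt (Eucl m) c').source
    from (hSc hy).2) _).trans ?_
  exact Set.indicator_of_mem (hSK y hy) F

theorem partialDeriv_comp_transition {c c' : M} {V : Eucl m → ℝ} (hV : Differentiable ℝ V)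
    {y : Eucl m} (hy : y ∈ overlap c c') (i : Fin m) :
    partialDeriv i (fun y ↦ V (transition c c' y)) y
      = ∑ l, partialDeriv l V (transition c c' y) *
          fderiv ℝ (transition c c') y (EuclideanSpace.single i 1) l := by
  have h1 := (hV (transition c c' y)).hasFDerivAt.comp y
    (differentiableAt_transition c c' hy).hasFDerivAt
  have h2 : fderiv ℝ (fun y ↦ V (transition c c' y)) y = _ := h1.fderiv
  rw [partialDeriv, h2, ContinuousLinearMap.comp_apply]
  set w := fderiv ℝ (transition c c') y (EuclideanSpace.single i 1)
  have : w = ∑ l, w l • (EuclideanSpace.single l (1:ℝ) : Eucl m) := by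
    ext j; simp [Finset.sum_apply, Pi.single_apply]
  conv_lhs => rw [this]
  simp only [map_sum, map_smul, smul_eq_mul]
  exact Finset.sum_congr rfl fun l _ ↦ mul_comm _ _

theorem continuousOn_fderiv_transition (c c' : M) (v : Eucl m) (l : Fin m) :
    ContinuousOn (fun y ↦ fderiv ℝ (transition c c') y v l) (overlap c c') := by
  have h1 := (contDiffOn_transition (m := m) c c').continuousOn_fderiv_of_isOpen
    (isOpen_overlap (m := m) c c') (by simp)
  have h2 : ContinuousOn (fun y ↦ fderiv ℝ (transition c c') y v) (overlap c c') :=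
    h1.clm_apply continuousOn_const
  exact (EuclideanSpace.proj (𝕜 := ℝ) l).continuous.comp_continuousOn h2

theorem memLp_of_continuousOn {S : Set (Eucl m)} (hS : IsCompact S) {f : Eucl m → ℝ}
    (hf : ContinuousOn f S) (p : ℝ≥0∞) : MemLp f p (volume.restrict S) := by
  obtain ⟨C, hC⟩ := hS.exists_bound_of_continuousOn hf
  have : IsFiniteMeasure (volume.restrict S) := ⟨by
    rw [Measure.restrict_apply_univ]; exact hS.measure_lt_top⟩
  exact MemLp.of_bound (hf.aestronglyMeasurable hS.measurableSet) C
    ((ae_restrict_iff' hS.measurableSet).2 (.of_forall hC))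

/-- If smooth functions `V n` converge in the chart around `c'` to `u`, with gradients converging
to `G`, then the field with components `G` is the weak gradient of `u`, in every chart. -/
theorem integral_coordField_mul {c c' : M} {K : Set (Eucl m)} (hK : IsCompact K)
    (hKc : K ⊆ (chartAt (Eucl m) c').target) {u : M → ℝ} {G : Fin m → Eucl m → ℝ}
    {V : ℕ → Eucl m → ℝ} (hV : ∀ n, ContDiff ℝ ∞ (V n))
    (hu : MemLp (fun z ↦ u ((chartAt (Eucl m) c').symm z)) 2 (volume.restrict K))
    (hG : ∀ l, MemLp (G l) 2 (volume.restrict K))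
    (h1 : Filter.Tendsto (fun n ↦ eLpNorm (fun z ↦ V n z - u ((chartAt (Eucl m) c').symm z)) 2
      (volume.restrict K)) Filter.atTop (𝓝 0))
    (h2 : ∀ l, Filter.Tendsto (fun n ↦ eLpNorm (fun z ↦ partialDeriv l (V n) z - G l z) 2
      (volume.restrict K)) Filter.atTop (𝓝 0))
    {η : Eucl m → ℝ} (hη : IsTest (overlap c c') η)
    (hηK : ∀ y ∈ tsupport η, transition c c' y ∈ K) (i : Fin m) :
    ∫ y, (inner ℝ (coordField c' G ((chartAt (Eucl m) c).symm y)) (coordVector m c i y) : ℝ) * η y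
      = - ∫ y, u ((chartAt (Eucl m) c).symm y) * partialDeriv i η y := by
  set S := tsupport η
  have hS : IsCompact S := hη.compact.isCompact
  have hSc : S ⊆ overlap c c' := hη.support_subset
  obtain ⟨C, hC, hCF⟩ := exists_eLpNorm_transition_le hS hK hKc hSc hηK 2
  set J : Fin m → Eucl m → ℝ := fun l y ↦
    fderiv ℝ (transition c c') y (EuclideanSpace.single i 1) l
  have hη0 : ∀ y, y ∉ S → η y = 0 := fun y hy ↦ image_eq_zero_of_notMem_tsupport hy
  have hdη0 : ∀ y, y ∉ S → partialDeriv i η y = 0 := fun y hy ↦ partialDeriv_eq_zero_of_notMem hy i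
  -- all integrals live on the compact set `S`
  have hres : ∀ F : Eucl m → ℝ, (∀ y, y ∉ S → F y = 0) → ∫ y, F y = ∫ y in S, F y := fun F hF ↦
    (setIntegral_eq_integral_of_forall_compl_eq_zero hF).symm
  have hlim : ∀ {F : ℕ → Eucl m → ℝ} {F' : Eucl m → ℝ},
      Filter.Tendsto (fun n ↦ eLpNorm (fun z ↦ F n z - F' z) 2 (volume.restrict K))
        Filter.atTop (𝓝 0) →
      Filter.Tendsto (fun n ↦ eLpNorm ((fun y ↦ F n (transition c c' y)) -
        fun y ↦ F' (transition c c' y)) 2 (volume.restrict S)) Filter.atTop (𝓝 0) := by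
    intro F F' h
    have h' := ENNReal.Tendsto.const_mul h (Or.inr hC)
    rw [mul_zero] at h'
    exact tendsto_of_tendsto_of_tendsto_of_le_of_le tendsto_const_nhds h'
      (fun _ ↦ zero_le) (fun n ↦ hCF fun z ↦ F n z - F' z)
  have hcont : ∀ {F : Eucl m → ℝ}, Continuous F → MemLp F 2 (volume.restrict K) := fun hF ↦
    memLp_of_continuousOn hK hF.continuousOn 2
  have hL : Filter.Tendsto (fun n ↦ ∑ l, ∫ y in S, partialDeriv l (V n) (transition c c' y)
      * (J l y * η y)) Filter.atTop
      (𝓝 (∑ l, ∫ y in S, G l (transition c c' y) * (J l y * η y))) := by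
    refine tendsto_finsetSum _ fun l _ ↦ tendsto_integral_mul
      (fun n ↦ memLp_transition hS hK hKc hSc hηK
        (hcont (contDiff_partialDeriv (hV n) l).continuous))
      (memLp_transition hS hK hKc hSc hηK (hG l)) (hlim (h2 l)) ?_
    exact memLp_of_continuousOn hS (((continuousOn_fderiv_transition c c' _ l).mono hSc).mul
      hη.smooth.continuous.continuousOn) 2
  have hR : Filter.Tendsto (fun n ↦ - ∫ y in S, V n (transition c c' y) * partialDeriv i η y)
      Filter.atTop (𝓝 (- ∫ y in S, u ((chartAt (Eucl m) c').symm (transition c c' y)) *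
        partialDeriv i η y)) := by
    refine (tendsto_integral_mul
      (fun n ↦ memLp_transition hS hK hKc hSc hηK (hcont (hV n).continuous))
      (memLp_transition (F := fun z ↦ u ((chartAt (Eucl m) c').symm z)) hS hK hKc hSc hηK hu)
      (hlim (F' := fun z ↦ u ((chartAt (Eucl m) c').symm z)) h1) ?_).neg
    exact memLp_of_continuousOn hS
      (contDiff_partialDeriv hη.smooth i).continuous.continuousOn 2
  have hGint : ∀ l, IntegrableOn (fun y ↦ G l (transition c c' y) * (J l y * η y)) S := fun l ↦
    (memLp_transition hS hK hKc hSc hηK (hG l)).integrable_mul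
      (memLp_of_continuousOn hS (((continuousOn_fderiv_transition c c' _ l).mono hSc).mul
      hη.smooth.continuous.continuousOn) 2)
  have hVint : ∀ n l, IntegrableOn (fun y ↦ partialDeriv l (V n) (transition c c' y)
      * (J l y * η y)) S := fun n l ↦
    (memLp_transition hS hK hKc hSc hηK
        (hcont (contDiff_partialDeriv (hV n) l).continuous)).integrable_mul
      (memLp_of_continuousOn hS (((continuousOn_fderiv_transition c c' _ l).mono hSc).mul
      hη.smooth.continuous.continuousOn) 2)
  -- for the smooth functions `V n` the identity is the chain rule and an integration by parts
  have heq : ∀ n, ∑ l, ∫ y in S, partialDeriv l (V n) (transition c c' y) * (J l y * η y)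
      = - ∫ y in S, V n (transition c c' y) * partialDeriv i η y := by
    intro n
    have hVO : ContDiffOn ℝ 1 (fun y ↦ V n (transition c c' y)) (overlap c c') :=
      ((hV n).of_le (by simp)).comp_contDiffOn ((contDiffOn_transition c c').of_le (by simp))
    have h3 := integral_mul_partialDeriv (isOpen_overlap c c') (hη.smooth.of_le (by simp))
      hη.compact hSc hVO i
    rw [hres _ (fun y hy ↦ by rw [hη0 y hy, mul_zero]),
      hres _ (fun y hy ↦ by rw [hdη0 y hy, mul_zero])] at h3
    rw [← h3, ← integral_finsetSum _ fun l _ ↦ hVint n l]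
    refine setIntegral_congr_fun hS.measurableSet fun y hy ↦ ?_
    rw [partialDeriv_comp_transition ((hV n).differentiable (by simp)) (hSc hy), Finset.sum_mul]
    exact Finset.sum_congr rfl fun l _ ↦ by ring
  have hfin := tendsto_nhds_unique (hL.congr heq) hR
  rw [hres _ (fun y hy ↦ by rw [hη0 y hy, mul_zero]),
      hres _ (fun y hy ↦ by rw [hdη0 y hy, mul_zero])]
  rw [← integral_finsetSum _ fun l _ ↦ hGint l] at hfin
  refine Eq.trans (setIntegral_congr_fun hS.measurableSet fun y hy ↦ ?_) (hfin.trans ?_)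
  · rw [inner_coordField c c' G (hSc hy), Finset.sum_mul]
    exact Finset.sum_congr rfl fun l _ ↦ by ring
  · congr 1
    refine setIntegral_congr_fun hS.measurableSet fun y hy ↦ ?_
    rw [chart_symm_transition c c' (hSc hy)]

end Transfer

/-! ### Smoothness of the metric coefficients -/

section Smoothness

variable {m : ℕ} {M : Type*} [TopologicalSpace M] [ChartedSpace (Eucl m) M]
  [RiemannianBundle (fun x : M ↦ TangentSpace (𝓡 m) x)]
  [IsManifold (𝓡 m) ∞ M] [IsContMDiffRiemannianBundle (𝓡 m) ∞ (Eucl m)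
      (fun x : M ↦ TangentSpace (𝓡 m) x)]

theorem contDiffOn_det {E : Type*} [NormedAddCommGroup E] [NormedSpace ℝ E] {n : Type*}
    [Fintype n] [DecidableEq n] {A : E → Matrix n n ℝ} {s : Set E} {k : ℕ∞ω}
    (h : ∀ i j, ContDiffOn ℝ k (fun y ↦ A y i j) s) : ContDiffOn ℝ k (fun y ↦ (A y).det) s := by
  simp only [Matrix.det_apply']
  exact ContDiffOn.sum fun σ _ ↦ contDiffOn_const.mul (contDiffOn_prod fun i _ ↦ h _ _)

theorem contDiffOn_metricInv (c : M) (i j : Fin m) :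
    ContDiffOn ℝ ∞ (metricInv m c i j) (chartAt (Eucl m) c).target := by
  have h : ∀ y, metricInv m c i j y = ((metricMatrix m c y).det)⁻¹ *
      ((metricMatrix m c y).updateRow j (Pi.single i 1)).det := fun y ↦ by
    rw [metricInv, Matrix.inv_def, Matrix.smul_apply, Matrix.adjugate_apply, Ring.inverse_eq_inv',
      smul_eq_mul]
  refine ContDiffOn.congr (ContDiffOn.mul (ContDiffOn.inv
    (contDiffOn_det (contDiffOn_metricMatrix c)) fun y hy ↦ (posDef_metricMatrix c hy).det_pos.ne')
    (contDiffOn_det fun a b ↦ ?_)) fun y _ ↦ h y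
  by_cases hab : a = j
  · subst hab
    simp only [Matrix.updateRow_self]
    exact contDiffOn_const
  · simp only [Matrix.updateRow_ne hab]
    exact contDiffOn_metricMatrix c a b

theorem contDiffOn_partialDeriv {O : Set (Eucl m)} (hO : IsOpen O) {f : Eucl m → ℝ}
    (hf : ContDiffOn ℝ ∞ f O) (i : Fin m) : ContDiffOn ℝ ∞ (partialDeriv i f) O :=
  (hf.fderiv_of_isOpen hO (m := ∞) (by simp)).clm_apply contDiffOn_const

theorem contDiffOn_christoffel (c : M) (k i j : Fin m) :
    ContDiffOn ℝ ∞ (christoffel m c k i j) (chartAt (Eucl m) c).target := by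
  have hO := (chartAt (Eucl m) c).open_target
  exact contDiffOn_const.mul (ContDiffOn.sum fun l _ ↦ (contDiffOn_metricInv c k l).mul
    (((contDiffOn_partialDeriv hO (contDiffOn_metricMatrix c j l) i).add
      (contDiffOn_partialDeriv hO (contDiffOn_metricMatrix c i l) j)).sub
      (contDiffOn_partialDeriv hO (contDiffOn_metricMatrix c i j) l)))

end Smoothness

/-! ### Norm and trace of bilinear forms -/

section Tensor

variable {V : Type*} [NormedAddCommGroup V] [InnerProductSpace ℝ V] [FiniteDimensional ℝ V]

/-- The trace of a bilinear form on a finite-dimensional inner product space. -/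
def tensorTrace (h : V →L[ℝ] V →L[ℝ] ℝ) : ℝ :=
  ∑ a, h (stdOrthonormalBasis ℝ V a) (stdOrthonormalBasis ℝ V a)

theorem tensorNorm_nonneg (h : V →L[ℝ] V →L[ℝ] ℝ) : 0 ≤ tensorNorm h := Real.sqrt_nonneg _

theorem abs_apply_le_tensorNorm (h : V →L[ℝ] V →L[ℝ] ℝ) (v w : V) :
    |h v w| ≤ tensorNorm h * (‖v‖ * ‖w‖) := by
  set e := stdOrthonormalBasis ℝ V
  have hexp : h v w = ∑ q : _ × _, (inner ℝ (e q.1) v * inner ℝ (e q.2) w) * h (e q.1) (e q.2) := by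
    conv_lhs => rw [← e.sum_repr' v, ← e.sum_repr' w]
    simp only [map_sum, map_smul, sum_apply, smul_apply,
      smul_eq_mul, Finset.mul_sum, Fintype.sum_prod_type]
    rw [Finset.sum_comm]
    refine Finset.sum_congr rfl fun a _ ↦ Finset.sum_congr rfl fun b _ ↦ by ring
  have hn : ∀ v : V, ∑ a, (inner ℝ (e a) v) ^ 2 = ‖v‖ ^ 2 := fun v ↦ by
    rw [← e.sum_sq_norm_inner_right v]
    simp [sq_abs]
  have hCS := Finset.sum_mul_sq_le_sq_mul_sq Finset.univ
    (fun q : _ × _ ↦ (inner ℝ (e q.1) v * inner ℝ (e q.2) w : ℝ)) (fun q ↦ h (e q.1) (e q.2))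
  rw [← hexp] at hCS
  have h1 : ∑ q : _ × _, (inner ℝ (e q.1) v * inner ℝ (e q.2) w : ℝ) ^ 2 = (‖v‖ * ‖w‖) ^ 2 := by
    rw [mul_pow, ← hn v, ← hn w, Fintype.sum_prod_type, Finset.sum_mul_sum]
    simp only [mul_pow]
  have h2 : ∑ q : _ × _, (h (e q.1) (e q.2)) ^ 2 = tensorNorm h ^ 2 := by
    rw [tensorNorm, Real.sq_sqrt (by positivity), Fintype.sum_prod_type]
  rw [h1, h2, ← mul_pow] at hCS
  rw [mul_comm]
  exact abs_le_of_sq_le_sq hCS (mul_nonneg (by positivity) (tensorNorm_nonneg h))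

theorem abs_tensorTrace_le (h : V →L[ℝ] V →L[ℝ] ℝ) :
    |tensorTrace h| ≤ Module.finrank ℝ V * tensorNorm h := by
  refine (Finset.abs_sum_le_sum_abs _ _).trans ((Finset.sum_le_card_nsmul _ _ (tensorNorm h)
    fun a _ ↦ (abs_apply_le_tensorNorm h _ _).trans_eq ?_).trans_eq ?_)
  · simp
  · simp

end Tensor

section TensorCoordinates

variable {m : ℕ} {M : Type*} [TopologicalSpace M] [ChartedSpace (Eucl m) M]
  [RiemannianBundle (fun x : M ↦ TangentSpace (𝓡 m) x)]

theorem finrank_tangentSpace (x : M) : Module.finrank ℝ (TangentSpace (𝓡 m) x) = m :=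
  finrank_euclideanSpace_fin

theorem apply_chartDeriv (c : M) (y v w : Eucl m)
    (h : TangentSpace (𝓡 m) ((chartAt (Eucl m) c).symm y) →L[ℝ]
      TangentSpace (𝓡 m) ((chartAt (Eucl m) c).symm y) →L[ℝ] ℝ) :
    h (chartDeriv c y v) (chartDeriv c y w)
      = ∑ i, ∑ j, v i * w j * h (coordVector m c i y) (coordVector m c j y) := by
  rw [chartDeriv_apply, chartDeriv_apply]
  simp only [map_sum, map_smul, sum_apply, smul_apply,
      smul_eq_mul, Finset.mul_sum]
  rw [Finset.sum_comm]
  refine Finset.sum_congr rfl fun a _ ↦ Finset.sum_congr rfl fun b _ ↦ by ring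

variable [IsManifold (𝓡 m) ∞ M]

/-- In coordinates the trace of `h` is `∑ g^{ij} h_ij`. -/
theorem tensorTrace_eq (c : M) {y : Eucl m} (hy : y ∈ (chartAt (Eucl m) c).target)
    (h : TangentSpace (𝓡 m) ((chartAt (Eucl m) c).symm y) →L[ℝ]
      TangentSpace (𝓡 m) ((chartAt (Eucl m) c).symm y) →L[ℝ] ℝ) :
    tensorTrace h
      = ∑ i, ∑ j, metricInv m c i j y * h (coordVector m c i y) (coordVector m c j y) := by
  set e := stdOrthonormalBasis ℝ (TangentSpace (𝓡 m) ((chartAt (Eucl m) c).symm y))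
  set ξ := fun a i ↦ (inner ℝ (e a) (coordVector m c i y) : ℝ)
  have he : ∀ a, e a = chartDeriv c y (raise c y (ξ a)) := fun a ↦ eq_chartDeriv_raise c hy (e a)
  have hcv : ∀ i, coordVector m c i y = ∑ a, ξ a i • e a := fun i ↦
    (e.sum_repr' (coordVector m c i y)).symm
  -- orthonormality of the basis in terms of the inverse metric
  have hδ : ∀ a b, ∑ i, ∑ j, metricInv m c i j y * (ξ a i * ξ b j) = if a = b then 1 else 0 := by
    intro a b
    have h1 := inner_chartDeriv_raise c hy (ξ a) (raise c y (ξ b))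
    rw [← he, ← he, orthonormal_iff_ite.1 e.orthonormal] at h1
    rw [h1]
    refine Finset.sum_congr rfl fun i _ ↦ ?_
    rw [raise_apply, Finset.mul_sum]
    exact Finset.sum_congr rfl fun j _ ↦ by ring
  have hexp : ∀ i j, h (coordVector m c i y) (coordVector m c j y)
      = ∑ a, ∑ b, ξ a i * ξ b j * h (e a) (e b) := by
    intro i j
    rw [hcv i, hcv j]
    simp only [map_sum, map_smul, sum_apply, smul_apply,
      smul_eq_mul, Finset.mul_sum]
    rw [Finset.sum_comm]
    refine Finset.sum_congr rfl fun a _ ↦ Finset.sum_congr rfl fun b _ ↦ by ring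
  calc tensorTrace h = ∑ a, ∑ b, (if a = b then 1 else 0) * h (e a) (e b) := by
        simp [tensorTrace, e]
    _ = ∑ a, ∑ b, ∑ i, ∑ j, metricInv m c i j y * (ξ a i * ξ b j * h (e a) (e b)) := by
        refine Finset.sum_congr rfl fun a _ ↦ Finset.sum_congr rfl fun b _ ↦ ?_
        rw [← hδ, Finset.sum_mul]
        refine Finset.sum_congr rfl fun i _ ↦ ?_
        rw [Finset.sum_mul]
        exact Finset.sum_congr rfl fun j _ ↦ by ring
    _ = _ := by
        simp only [hexp, Finset.mul_sum]
        rw [Finset.sum_congr rfl fun a _ ↦ Finset.sum_comm, Finset.sum_comm]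
        refine Finset.sum_congr rfl fun i _ ↦ ?_
        rw [Finset.sum_congr rfl fun a _ ↦ Finset.sum_comm, Finset.sum_comm]

end TensorCoordinates

/-! ### The gradient of a function with square integrable Hessian, in a chart -/

section LocalGradientExistence

variable {m : ℕ}

/-- `F` is square integrable on the compact subsets of `O`. -/
def LocallySq (O : Set (Eucl m)) (F : Eucl m → ℝ) : Prop :=
  ∀ K, IsCompact K → K ⊆ O → MemLp F 2 (volume.restrict K)

theorem exists_isTest_eq_one {K O : Set (Eucl m)} (hK : IsCompact K) (hO : IsOpen O)
    (hKO : K ⊆ O) : ∃ φ : Eucl m → ℝ, IsTest O φ ∧ ∀ x ∈ K, φ x = 1 := by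
  obtain ⟨K', hK', hKK', hK'O⟩ := exists_compact_between hK hO hKO
  obtain ⟨f, hf1, hf0, -⟩ := exists_contMDiffMap_one_nhds_of_subset_interior (n := (⊤ : ℕ∞))
    𝓘(ℝ, Eucl m) hK.isClosed hKK'
  have hsub : tsupport f ⊆ K' := closure_minimal
    (fun x hx ↦ by by_contra h; exact hx (hf0 x h)) hK'.isClosed
  refine ⟨f, ⟨f.contMDiff.contDiff, hK'.of_isClosed_subset (isClosed_tsupport _) hsub,
    hsub.trans hK'O⟩, fun x hx ↦ ?_⟩
  exact (hf1.filter_mono (nhds_le_nhdsSet hx)).self_of_nhds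

theorem LocallySq.continuousOn_mul {O : Set (Eucl m)} {F g : Eucl m → ℝ} (hF : LocallySq O F)
    (hg : ContinuousOn g O) : LocallySq O (fun y ↦ g y * F y) := fun K hK hKO ↦
  MemLp.mul (p := ∞) (q := 2) (hF K hK hKO) (memLp_of_continuousOn hK (hg.mono hKO) ∞)

theorem LocallySq.add {O : Set (Eucl m)} {F G : Eucl m → ℝ} (hF : LocallySq O F)
    (hG : LocallySq O G) : LocallySq O (fun y ↦ F y + G y) := fun K hK hKO ↦
  (hF K hK hKO).add (hG K hK hKO)

theorem LocallySq.sub {O : Set (Eucl m)} {F G : Eucl m → ℝ} (hF : LocallySq O F)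
    (hG : LocallySq O G) : LocallySq O (fun y ↦ F y - G y) := fun K hK hKO ↦
  (hF K hK hKO).sub (hG K hK hKO)

theorem LocallySq.sum {ι : Type*} (s : Finset ι) {O : Set (Eucl m)} {F : ι → Eucl m → ℝ}
    (hF : ∀ i ∈ s, LocallySq O (F i)) : LocallySq O (fun y ↦ ∑ i ∈ s, F i y) := fun K hK hKO ↦
  memLp_finsetSum s fun i hi ↦ hF i hi K hK hKO

theorem LocallySq.integrableOn_mul {O : Set (Eucl m)} {F g : Eucl m → ℝ} (hF : LocallySq O F)
    (hg : ContinuousOn g O) {K : Set (Eucl m)} (hK : IsCompact K) (hKO : K ⊆ O) :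
    IntegrableOn (fun y ↦ F y * g y) K :=
  (hF K hK hKO).integrable_mul (memLp_of_continuousOn hK (hg.mono hKO) 2)

theorem LocallySq.memLp_indicator {O : Set (Eucl m)} {F : Eucl m → ℝ} (hF : LocallySq O F)
    {K : Set (Eucl m)} (hK : IsCompact K) (hKO : K ⊆ O) : MemLp (K.indicator F) 2 volume :=
  (memLp_indicator_iff_restrict hK.measurableSet).2 (hF K hK hKO)

theorem integral_indicator_mul {K : Set (Eucl m)} {F g : Eucl m → ℝ}
    (hg : ∀ y, y ∉ K → g y = 0) : ∫ y, K.indicator F y * g y = ∫ y, F y * g y := by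
  refine integral_congr_ae (.of_forall fun y ↦ ?_)
  by_cases hy : y ∈ K
  · simp [hy]
  · simp [hg y hy]

theorem integral_mul_eq_setIntegral {K : Set (Eucl m)} {F g : Eucl m → ℝ}
    (hg : ∀ y, y ∉ K → g y = 0) : ∫ y, F y * g y = ∫ y in K, F y * g y :=
  (setIntegral_eq_integral_of_forall_compl_eq_zero fun y hy ↦ by rw [hg y hy, mul_zero]).symm

variable {M : Type*} [TopologicalSpace M] [ChartedSpace (Eucl m) M]
  [RiemannianBundle (fun x : M ↦ TangentSpace (𝓡 m) x)]
  [IsManifold (𝓡 m) ∞ M] [IsContMDiffRiemannianBundle (𝓡 m) ∞ (Eucl m)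
      (fun x : M ↦ TangentSpace (𝓡 m) x)]

/-- The diagonal part of the Hessian equation, summed up, is an equation `Δ u = f + div B` for the
flat Laplacian, with `f` and `B` of order zero in `u`. -/
theorem integral_sum_hessian {u : M → ℝ}
    {h : ∀ x : M, TangentSpace (𝓡 m) x →L[ℝ] TangentSpace (𝓡 m) x →L[ℝ] ℝ}
    (hh : IsWeakHessian m u h) (c : M)
    (hu : LocallySq (chartAt (Eucl m) c).target fun y ↦ u ((chartAt (Eucl m) c).symm y))
    (hh2 : ∀ i j, LocallySq (chartAt (Eucl m) c).target fun y ↦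
      h ((chartAt (Eucl m) c).symm y) (coordVector m c i y) (coordVector m c j y))
    {K : Set (Eucl m)} (hK : IsCompact K) (hKc : K ⊆ (chartAt (Eucl m) c).target)
    {η : Eucl m → ℝ} (hη : IsTest (interior K) η) :
    ∫ y, K.indicator (fun y ↦
        (∑ i, h ((chartAt (Eucl m) c).symm y) (coordVector m c i y) (coordVector m c i y))
          - ∑ i, ∑ k, partialDeriv k (christoffel m c k i i) y *
              u ((chartAt (Eucl m) c).symm y)) y * η y
      = (∑ i, ∫ y, K.indicator (fun y ↦ u ((chartAt (Eucl m) c).symm y)) y *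
            partialDeriv i (partialDeriv i η) y)
        + ∑ k, ∫ y, K.indicator (fun y ↦ ∑ i, christoffel m c k i i y *
            u ((chartAt (Eucl m) c).symm y)) y * partialDeriv k η y := by
  set T := (chartAt (Eucl m) c).target
  have hO : IsOpen T := (chartAt (Eucl m) c).open_target
  set U : Eucl m → ℝ := fun y ↦ u ((chartAt (Eucl m) c).symm y)
  set H : Fin m → Fin m → Eucl m → ℝ := fun i j y ↦
    h ((chartAt (Eucl m) c).symm y) (coordVector m c i y) (coordVector m c j y)
  have hsK : tsupport η ⊆ K := hη.support_subset.trans interior_subset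
  have z0 : ∀ y, y ∉ K → η y = 0 := fun y hy ↦ image_eq_zero_of_notMem_tsupport fun h ↦ hy (hsK h)
  have z1 : ∀ k y, y ∉ K → partialDeriv k η y = 0 := fun k y hy ↦
    partialDeriv_eq_zero_of_notMem (fun h ↦ hy (hsK h)) k
  have z2 : ∀ k l y, y ∉ K → partialDeriv k (partialDeriv l η) y = 0 := fun k l y hy ↦
    partialDeriv_eq_zero_of_notMem (fun h ↦ hy (hsK (tsupport_partialDeriv_subset _ _ h))) k
  rw [integral_indicator_mul z0, integral_mul_eq_setIntegral z0]
  simp only [integral_indicator_mul (z1 _), integral_indicator_mul (z2 _ _),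
    integral_mul_eq_setIntegral (z1 _), integral_mul_eq_setIntegral (z2 _ _)]
  have c0 : ContinuousOn η T := hη.smooth.continuous.continuousOn
  have c1 : ∀ k, ContinuousOn (partialDeriv k η) T := fun k ↦
    (contDiff_partialDeriv hη.smooth k).continuous.continuousOn
  have c2 : ∀ k l, ContinuousOn (partialDeriv k (partialDeriv l η)) T := fun k l ↦
    (contDiff_partialDeriv (contDiff_partialDeriv hη.smooth l) k).continuous.continuousOn
  have cΓ : ∀ k i, ContinuousOn (christoffel m c k i i) T := fun k i ↦
    (contDiffOn_christoffel c k i i).continuousOn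
  have cdΓ : ∀ k i, ContinuousOn (partialDeriv k (christoffel m c k i i)) T := fun k i ↦
    (contDiffOn_partialDeriv hO (contDiffOn_christoffel c k i i) k).continuousOn
  have i0 : ∀ i, IntegrableOn (fun y ↦ H i i y * η y) K := fun i ↦
    (hh2 i i).integrableOn_mul c0 hK hKc
  have i2 : ∀ i, IntegrableOn (fun y ↦ U y * partialDeriv i (partialDeriv i η) y) K := fun i ↦
    hu.integrableOn_mul (c2 i i) hK hKc
  have i3 : ∀ i k, IntegrableOn (fun y ↦
      partialDeriv k (christoffel m c k i i) y * U y * η y) K := fun i k ↦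
    (hu.continuousOn_mul (cdΓ k i)).integrableOn_mul c0 hK hKc
  have i1 : ∀ i k, IntegrableOn (fun y ↦
      christoffel m c k i i y * U y * partialDeriv k η y) K := fun i k ↦
    (hu.continuousOn_mul (cΓ k i)).integrableOn_mul (c1 k) hK hKc
  -- the equation for `h_ii`, with the derivative of `Γ^k_ii η` expanded by the product rule
  have key : ∀ i, ∫ y in K, H i i y * η y
      = (∫ y in K, U y * partialDeriv i (partialDeriv i η) y)
        + ((∑ k, ∫ y in K, partialDeriv k (christoffel m c k i i) y * U y * η y)
        + ∑ k, ∫ y in K, christoffel m c k i i y * U y * partialDeriv k η y) := by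
    intro i
    have h1 := hh.integral_eq c η ⟨hη.smooth, hη.compact, hsK.trans hKc⟩ i i
    rw [integral_mul_eq_setIntegral z0] at h1
    refine h1.trans ?_
    have hd : ∀ k y, partialDeriv k (fun z ↦ christoffel m c k i i z * η z) y
        = η y * partialDeriv k (christoffel m c k i i) y
          + christoffel m c k i i y * partialDeriv k η y := by
      intro k y
      have := partialDeriv_mul_of_tsupport hO (hη.smooth.of_le (by simp)) (hsK.trans hKc)
        ((contDiffOn_christoffel c k i i).of_le (by simp)) k y
      rw [← this]
      congr 1
      ext z
      exact mul_comm _ _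
    rw [integral_mul_eq_setIntegral (K := K) (fun y hy ↦ by
      simp only [hd, z0 y hy, z1 _ y hy, z2 _ _ y hy]; simp)]
    have i13 : IntegrableOn (fun y ↦
        (∑ k, partialDeriv k (christoffel m c k i i) y * U y * η y)
          + ∑ k, christoffel m c k i i y * U y * partialDeriv k η y) K :=
      (integrable_finsetSum _ fun k _ ↦ i3 i k).add (integrable_finsetSum _ fun k _ ↦ i1 i k)
    rw [← integral_finsetSum _ fun k _ ↦ i3 i k, ← integral_finsetSum _ fun k _ ↦ i1 i k,
      ← integral_add (integrable_finsetSum _ fun k _ ↦ i3 i k)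
        (integrable_finsetSum _ fun k _ ↦ i1 i k), ← integral_add (i2 i) i13]
    refine integral_congr_ae (.of_forall fun y ↦ ?_)
    simp only [hd, Finset.sum_add_distrib, mul_add, Finset.mul_sum, U]
    congr 2 <;> exact Finset.sum_congr rfl fun k _ ↦ by ring
  have e1 : ∫ y in K, ((∑ i, H i i y)
      - ∑ i, ∑ k, partialDeriv k (christoffel m c k i i) y * U y) * η y
      = (∑ i, ∫ y in K, H i i y * η y)
        - ∑ i, ∑ k, ∫ y in K, partialDeriv k (christoffel m c k i i) y * U y * η y := by
    simp only [← integral_finsetSum _ fun k _ ↦ i3 _ k]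
    rw [← integral_finsetSum _ fun i _ ↦ integrable_finsetSum _ fun k _ ↦ i3 i k,
      ← integral_finsetSum _ fun i _ ↦ i0 i, ← integral_sub
        (integrable_finsetSum _ fun i _ ↦ i0 i)
        (integrable_finsetSum _ fun i _ ↦ integrable_finsetSum _ fun k _ ↦ i3 i k)]
    refine integral_congr_ae (.of_forall fun y ↦ ?_)
    simp only [sub_mul, Finset.sum_mul]
  have e2 : ∀ k, ∫ y in K, (∑ i, christoffel m c k i i y * U y) * partialDeriv k η y
      = ∑ i, ∫ y in K, christoffel m c k i i y * U y * partialDeriv k η y := by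
    intro k
    rw [← integral_finsetSum _ fun i _ ↦ i1 i k]
    simp only [Finset.sum_mul]
  rw [e1, Finset.sum_congr rfl fun k _ ↦ e2 k, Finset.sum_congr rfl fun i _ ↦ key i]
  rw [Finset.sum_comm (f := fun k i ↦
    ∫ y in K, christoffel m c k i i y * U y * partialDeriv k η y)]
  simp only [Finset.sum_add_distrib]
  ring

/-- Locally, a function with square integrable Hessian is approximated by smooth functions together
with its first derivatives. -/
theorem exists_smooth_approximation {u : M → ℝ}
    {h : ∀ x : M, TangentSpace (𝓡 m) x →L[ℝ] TangentSpace (𝓡 m) x →L[ℝ] ℝ}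
    (hh : IsWeakHessian m u h) (c : M)
    (hu : LocallySq (chartAt (Eucl m) c).target fun y ↦ u ((chartAt (Eucl m) c).symm y))
    (hh2 : ∀ i j, LocallySq (chartAt (Eucl m) c).target fun y ↦
      h ((chartAt (Eucl m) c).symm y) (coordVector m c i y) (coordVector m c j y))
    {K : Set (Eucl m)} (hK : IsCompact K) (hKc : K ⊆ (chartAt (Eucl m) c).target) :
    ∃ (V : ℕ → Eucl m → ℝ) (G : Fin m → Eucl m → ℝ), (∀ n, ContDiff ℝ ∞ (V n)) ∧
      (∀ l, MemLp (G l) 2 volume) ∧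
      Filter.Tendsto (fun n ↦ eLpNorm (fun z ↦ V n z - u ((chartAt (Eucl m) c).symm z)) 2
        (volume.restrict K)) Filter.atTop (𝓝 0) ∧
      ∀ l, Filter.Tendsto (fun n ↦ eLpNorm (fun z ↦ partialDeriv l (V n) z - G l z) 2
        (volume.restrict K)) Filter.atTop (𝓝 0) := by
  set T := (chartAt (Eucl m) c).target
  have hO : IsOpen T := (chartAt (Eucl m) c).open_target
  obtain ⟨K', hK', hKK', hK'T⟩ := exists_compact_between hK hO hKc
  obtain ⟨φ, hφ, hφ1⟩ := exists_isTest_eq_one hK isOpen_interior hKK'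
  set U : Eucl m → ℝ := fun y ↦ u ((chartAt (Eucl m) c).symm y)
  -- cutting `u` off makes it globally square integrable and keeps the equation inside `K'`
  set W := K'.indicator U
  have hW : MemLp W 2 volume := hu.memLp_indicator hK' hK'T
  have hf : LocallySq T (fun y ↦
        (∑ i, h ((chartAt (Eucl m) c).symm y) (coordVector m c i y) (coordVector m c i y))
          - ∑ i, ∑ k, partialDeriv k (christoffel m c k i i) y * U y) :=
    (LocallySq.sum _ fun i _ ↦ hh2 i i).sub (LocallySq.sum _ fun i _ ↦ LocallySq.sum _ fun k _ ↦
      hu.continuousOn_mul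
        (contDiffOn_partialDeriv hO (contDiffOn_christoffel c k i i) k).continuousOn)
  have hB : ∀ k, LocallySq T (fun y ↦ ∑ i, christoffel m c k i i y * U y) := fun k ↦
    LocallySq.sum _ fun i _ ↦ hu.continuousOn_mul (contDiffOn_christoffel c k i i).continuousOn
  have hex := fun k ↦ exists_tendsto_partialDeriv_mollify isOpen_interior hW
    (hf.memLp_indicator hK' hK'T) (fun k ↦ (hB k).memLp_indicator hK' hK'T)
    (fun η hη ↦ integral_sum_hessian hh c hu hh2 hK' hK'T hη) hφ k
  choose G hG hGt using hex
  refine ⟨fun n ↦ mollify n W, G, fun n ↦ contDiff_mollify n (hW.locallyIntegrable (by norm_num)),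
    hG, ?_, fun l ↦ ?_⟩
  · refine tendsto_of_tendsto_of_tendsto_of_le_of_le tendsto_const_nhds
      (tendsto_eLpNorm_mollify_sub hW) (fun _ ↦ zero_le) fun n ↦ ?_
    refine le_trans (le_of_eq (eLpNorm_congr_ae ?_))
      (eLpNorm_mono_measure _ Measure.restrict_le_self)
    refine (ae_restrict_iff' hK.measurableSet).2 (.of_forall fun y hy ↦ ?_)
    have : W y = U y := Set.indicator_of_mem (interior_subset (hKK' hy)) _
    simp [this, U]
  · refine tendsto_of_tendsto_of_tendsto_of_le_of_le tendsto_const_nhds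
      (hGt l) (fun _ ↦ zero_le) fun n ↦ ?_
    refine le_trans (le_of_eq (eLpNorm_congr_ae ?_))
      (eLpNorm_mono_measure _ Measure.restrict_le_self)
    refine (ae_restrict_iff' hK.measurableSet).2 (.of_forall fun y hy ↦ ?_)
    simp [hφ1 y hy]

end LocalGradientExistence

/-! ### Partitions of unity -/

section Partition

/-- A finite smooth partition of unity on a compact set. -/
theorem exists_finite_partition {m : ℕ} {M : Type*} [TopologicalSpace M] [ChartedSpace (Eucl m) M]
    [T2Space M] [SigmaCompactSpace M] [IsManifold (𝓡 m) ∞ M] {ι : Type*} {U : ι → Set M}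
    (hU : ∀ i, IsOpen (U i)) {K : Set M} (hK : IsCompact K) (hKU : K ⊆ ⋃ i, U i) :
    ∃ (t : Finset ι) (ρ : t → M → ℝ), (∀ i, ContMDiff (𝓡 m) 𝓘(ℝ, ℝ) ∞ (ρ i)) ∧
      (∀ i, tsupport (ρ i) ⊆ U i) ∧ ∀ x ∈ K, ∑ i, ρ i x = 1 := by
  obtain ⟨t, ht⟩ := hK.elim_finite_subcover U hU hKU
  obtain ⟨f, hf⟩ := SmoothPartitionOfUnity.exists_isSubordinate (𝓡 m) hK.isClosed
    (fun i : t ↦ U i) (fun i ↦ hU i) (by simpa [Set.iUnion_subtype] using ht)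
  refine ⟨t, fun i ↦ f i, fun i ↦ (f i).contMDiff, hf, fun x hx ↦ ?_⟩
  rw [← finsum_eq_sum_of_fintype]
  exact f.sum_eq_one hx

end Partition

/-! ### Local properties of weak derivatives -/

section Gluing

variable {m : ℕ}

theorem LocallySq.locallyIntegrableOn {O : Set (Eucl m)} (hO : IsOpen O) {F : Eucl m → ℝ}
    (hF : LocallySq O F) : LocallyIntegrableOn F O := by
  rw [locallyIntegrableOn_iff hO.isLocallyClosed]
  intro K hKO hK
  have : IsFiniteMeasure (volume.restrict K) := ⟨by
    rw [Measure.restrict_apply_univ]; exact hK.measure_lt_top⟩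
  exact (hF K hK hKO).integrable (by norm_num)

/-- Square integrability on compact sets is a local property. -/
theorem LocallySq.of_cover {ι : Type*} {O : Set (Eucl m)} {U : ι → Set (Eucl m)}
    (hU : ∀ i, IsOpen (U i)) (hOU : O ⊆ ⋃ i, U i) {F : Eucl m → ℝ} {f : ι → Eucl m → ℝ}
    (hf : ∀ i, LocallySq (U i) (f i)) (hFf : ∀ i, ∀ᵐ y, y ∈ U i → F y = f i y) :
    LocallySq O F := by
  intro K hK hKO
  refine hK.induction_on (p := fun s ↦ MemLp F 2 (volume.restrict s)) (by simp)
    (fun s t hst h ↦ h.mono_measure (Measure.restrict_mono_set _ hst)) (fun s t hs ht ↦ ?_)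
    fun x hx ↦ ?_
  · have hm : AEStronglyMeasurable F (volume.restrict (s ∪ t)) :=
      ((aestronglyMeasurable_add_measure_iff).2 ⟨hs.1, ht.1⟩).mono_measure
        (Measure.restrict_union_le s t)
    rw [memLp_two_iff_integrable_sq hm]
    exact IntegrableOn.union hs.integrable_sq ht.integrable_sq
  · obtain ⟨i, hi⟩ := Set.mem_iUnion.1 (hOU (hKO hx))
    obtain ⟨S, hS, hxS, hSU⟩ := exists_compact_subset (hU i) hi
    refine ⟨S, mem_nhdsWithin_of_mem_nhds (mem_interior_iff_mem_nhds.1 hxS), ?_⟩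
    refine (hf i S hS hSU).ae_eq ?_
    refine (ae_restrict_iff' hS.measurableSet).2 ?_
    filter_upwards [hFf i] with y hy hyS
    exact (hy (hSU hyS)).symm

theorem partialDeriv_sum {ι : Type*} (s : Finset ι) {f : ι → Eucl m → ℝ}
    {y : Eucl m} (hf : ∀ i ∈ s, DifferentiableAt ℝ (f i) y) (k : Fin m) :
    partialDeriv k (fun z ↦ ∑ i ∈ s, f i z) y = ∑ i ∈ s, partialDeriv k (f i) y := by
  rw [partialDeriv, fderiv_fun_sum hf]
  simp [partialDeriv]

/-- The equation for a weak partial derivative is local. -/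
theorem integral_partialDeriv_of_cover {ι : Type*} {O : Set (Eucl m)}
    {U : ι → Set (Eucl m)} (hU : ∀ i, IsOpen (U i)) (hOU : O ⊆ ⋃ i, U i) {u F : Eucl m → ℝ}
    {f : ι → Eucl m → ℝ} {k : Fin m} (hu : LocallySq O u) (hF : LocallySq O F)
    (hFf : ∀ i, ∀ᵐ y, y ∈ U i → F y = f i y)
    (h : ∀ i η, IsTest (O ∩ U i) η → ∫ y, f i y * η y = - ∫ y, u y * partialDeriv k η y)
    {η : Eucl m → ℝ} (hη : IsTest O η) :
    ∫ y, F y * η y = - ∫ y, u y * partialDeriv k η y := by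
  -- the test function is split by a partition of unity, whose derivatives sum up to zero
  obtain ⟨t, ρ, hρ, hρU, hρ1⟩ := exists_finite_partition (m := m) hU hη.compact.isCompact
    (hη.support_subset.trans hOU)
  have hρs : ∀ i, ContDiff ℝ ∞ (ρ i) := fun i ↦ (hρ i).contDiff
  have hT : ∀ i : t, IsTest (O ∩ U i) (fun y ↦ ρ i y * η y) := fun i ↦
    ⟨(hρs i).mul hη.smooth, hη.compact.mul_left, Set.subset_inter
      ((tsupport_mul_subset_right).trans hη.support_subset)
      ((tsupport_mul_subset_left).trans (hρU i))⟩
  have hsum : ∀ y, ∑ i, ρ i y * η y = η y := fun y ↦ by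
    rw [← Finset.sum_mul]
    by_cases hy : y ∈ tsupport η
    · rw [hρ1 y hy, one_mul]
    · rw [image_eq_zero_of_notMem_tsupport hy, mul_zero]
  have hdsum : ∀ y, ∑ i, partialDeriv k (fun y ↦ ρ i y * η y) y = partialDeriv k η y := fun y ↦ by
    rw [← partialDeriv_sum _ fun i _ ↦ ((hT i).smooth.differentiable (by simp)) y]
    simp only [hsum]
  have hint : ∀ {w g : Eucl m → ℝ}, LocallySq O w → Continuous g → HasCompactSupport g →
      tsupport g ⊆ O → Integrable (fun y ↦ w y * g y) := fun {w g} hw hg hgc hgO ↦ by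
    have h1 := hw.integrableOn_mul hg.continuousOn hgc.isCompact hgO
    refine (integrableOn_iff_integrable_of_support_subset ?_).1 h1
    exact (Function.support_mul_subset_right _ _).trans (subset_tsupport g)
  calc ∫ y, F y * η y = ∑ i, ∫ y, F y * (ρ i y * η y) := by
        rw [← integral_finsetSum _ fun i _ ↦ hint hF (hT i).smooth.continuous (hT i).compact
          ((hT i).support_subset.trans Set.inter_subset_left)]
        simp only [← Finset.mul_sum, hsum]
    _ = ∑ i, - ∫ y, u y * partialDeriv k (fun y ↦ ρ i y * η y) y := by
        refine Finset.sum_congr rfl fun i _ ↦ ?_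
        rw [← h i _ (hT i)]
        refine integral_congr_ae ?_
        filter_upwards [hFf i] with y hy
        by_cases hyU : y ∈ U i
        · rw [hy hyU]
        · have : ρ i y = 0 := image_eq_zero_of_notMem_tsupport fun h ↦ hyU (hρU i h)
          simp [this]
    _ = _ := by
        rw [Finset.sum_neg_distrib, ← integral_finsetSum _ fun i _ ↦ hint hu
          (contDiff_partialDeriv (hT i).smooth k).continuous
          (hasCompactSupport_partialDeriv (hT i).compact k)
          ((tsupport_partialDeriv_subset _ k).trans
            ((hT i).support_subset.trans Set.inter_subset_left))]
        simp only [← Finset.mul_sum, hdsum]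

end Gluing

/-! ### The gradient of a function with square integrable Hessian -/

section GlobalGradient

variable {m : ℕ} {M : Type*} [TopologicalSpace M] [T2Space M] [ChartedSpace (Eucl m) M]
  [MeasurableSpace M] [BorelSpace M] [SecondCountableTopology M]
  [RiemannianBundle (fun x : M ↦ TangentSpace (𝓡 m) x)]
  [IsManifold (𝓡 m) ∞ M] [IsContMDiffRiemannianBundle (𝓡 m) ∞ (Eucl m)
      (fun x : M ↦ TangentSpace (𝓡 m) x)]

/-- The points with coordinates in the chart around `c` which lie in `W`. -/
def chartPreimage (c : M) (W : Set M) : Set (Eucl m) :=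
  (chartAt (Eucl m) c).target ∩ (chartAt (Eucl m) c).symm ⁻¹' W

theorem isOpen_chartPreimage (c : M) {W : Set M} (hW : IsOpen W) :
    IsOpen (chartPreimage (m := m) c W) :=
  (chartAt (Eucl m) c).isOpen_inter_preimage_symm hW

/-- The points whose coordinates in the chart around `c` lie in the interior of `K`. -/
def chartInterior (c : M) (K : Set (Eucl m)) : Set M :=
  (chartAt (Eucl m) c).source ∩ chartAt (Eucl m) c ⁻¹' interior K

theorem isOpen_chartInterior (c : M) (K : Set (Eucl m)) : IsOpen (chartInterior c K) :=
  (chartAt (Eucl m) c).isOpen_inter_preimage isOpen_interior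

theorem mem_overlap_of_mem_chartPreimage {c c' : M} {K : Set (Eucl m)} {y : Eucl m}
    (hy : y ∈ chartPreimage c (chartInterior c' K)) : y ∈ overlap c c' := ⟨hy.1, hy.2.1⟩

theorem transition_mem_of_mem_chartPreimage {c c' : M} {K : Set (Eucl m)} {y : Eucl m}
    (hy : y ∈ chartPreimage c (chartInterior c' K)) : transition c c' y ∈ K :=
  interior_subset hy.2.2

theorem locallySq_inner_coordField {c c' : M} {K : Set (Eucl m)} (hK : IsCompact K)
    (hKc : K ⊆ (chartAt (Eucl m) c').target) {G : Fin m → Eucl m → ℝ}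
    (hG : ∀ l, MemLp (G l) 2 (volume.restrict K)) (i : Fin m) :
    LocallySq (chartPreimage c (chartInterior c' K)) fun y ↦
      (inner ℝ (coordField c' G ((chartAt (Eucl m) c).symm y)) (coordVector m c i y) : ℝ) := by
  have h1 : ∀ l, LocallySq (chartPreimage c (chartInterior c' K)) fun y ↦
      G l (transition c c' y) := fun l S hS hSO ↦
    memLp_transition hS hK hKc (fun y hy ↦ mem_overlap_of_mem_chartPreimage (hSO hy))
      (fun y hy ↦ transition_mem_of_mem_chartPreimage (hSO hy)) (hG l)
  have h2 : LocallySq (chartPreimage c (chartInterior c' K)) fun y ↦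
      ∑ l, fderiv ℝ (transition c c') y (EuclideanSpace.single i 1) l * G l (transition c c' y) :=
    LocallySq.sum _ fun l _ ↦ (h1 l).continuousOn_mul
      ((continuousOn_fderiv_transition c c' _ l).mono
        fun y hy ↦ mem_overlap_of_mem_chartPreimage hy)
  intro S hS hSO
  refine (h2 S hS hSO).ae_eq ((ae_restrict_iff' hS.measurableSet).2 (.of_forall fun y hy ↦ ?_))
  simp only
  rw [inner_coordField c c' G (mem_overlap_of_mem_chartPreimage (hSO hy))]
  exact Finset.sum_congr rfl fun l _ ↦ mul_comm _ _

/-- A function with locally square integrable Hessian has a locally square integrable gradient. -/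
theorem exists_isWeakGradient {u : M → ℝ}
    {h : ∀ x : M, TangentSpace (𝓡 m) x →L[ℝ] TangentSpace (𝓡 m) x →L[ℝ] ℝ}
    (hh : IsWeakHessian m u h)
    (hu : ∀ c : M, LocallySq (chartAt (Eucl m) c).target fun y ↦ u ((chartAt (Eucl m) c).symm y))
    (hh2 : ∀ c i j, LocallySq (chartAt (Eucl m) c).target fun y ↦
      h ((chartAt (Eucl m) c).symm y) (coordVector m c i y) (coordVector m c j y)) :
    ∃ X : ∀ x : M, TangentSpace (𝓡 m) x, IsWeakGradient m u X ∧
      ∀ c i, LocallySq (chartAt (Eucl m) c).target fun y ↦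
        (inner ℝ (X ((chartAt (Eucl m) c).symm y)) (coordVector m c i y) : ℝ) := by
  rcases isEmpty_or_nonempty M with hM | hM
  · exact ⟨fun x ↦ 0, ⟨fun c ↦ (hM.false c).elim, fun c ↦ (hM.false c).elim⟩,
      fun c ↦ (hM.false c).elim⟩
  -- a countable cover by relatively compact pieces of charts
  have hK : ∀ x : M, ∃ K : Set (Eucl m), IsCompact K ∧ K ⊆ (chartAt (Eucl m) x).target ∧
      chartInterior x K ∈ 𝓝 x := by
    intro x
    obtain ⟨K, hK, hxK, hKT⟩ := exists_compact_subset (chartAt (Eucl m) x).open_target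
      (mem_chart_target (Eucl m) x)
    exact ⟨K, hK, hKT, (isOpen_chartInterior x K).mem_nhds ⟨mem_chart_source _ x, hxK⟩⟩
  choose K hK hKT hKx using hK
  obtain ⟨s, hs, hsU⟩ := TopologicalSpace.countable_cover_nhds hKx
  have hsne : s.Nonempty := by
    obtain ⟨x⟩ := hM
    obtain ⟨c, hc, -⟩ := Set.mem_iUnion₂.1 (hsU.symm ▸ Set.mem_univ x :
      x ∈ ⋃ x ∈ s, chartInterior x (K x))
    exact ⟨c, hc⟩
  obtain ⟨b, rfl⟩ := hs.exists_eq_range hsne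
  have hcov : ∀ x, ∃ n, x ∈ chartInterior (b n) (K (b n)) := fun x ↦ by
    have : x ∈ ⋃ x ∈ Set.range b, chartInterior x (K x) := hsU.symm ▸ Set.mem_univ x
    simpa using this
  choose V G hV hG hVu hVG using fun n ↦
    exists_smooth_approximation hh (b n) (hu _) (hh2 _) (hK (b n)) (hKT (b n))
  set W : ℕ → Set M := fun n ↦ chartInterior (b n) (K (b n))
  have hWo : ∀ n, IsOpen (W n) := fun n ↦ isOpen_chartInterior _ _
  set Y : ℕ → ∀ x : M, TangentSpace (𝓡 m) x := fun n ↦ coordField (b n) (G n)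
  have hYsq : ∀ n c i, LocallySq (chartPreimage c (W n)) fun y ↦
      (inner ℝ (Y n ((chartAt (Eucl m) c).symm y)) (coordVector m c i y) : ℝ) := fun n c i ↦
    locallySq_inner_coordField (hK _) (hKT _) (fun l ↦ (hG n l).restrict _) i
  have hYeq : ∀ n c i η, IsTest (chartPreimage c (W n)) η →
      ∫ y, (inner ℝ (Y n ((chartAt (Eucl m) c).symm y)) (coordVector m c i y) : ℝ) * η y
      = - ∫ y, u ((chartAt (Eucl m) c).symm y) * partialDeriv i η y := fun n c i η hη ↦
    integral_coordField_mul (hK _) (hKT _) (hV n) (hu _ _ (hK _) (hKT _))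
      (fun l ↦ (hG n l).restrict _) (hVu n) (hVG n) ⟨hη.smooth, hη.compact, fun y hy ↦
        mem_overlap_of_mem_chartPreimage (hη.support_subset hy)⟩
      (fun y hy ↦ transition_mem_of_mem_chartPreimage (hη.support_subset hy)) i
  -- the local gradients agree on the overlaps
  have hagree : ∀ n j c, ∀ᵐ y : Eucl m, y ∈ chartPreimage c (W n ∩ W j) →
      Y n ((chartAt (Eucl m) c).symm y) = Y j ((chartAt (Eucl m) c).symm y) := by
    intro n j c
    have hi : ∀ i, ∀ᵐ y : Eucl m, y ∈ chartPreimage c (W n ∩ W j) →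
        (inner ℝ (Y n ((chartAt (Eucl m) c).symm y)) (coordVector m c i y) : ℝ)
          - inner ℝ (Y j ((chartAt (Eucl m) c).symm y)) (coordVector m c i y) = 0 := by
      intro i
      have hO : IsOpen (chartPreimage (m := m) c (W n ∩ W j)) :=
        isOpen_chartPreimage c ((hWo n).inter (hWo j))
      have s1 : chartPreimage (m := m) c (W n ∩ W j) ⊆ chartPreimage c (W n) := fun y hy ↦
        ⟨hy.1, hy.2.1⟩
      have s2 : chartPreimage (m := m) c (W n ∩ W j) ⊆ chartPreimage c (W j) := fun y hy ↦
        ⟨hy.1, hy.2.2⟩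
      have l1 : LocallySq (chartPreimage c (W n ∩ W j)) _ := fun S hS hSO ↦
        hYsq n c i S hS (hSO.trans s1)
      have l2 : LocallySq (chartPreimage c (W n ∩ W j)) _ := fun S hS hSO ↦
        hYsq j c i S hS (hSO.trans s2)
      refine hO.ae_eq_zero_of_integral_contDiff_smul_eq_zero
        ((l1.sub l2).locallyIntegrableOn hO) fun g hg hgc hgO ↦ ?_
      have e1 := hYeq n c i g ⟨hg, hgc, hgO.trans s1⟩
      have e2 := hYeq j c i g ⟨hg, hgc, hgO.trans s2⟩
      have z0 : ∀ y, y ∉ tsupport g → g y = 0 := fun y hy ↦ image_eq_zero_of_notMem_tsupport hy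
      rw [← e2, integral_mul_eq_setIntegral z0, integral_mul_eq_setIntegral z0] at e1
      calc _ = ∫ y, ((inner ℝ (Y n ((chartAt (Eucl m) c).symm y)) (coordVector m c i y) : ℝ)
          - inner ℝ (Y j ((chartAt (Eucl m) c).symm y)) (coordVector m c i y)) * g y :=
            integral_congr_ae (.of_forall fun y ↦ mul_comm _ _)
        _ = _ := by
          rw [integral_mul_eq_setIntegral z0]
          simp only [sub_mul]
          rw [integral_sub (l1.integrableOn_mul hg.continuous.continuousOn hgc.isCompact hgO)
            (l2.integrableOn_mul hg.continuous.continuousOn hgc.isCompact hgO), e1, sub_self]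
    filter_upwards [ae_all_iff.2 hi] with y hy hyO
    rw [eq_chartDeriv_raise c hyO.1 (Y n _), eq_chartDeriv_raise c hyO.1 (Y j _)]
    congr 2
    ext i
    exact sub_eq_zero.1 (hy i hyO)
  -- a global field, equal almost everywhere on each piece to the local gradient
  classical
  set X : ∀ x : M, TangentSpace (𝓡 m) x := fun x ↦ Y (Nat.find (hcov x)) x
  have hXY : ∀ n c, ∀ᵐ y : Eucl m, y ∈ chartPreimage c (W n) →
      X ((chartAt (Eucl m) c).symm y) = Y n ((chartAt (Eucl m) c).symm y) := by
    intro n c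
    filter_upwards [ae_all_iff.2 fun j ↦ hagree j n c] with y hy hyn
    exact hy _ ⟨hyn.1, Nat.find_spec (hcov ((chartAt (Eucl m) c).symm y)), hyn.2⟩
  have hcov' : ∀ c : M, (chartAt (Eucl m) c).target ⊆ ⋃ n, chartPreimage c (W n) :=
    fun c y hy ↦ by
      obtain ⟨n, hn⟩ := hcov ((chartAt (Eucl m) c).symm y)
      exact Set.mem_iUnion.2 ⟨n, hy, hn⟩
  have hinner : ∀ c i n, ∀ᵐ y : Eucl m, y ∈ chartPreimage c (W n) →
      (inner ℝ (X ((chartAt (Eucl m) c).symm y)) (coordVector m c i y) : ℝ)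
        = inner ℝ (Y n ((chartAt (Eucl m) c).symm y)) (coordVector m c i y) := by
    intro c i n
    filter_upwards [hXY n c] with y hy hyn
    rw [hy hyn]
  have hXsq : ∀ c i, LocallySq (chartAt (Eucl m) c).target fun y ↦
        (inner ℝ (X ((chartAt (Eucl m) c).symm y)) (coordVector m c i y) : ℝ) := fun c i ↦
    LocallySq.of_cover (fun n ↦ isOpen_chartPreimage c (hWo n)) (hcov' c)
      (fun n ↦ hYsq n c i) (hinner c i)
  refine ⟨X, ⟨fun c i ↦ (hXsq c i).locallyIntegrableOn (chartAt (Eucl m) c).open_target,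
    fun c η hη i ↦ ?_⟩, hXsq⟩
  exact integral_partialDeriv_of_cover
    (fun n ↦ isOpen_chartPreimage c (hWo n)) (hcov' c) (hu c) (hXsq c i) (hinner c i)
    (fun n η hη ↦ hYeq n c i η ⟨hη.smooth, hη.compact, hη.support_subset.trans
      Set.inter_subset_right⟩) ⟨hη.smooth, hη.compact, hη.support_subset⟩

end GlobalGradient

/-! ### Derivatives of the metric coefficients -/

section MetricDerivatives

variable {m : ℕ}

theorem partialDeriv_const (a : ℝ) (l : Fin m) (y : Eucl m) :
    partialDeriv l (fun _ ↦ a) y = 0 := by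
  simp [partialDeriv]

theorem partialDeriv_prod {ι : Type*} [DecidableEq ι] (s : Finset ι) {f : ι → Eucl m → ℝ}
    {y : Eucl m} (hf : ∀ i ∈ s, DifferentiableAt ℝ (f i) y) (l : Fin m) :
    partialDeriv l (fun z ↦ ∏ i ∈ s, f i z) y
      = ∑ i ∈ s, (∏ j ∈ s.erase i, f j y) * partialDeriv l (f i) y := by
  have h : HasFDerivAt (fun z ↦ ∏ i ∈ s, f i z) _ y :=
    HasFDerivAt.finsetProd fun i hi ↦ (hf i hi).hasFDerivAt
  rw [partialDeriv, h.fderiv]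
  simp [partialDeriv]

/-- Jacobi's formula for the derivative of a determinant. -/
theorem partialDeriv_det {n : Type*} [Fintype n] [DecidableEq n] {A : Eucl m → Matrix n n ℝ}
    {y : Eucl m} (hA : ∀ i j, DifferentiableAt ℝ (fun z ↦ A z i j) y) (l : Fin m) :
    partialDeriv l (fun z ↦ (A z).det) y
      = ∑ i, ∑ j, (A y).adjugate i j * partialDeriv l (fun z ↦ A z j i) y := by
  have h1 : ∀ i, ∑ j, (A y).adjugate i j * partialDeriv l (fun z ↦ A z j i) y
      = ((A y).updateCol i fun j ↦ partialDeriv l (fun z ↦ A z j i) y).det := by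
    intro i
    rw [← Matrix.cramer_apply, Matrix.cramer_eq_adjugate_mulVec]
    rfl
  simp only [h1, Matrix.det_apply']
  have hdp : ∀ σ : Equiv.Perm n, DifferentiableAt ℝ (fun z ↦ ∏ i, A z (σ i) i) y := fun σ ↦
    (HasFDerivAt.finsetProd fun i _ ↦ (hA (σ i) i).hasFDerivAt).differentiableAt
  rw [partialDeriv_sum _ fun σ _ ↦ (hdp σ).const_mul _, Finset.sum_comm]
  refine Finset.sum_congr rfl fun σ _ ↦ ?_
  have h2 : partialDeriv l (fun z ↦ ((Equiv.Perm.sign σ : ℤ) : ℝ) * ∏ i, A z (σ i) i) y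
      = ((Equiv.Perm.sign σ : ℤ) : ℝ) * partialDeriv l (fun z ↦ ∏ i, A z (σ i) i) y := by
    rw [partialDeriv_mul (f := fun _ ↦ ((Equiv.Perm.sign σ : ℤ) : ℝ)) (differentiableAt_const _)
      (hdp σ), partialDeriv_const, mul_zero, add_zero]
  rw [h2, partialDeriv_prod _ fun i _ ↦ hA _ _, Finset.mul_sum]
  refine Finset.sum_congr rfl fun i _ ↦ ?_
  rw [← Finset.mul_prod_erase _ _ (Finset.mem_univ i), Matrix.updateCol_self, mul_comm (∏ j ∈ _, _)]
  congr 2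
  exact Finset.prod_congr rfl fun j hj ↦ (Matrix.updateCol_ne (Finset.ne_of_mem_erase hj)).symm

variable {M : Type*} [TopologicalSpace M] [ChartedSpace (Eucl m) M]
  [RiemannianBundle (fun x : M ↦ TangentSpace (𝓡 m) x)]
  [IsManifold (𝓡 m) ∞ M] [IsContMDiffRiemannianBundle (𝓡 m) ∞ (Eucl m)
      (fun x : M ↦ TangentSpace (𝓡 m) x)]

theorem differentiableAt_metricMatrix (c : M) {y : Eucl m}
    (hy : y ∈ (chartAt (Eucl m) c).target) (i j : Fin m) :
    DifferentiableAt ℝ (fun z ↦ metricMatrix m c z i j) y :=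
  ((contDiffOn_metricMatrix c i j).contDiffAt
    ((chartAt (Eucl m) c).open_target.mem_nhds hy)).differentiableAt (by simp)

theorem differentiableAt_metricInv (c : M) {y : Eucl m}
    (hy : y ∈ (chartAt (Eucl m) c).target) (i j : Fin m) :
    DifferentiableAt ℝ (metricInv m c i j) y :=
  ((contDiffOn_metricInv c i j).contDiffAt
    ((chartAt (Eucl m) c).open_target.mem_nhds hy)).differentiableAt (by simp)

theorem differentiableAt_volDensity (c : M) {y : Eucl m}
    (hy : y ∈ (chartAt (Eucl m) c).target) : DifferentiableAt ℝ (volDensity m c) y :=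
  ((contDiffOn_volDensity c).contDiffAt
    ((chartAt (Eucl m) c).open_target.mem_nhds hy)).differentiableAt (by simp)

/-- The coefficients `∂_l g_ij`. -/
def metricDeriv (c : M) (y : Eucl m) (l i j : Fin m) : ℝ :=
  partialDeriv l (fun z ↦ metricMatrix m c z i j) y

theorem metricDeriv_comm (c : M) (y : Eucl m) (l i j : Fin m) :
    metricDeriv c y l i j = metricDeriv c y l j i := by
  simp only [metricDeriv, metricMatrix_comm c _ i j]

theorem partialDeriv_volDensity (c : M) {y : Eucl m} (hy : y ∈ (chartAt (Eucl m) c).target)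
    (l : Fin m) : partialDeriv l (volDensity m c) y
      = (1 / 2) * volDensity m c y * ∑ i, ∑ j, metricInv m c i j y * metricDeriv c y l i j := by
  have hdet := (posDef_metricMatrix c hy).det_pos
  have hd : DifferentiableAt ℝ (fun z ↦ (metricMatrix m c z).det) y :=
    ((contDiffOn_det (contDiffOn_metricMatrix c)).contDiffAt
      ((chartAt (Eucl m) c).open_target.mem_nhds hy)).differentiableAt (n := ∞) (by simp)
  have h1 : HasFDerivAt (volDensity m c) _ y := hd.hasFDerivAt.sqrt hdet.ne'
  have h2 := partialDeriv_det (differentiableAt_metricMatrix c hy) l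
  rw [partialDeriv] at h2 ⊢
  rw [h1.fderiv, smul_apply, h2, smul_eq_mul]
  have h3 : ∀ i j, (metricMatrix m c y).adjugate i j
      = volDensity m c y ^ 2 * metricInv m c i j y := fun i j ↦ by
    rw [metricInv, Matrix.inv_def, Matrix.smul_apply, Ring.inverse_eq_inv', smul_eq_mul, volDensity,
      Real.sq_sqrt hdet.le, mul_inv_cancel_left₀ hdet.ne']
  have hv : √(metricMatrix m c y).det = volDensity m c y := rfl
  have hvp := (volDensity_pos c hy).ne'
  rw [hv]
  simp only [h3, mul_assoc, ← Finset.mul_sum]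
  have h4 : ∀ i j, partialDeriv l (fun z ↦ metricMatrix m c z j i) y = metricDeriv c y l i j :=
    fun i j ↦ metricDeriv_comm c y l j i
  simp only [h4]
  field_simp

/-- The derivative of the inverse matrix, `∂_l g^{ij} = - ∑ g^{ia} ∂_l g_ab g^{bj}`. -/
theorem partialDeriv_metricInv (c : M) {y : Eucl m} (hy : y ∈ (chartAt (Eucl m) c).target)
    (l i j : Fin m) : partialDeriv l (metricInv m c i j) y
      = - ∑ a, ∑ b, metricInv m c i a y * metricDeriv c y l a b * metricInv m c b j y := by
  -- differentiate `∑ g^{ia} g_ak = δ_ik` and multiply by the inverse matrix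
  have h1 : ∀ k, ∑ a, (metricInv m c i a y * metricDeriv c y l a k
      + metricMatrix m c y a k * partialDeriv l (metricInv m c i a) y) = 0 := by
    intro k
    have e : (fun z ↦ ∑ a, metricInv m c i a z * metricMatrix m c z a k) =ᶠ[𝓝 y]
        fun _ ↦ if i = k then 1 else 0 := by
      filter_upwards [(chartAt (Eucl m) c).open_target.mem_nhds hy] with z hz
      exact sum_metricInv_mul_metricMatrix c hz i k
    have e2 : partialDeriv l (fun z ↦ ∑ a, metricInv m c i a z * metricMatrix m c z a k) y = 0 := by
      rw [partialDeriv, e.fderiv_eq]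
      exact partialDeriv_const _ l y
    rw [partialDeriv_sum _ fun a _ ↦ (differentiableAt_metricInv c hy i a).fun_mul
      (differentiableAt_metricMatrix c hy a k)] at e2
    rw [← e2]
    exact Finset.sum_congr rfl fun a _ ↦ (partialDeriv_mul (differentiableAt_metricInv c hy i a)
      (differentiableAt_metricMatrix c hy a k) l).symm
  have h2 : ∑ k, (∑ a, (metricInv m c i a y * metricDeriv c y l a k
      + metricMatrix m c y a k * partialDeriv l (metricInv m c i a) y)) * metricInv m c k j y = 0 :=
    Finset.sum_eq_zero fun k _ ↦ by rw [h1 k, zero_mul]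
  simp only [Finset.sum_add_distrib, add_mul, Finset.sum_mul] at h2
  have h3 : ∑ k, ∑ a, metricMatrix m c y a k * partialDeriv l (metricInv m c i a) y
      * metricInv m c k j y = partialDeriv l (metricInv m c i j) y := by
    rw [Finset.sum_comm]
    calc _ = ∑ a, partialDeriv l (metricInv m c i a) y *
          ∑ k, metricMatrix m c y a k * metricInv m c k j y := by
          refine Finset.sum_congr rfl fun a _ ↦ ?_
          rw [Finset.mul_sum]
          exact Finset.sum_congr rfl fun k _ ↦ by ring
      _ = _ := by simp [sum_metricMatrix_mul_metricInv c hy]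
  rw [h3, Finset.sum_comm] at h2
  linarith

/-- The Christoffel term of the Hessian, in terms of the vector dual to the covector `p`. -/
theorem sum_christoffel_mul (c : M) (y : Eucl m) (p : Fin m → ℝ) (i j : Fin m) :
    ∑ k, christoffel m c k i j y * p k = (1 / 2) * ∑ l, raise c y p l *
      (metricDeriv c y i j l + metricDeriv c y j i l - metricDeriv c y l i j) := by
  simp only [christoffel, raise_apply, metricDeriv, Finset.mul_sum, Finset.sum_mul]
  rw [Finset.sum_comm]
  refine Finset.sum_congr rfl fun l _ ↦ Finset.sum_congr rfl fun k _ ↦ ?_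
  rw [metricInv_comm c y k l]
  ring

end MetricDerivatives

/-! ### Divergence identities for smooth functions -/

section Divergence

variable {m : ℕ} {M : Type*} [TopologicalSpace M] [ChartedSpace (Eucl m) M]
  [RiemannianBundle (fun x : M ↦ TangentSpace (𝓡 m) x)]
  [IsManifold (𝓡 m) ∞ M] [IsContMDiffRiemannianBundle (𝓡 m) ∞ (Eucl m)
      (fun x : M ↦ TangentSpace (𝓡 m) x)]

/-- The covariant Hessian `∂_i ∂_j V - ∑ Γ^k_ij ∂_k V` of a smooth function in coordinates. -/
def hessCoord (c : M) (V : Eucl m → ℝ) (i j : Fin m) (y : Eucl m) : ℝ :=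
  partialDeriv i (partialDeriv j V) y - ∑ k, christoffel m c k i j y * partialDeriv k V y

/-- The components of the gradient of a smooth function in coordinates. -/
def gradCoord (c : M) (V : Eucl m → ℝ) (i : Fin m) (y : Eucl m) : ℝ :=
  raise c y (fun k ↦ partialDeriv k V y) i

theorem sum_metricInv_mul (c : M) (y : Eucl m) (V : Eucl m → ℝ) (i : Fin m) :
    ∑ j, metricInv m c j i y * partialDeriv j V y = gradCoord c V i y := by
  simp only [metricInv_comm c y _ i]; rfl

theorem differentiableAt_gradCoord (c : M) {V : Eucl m → ℝ} (hV : ContDiff ℝ ∞ V) (i : Fin m)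
    {y : Eucl m} (hy : y ∈ (chartAt (Eucl m) c).target) :
    DifferentiableAt ℝ (gradCoord c V i) y := by
  have h0 : gradCoord c V i = fun z ↦ ∑ j, metricInv m c i j z * partialDeriv j V z := rfl
  rw [h0]
  exact DifferentiableAt.fun_sum fun j _ ↦ (differentiableAt_metricInv c hy i j).fun_mul
    ((contDiff_partialDeriv hV j).differentiable (by simp) y)

theorem partialDeriv_gradCoord (c : M) {V : Eucl m → ℝ} (hV : ContDiff ℝ ∞ V) (l i : Fin m)
    {y : Eucl m} (hy : y ∈ (chartAt (Eucl m) c).target) :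
    partialDeriv l (gradCoord c V i) y
      = (∑ j, metricInv m c i j y * partialDeriv l (partialDeriv j V) y)
        - ∑ a, ∑ b, metricInv m c i a y * metricDeriv c y l a b * gradCoord c V b y := by
  have h0 : gradCoord c V i = fun z ↦ ∑ j, metricInv m c i j z * partialDeriv j V z := rfl
  have d1 := fun j ↦ differentiableAt_metricInv c hy i j
  have d2 := fun j ↦ (contDiff_partialDeriv hV j).differentiable (by simp) y
  rw [h0, partialDeriv_sum _ fun j _ ↦ (d1 j).fun_mul (d2 j)]
  simp only [partialDeriv_mul (d1 _) (d2 _), partialDeriv_metricInv c hy,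
    Finset.sum_add_distrib, gradCoord, raise_apply, Finset.mul_sum, mul_neg,
    Finset.sum_neg_distrib]
  rw [sub_eq_add_neg]
  congr 2
  rw [Finset.sum_comm]
  refine Finset.sum_congr rfl fun a _ ↦ ?_
  rw [Finset.sum_comm]
  exact Finset.sum_congr rfl fun b _ ↦ Finset.sum_congr rfl fun j _ ↦ by ring

/-- The Laplacian is the trace of the Hessian: `div (w ∇V) = w tr Hess V`. -/
theorem sum_partialDeriv_volDensity_mul_gradCoord (c : M) {V : Eucl m → ℝ} (hV : ContDiff ℝ ∞ V)
    {y : Eucl m} (hy : y ∈ (chartAt (Eucl m) c).target) :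
    ∑ i, partialDeriv i (fun z ↦ volDensity m c z * gradCoord c V i z) y
      = volDensity m c y * ∑ i, ∑ j, metricInv m c i j y * hessCoord c V i j y := by
  set A := fun i j ↦ metricInv m c i j y
  set D := metricDeriv c y
  set x := fun i ↦ gradCoord c V i y
  have hA : ∀ i j, A i j = A j i := metricInv_comm c y
  have hD : ∀ l i j, D l i j = D l j i := metricDeriv_comm c y
  have hΓ : ∀ i j, ∑ k, christoffel m c k i j y * partialDeriv k V y
      = (1 / 2) * ∑ l, x l * (D i j l + D j i l - D l i j) := fun i j ↦
    sum_christoffel_mul c y _ i j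
  have hL : ∀ i, partialDeriv i (fun z ↦ volDensity m c z * gradCoord c V i z) y
      = volDensity m c y * ((∑ j, A i j * partialDeriv i (partialDeriv j V) y)
        - (∑ a, ∑ b, A i a * D i a b * x b) + (1 / 2) * ∑ a, ∑ b, A a b * D i a b * x i) := by
    intro i
    rw [partialDeriv_mul (differentiableAt_volDensity c hy) (differentiableAt_gradCoord c hV i hy),
      partialDeriv_gradCoord c hV i i hy, partialDeriv_volDensity c hy]
    simp only [← Finset.sum_mul]
    ring
  have e0 : ∀ q t : Fin m → Fin m → ℝ, ∑ i, ∑ j, A i j * (q i j - t i j)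
      = (∑ i, ∑ j, A i j * q i j) - ∑ i, ∑ j, A i j * t i j := fun q t ↦ by
    simp only [mul_sub, Finset.sum_sub_distrib]
  simp only [hL, ← Finset.mul_sum, hessCoord, hΓ]
  congr 1
  refine Eq.trans ?_ (e0 _ _).symm
  simp only [Finset.sum_sub_distrib, Finset.sum_add_distrib]
  rw [← Finset.mul_sum]
  -- the derivatives of the metric in the Christoffel symbols cancel those of `√det g` and `g^{ij}`
  have e1 : ∑ i, ∑ j, A i j * ((1 / 2) * ∑ l, x l * (D i j l + D j i l - D l i j))
      = (∑ i, ∑ j, ∑ l, A i j * D i j l * x l)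
        - (1 / 2) * ∑ i, ∑ j, ∑ l, A i j * D l i j * x l := by
    have s1 : ∑ i, ∑ j, ∑ l, A i j * D j i l * x l = ∑ i, ∑ j, ∑ l, A i j * D i j l * x l := by
      rw [Finset.sum_comm]
      refine Finset.sum_congr rfl fun i _ ↦ Finset.sum_congr rfl fun j _ ↦ ?_
      rw [hA]
    have s2 : ∑ i, ∑ j, A i j * ((1 / 2) * ∑ l, x l * (D i j l + D j i l - D l i j))
        = (1 / 2) * ((∑ i, ∑ j, ∑ l, A i j * D i j l * x l)
          + (∑ i, ∑ j, ∑ l, A i j * D j i l * x l)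
          - ∑ i, ∑ j, ∑ l, A i j * D l i j * x l) := by
      simp only [Finset.mul_sum, ← Finset.sum_add_distrib, ← Finset.sum_sub_distrib]
      refine Finset.sum_congr rfl fun i _ ↦ Finset.sum_congr rfl fun j _ ↦
        Finset.sum_congr rfl fun l _ ↦ by ring
    rw [s2, s1]
    ring
  have e2 : ∑ i, ∑ a, ∑ b, A a b * D i a b * x i = ∑ i, ∑ j, ∑ l, A i j * D l i j * x l := by
    rw [Finset.sum_comm]
    exact Finset.sum_congr rfl fun a _ ↦ Finset.sum_comm
  rw [e1, e2]
  ring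

/-- The derivative of `|∇V|²` along `∇V` is `2 Hess V(∇V, ∇V)`. -/
theorem sum_gradCoord_mul_partialDeriv (c : M) {V : Eucl m → ℝ} (hV : ContDiff ℝ ∞ V)
    {y : Eucl m} (hy : y ∈ (chartAt (Eucl m) c).target) :
    ∑ l, gradCoord c V l y *
        partialDeriv l (fun z ↦ ∑ i, gradCoord c V i z * partialDeriv i V z) y
      = 2 * ∑ i, ∑ j, gradCoord c V i y * gradCoord c V j y * hessCoord c V i j y := by
  set A := fun i j ↦ metricInv m c i j y
  set D := metricDeriv c y
  set x := fun i ↦ gradCoord c V i y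
  set q := fun i j ↦ partialDeriv i (partialDeriv j V) y
  have hD : ∀ l i j, D l i j = D l j i := metricDeriv_comm c y
  have hΓ : ∀ i j, ∑ k, christoffel m c k i j y * partialDeriv k V y
      = (1 / 2) * ∑ l, x l * (D i j l + D j i l - D l i j) := fun i j ↦
    sum_christoffel_mul c y _ i j
  have d1 := fun i ↦ differentiableAt_gradCoord c hV i hy
  have d2 := fun j ↦ (contDiff_partialDeriv hV j).differentiable (by simp) y
  have hs : ∀ l, partialDeriv l (fun z ↦ ∑ i, gradCoord c V i z * partialDeriv i V z) y
      = 2 * (∑ j, x j * q l j) - ∑ a, ∑ b, x a * D l a b * x b := by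
    intro l
    rw [partialDeriv_sum _ fun i _ ↦ (d1 i).fun_mul (d2 i)]
    simp only [partialDeriv_mul (d1 _) (d2 _), partialDeriv_gradCoord c hV _ _ hy]
    have e1 : ∑ i, partialDeriv i V y * (∑ j, metricInv m c i j y * q l j)
        = ∑ j, x j * q l j := by
      simp only [x, ← sum_metricInv_mul, Finset.mul_sum, Finset.sum_mul]
      rw [Finset.sum_comm]
      exact Finset.sum_congr rfl fun i _ ↦ Finset.sum_congr rfl fun j _ ↦ by ring
    have e2 : ∑ i, partialDeriv i V y * (∑ a, ∑ b, metricInv m c i a y * D l a b * x b)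
        = ∑ a, ∑ b, x a * D l a b * x b := by
      simp only [x, ← sum_metricInv_mul c y V, Finset.mul_sum, Finset.sum_mul]
      rw [Finset.sum_comm]
      refine Finset.sum_congr rfl fun a _ ↦ ?_
      rw [Finset.sum_comm]
      refine Finset.sum_congr rfl fun b _ ↦ ?_
      rw [Finset.sum_comm]
      refine Finset.sum_congr rfl fun i _ ↦ Finset.sum_congr rfl fun j _ ↦ by ring
    simp only [mul_sub, Finset.sum_add_distrib, Finset.sum_sub_distrib]
    rw [e1, e2]
    simp only [q, x]
    ring
  -- contracted with `∇V` three times, the three terms of the Christoffel symbols coincide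
  have s1 : ∑ i, ∑ j, ∑ l, x i * x j * x l * D i j l = ∑ l, ∑ a, ∑ b, x l * x a * x b * D l a b :=
    rfl
  have s2 : ∑ i, ∑ j, ∑ l, x i * x j * x l * D j i l =
      ∑ l, ∑ a, ∑ b, x l * x a * x b * D l a b := by
    rw [Finset.sum_comm]
    exact Finset.sum_congr rfl fun i _ ↦ Finset.sum_congr rfl fun j _ ↦
        Finset.sum_congr rfl fun l _ ↦ by ring
  have s3 : ∑ i, ∑ j, ∑ l, x i * x j * x l * D l i j =
      ∑ l, ∑ a, ∑ b, x l * x a * x b * D l a b := by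
    rw [Finset.sum_congr rfl fun i _ ↦ Finset.sum_comm, Finset.sum_comm]
    exact Finset.sum_congr rfl fun i _ ↦ Finset.sum_congr rfl fun j _ ↦
        Finset.sum_congr rfl fun l _ ↦ by ring
  have hR : ∑ i, ∑ j, x i * x j * hessCoord c V i j y
      = (∑ i, ∑ j, x i * x j * q i j) - (1 / 2) * ((∑ i, ∑ j, ∑ l, x i * x j * x l * D i j l)
        + (∑ i, ∑ j, ∑ l, x i * x j * x l * D j i l)
        - ∑ i, ∑ j, ∑ l, x i * x j * x l * D l i j) := by
    simp only [hessCoord, hΓ, Finset.mul_sum, ← Finset.sum_add_distrib, ← Finset.sum_sub_distrib,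
      mul_sub]
    refine Finset.sum_congr rfl fun i _ ↦ Finset.sum_congr rfl fun j _ ↦ ?_
    simp only [q]
    congr 1
    refine Finset.sum_congr rfl fun l _ ↦ by ring
  have hLs : ∑ l, x l * (2 * (∑ j, x j * q l j) - ∑ a, ∑ b, x a * D l a b * x b)
      = 2 * (∑ i, ∑ j, x i * x j * q i j) - ∑ l, ∑ a, ∑ b, x l * x a * x b * D l a b := by
    simp only [mul_sub, Finset.sum_sub_distrib, Finset.mul_sum]
    congr 1
    · exact Finset.sum_congr rfl fun i _ ↦ Finset.sum_congr rfl fun j _ ↦ by ring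
    · exact Finset.sum_congr rfl fun i _ ↦ Finset.sum_congr rfl fun j _ ↦
        Finset.sum_congr rfl fun l _ ↦ by ring
  rw [Finset.sum_congr rfl fun l _ ↦ by rw [hs l], hLs, hR, s1, s2, s3]
  ring

end Divergence

/-! ### Convergence in `L²` -/

section SquareConvergence

variable {α : Type*} [MeasurableSpace α] {μ : Measure α}

/-- Convergence in `L^2`. -/
def TendstoSq (μ : Measure α) (F : ℕ → α → ℝ) (F' : α → ℝ) : Prop :=
  Filter.Tendsto (fun n ↦ eLpNorm (fun x ↦ F n x - F' x) 2 μ) Filter.atTop (𝓝 0)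

theorem TendstoSq.add {F G : ℕ → α → ℝ} {F' G' : α → ℝ} (hF : TendstoSq μ F F')
    (hG : TendstoSq μ G G') (mF : ∀ n, MemLp (F n) 2 μ) (mF' : MemLp F' 2 μ)
    (mG : ∀ n, MemLp (G n) 2 μ) (mG' : MemLp G' 2 μ) :
    TendstoSq μ (fun n x ↦ F n x + G n x) fun x ↦ F' x + G' x := by
  have h := Filter.Tendsto.add hF hG
  rw [add_zero] at h
  refine tendsto_of_tendsto_of_tendsto_of_le_of_le tendsto_const_nhds h (fun _ ↦ zero_le)
    fun n ↦ ?_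
  refine le_trans (le_of_eq ?_) (eLpNorm_add_le ((mF n).sub mF').1 ((mG n).sub mG').1 (by norm_num))
  congr 1
  ext x
  simp only [Pi.add_apply]
  ring

theorem TendstoSq.neg {F : ℕ → α → ℝ} {F' : α → ℝ} (hF : TendstoSq μ F F') :
    TendstoSq μ (fun n x ↦ - F n x) fun x ↦ - F' x := by
  refine Filter.Tendsto.congr (fun n ↦ ?_) hF
  rw [← eLpNorm_neg]
  congr 1
  ext x
  simp only [Pi.neg_apply]
  ring

theorem TendstoSq.sum {ι : Type*} (s : Finset ι) {F : ι → ℕ → α → ℝ} {F' : ι → α → ℝ}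
    (hF : ∀ i ∈ s, TendstoSq μ (F i) (F' i)) (mF : ∀ i ∈ s, ∀ n, MemLp (F i n) 2 μ)
    (mF' : ∀ i ∈ s, MemLp (F' i) 2 μ) :
    TendstoSq μ (fun n x ↦ ∑ i ∈ s, F i n x) fun x ↦ ∑ i ∈ s, F' i x := by
  classical
  induction s using Finset.induction_on with
  | empty => simp [TendstoSq]
  | insert i s his ih =>
    simp only [Finset.sum_insert his]
    refine (hF i (Finset.mem_insert_self _ _)).add
      (ih (fun j hj ↦ hF j (Finset.mem_insert_of_mem hj))
        (fun j hj ↦ mF j (Finset.mem_insert_of_mem hj))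
        (fun j hj ↦ mF' j (Finset.mem_insert_of_mem hj)))
      (mF i (Finset.mem_insert_self _ _)) (mF' i (Finset.mem_insert_self _ _))
      (fun n ↦ memLp_finsetSum s fun j hj ↦ mF j (Finset.mem_insert_of_mem hj) n)
      (memLp_finsetSum s fun j hj ↦ mF' j (Finset.mem_insert_of_mem hj))

theorem TendstoSq.bdd_mul {F : ℕ → α → ℝ} {F' g : α → ℝ} {C : ℝ} (hF : TendstoSq μ F F')
    (hg : ∀ᵐ x ∂μ, |g x| ≤ C) : TendstoSq μ (fun n x ↦ g x * F n x) fun x ↦ g x * F' x := by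
  have h := ENNReal.Tendsto.const_mul hF (Or.inr (ENNReal.ofReal_ne_top (r := C)))
  rw [mul_zero] at h
  refine tendsto_of_tendsto_of_tendsto_of_le_of_le tendsto_const_nhds h (fun _ ↦ zero_le)
    fun n ↦ eLpNorm_le_mul_eLpNorm_of_ae_le_mul ?_ 2
  filter_upwards [hg] with x hx
  rw [← mul_sub, norm_mul]
  exact mul_le_mul_of_nonneg_right hx (norm_nonneg _)

theorem TendstoSq.comp_subseq {F : ℕ → α → ℝ} {F' : α → ℝ} (hF : TendstoSq μ F F') {ns : ℕ → ℕ}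
    (h : StrictMono ns) : TendstoSq μ (fun n ↦ F (ns n)) F' := by
  rw [TendstoSq] at hF ⊢
  exact hF.comp h.tendsto_atTop

/-- Finitely many `L^2`-convergent sequences converge almost everywhere along a common
subsequence. -/
theorem TendstoSq.exists_subseq_ae {ι : Type*} [Fintype ι] {F : ι → ℕ → α → ℝ} {F' : ι → α → ℝ}
    (hF : ∀ i, TendstoSq μ (F i) (F' i)) (mF : ∀ i n, MemLp (F i n) 2 μ)
    (mF' : ∀ i, MemLp (F' i) 2 μ) :
    ∃ ns : ℕ → ℕ, StrictMono ns ∧ ∀ᵐ x ∂μ, ∀ i,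
      Filter.Tendsto (fun n ↦ F i (ns n) x) Filter.atTop (𝓝 (F' i x)) := by
  have hsum : TendstoSq μ (fun n x ↦ ∑ i, |F i n x - F' i x|) fun x ↦ ∑ i : ι, (0 : ℝ) := by
    refine TendstoSq.sum _ (fun i _ ↦ ?_) (fun i _ n ↦ ((mF i n).sub (mF' i)).abs)
      fun i _ ↦ MemLp.zero'
    refine Filter.Tendsto.congr (fun n ↦ ?_) (hF i)
    simp only [sub_zero]
    exact (eLpNorm_norm _).symm
  simp only [Finset.sum_const_zero] at hsum
  have hm : ∀ n, MemLp (fun x ↦ ∑ i, |F i n x - F' i x|) 2 μ := fun n ↦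
    memLp_finsetSum _ fun i _ ↦ ((mF i n).sub (mF' i)).abs
  obtain ⟨ns, hns, h⟩ := (tendstoInMeasure_of_tendsto_eLpNorm (p := 2) (by norm_num)
    (fun n ↦ (hm n).1) aestronglyMeasurable_const (g := fun _ ↦ (0:ℝ)) hsum).exists_seq_tendsto_ae
  refine ⟨ns, hns, ?_⟩
  filter_upwards [h] with x hx i
  rw [tendsto_iff_dist_tendsto_zero]
  refine squeeze_zero (fun _ ↦ dist_nonneg) (fun n ↦ ?_) hx
  rw [Real.dist_eq]
  exact Finset.single_le_sum (f := fun i ↦ |F i (ns n) x - F' i x|) (fun i _ ↦ abs_nonneg _)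
    (Finset.mem_univ i)

end SquareConvergence

/-! ### Smooth approximation of functions with square integrable Hessian -/

section HessianApproximation

variable {m : ℕ}

theorem tendstoSq_of_mollify {K : Set (Eucl m)} (hK : IsCompact K) {F : ℕ → Eucl m → ℝ}
    {f f' : Eucl m → ℝ} (hf : MemLp f 2 volume) (hff : ∀ y ∈ K, f y = f' y)
    (h : ∀ᶠ n in Filter.atTop, ∀ y ∈ K, F n y = mollify n f y) :
    TendstoSq (volume.restrict K) F f' := by
  refine tendsto_of_tendsto_of_tendsto_of_le_of_le' tendsto_const_nhds
      (tendsto_eLpNorm_mollify_sub hf) (.of_forall fun _ ↦ zero_le) ?_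
  filter_upwards [h] with n hn
  refine le_trans (le_of_eq (eLpNorm_congr_ae ?_))
    (eLpNorm_mono_measure _ Measure.restrict_le_self)
  refine (ae_restrict_iff' hK.measurableSet).2 (.of_forall fun y hy ↦ ?_)
  simp [hn y hy, hff y hy]

variable {M : Type*} [TopologicalSpace M] [ChartedSpace (Eucl m) M]
  [RiemannianBundle (fun x : M ↦ TangentSpace (𝓡 m) x)]
  [IsManifold (𝓡 m) ∞ M] [IsContMDiffRiemannianBundle (𝓡 m) ∞ (Eucl m)
      (fun x : M ↦ TangentSpace (𝓡 m) x)]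

/-- The weak equation `∂_i ∂_j u = h_ij + ∑ Γ^k_ij ∂_k u`. -/
theorem integral_partialDeriv_partialDeriv {u : M → ℝ}
    {h : ∀ x : M, TangentSpace (𝓡 m) x →L[ℝ] TangentSpace (𝓡 m) x →L[ℝ] ℝ}
    {X : ∀ x : M, TangentSpace (𝓡 m) x} (hh : IsWeakHessian m u h) (hX : IsWeakGradient m u X)
    (c : M) (hu : LocallySq (chartAt (Eucl m) c).target fun y ↦ u ((chartAt (Eucl m) c).symm y))
    (hh2 : ∀ i j, LocallySq (chartAt (Eucl m) c).target fun y ↦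
      h ((chartAt (Eucl m) c).symm y) (coordVector m c i y) (coordVector m c j y))
    (hX2 : ∀ i, LocallySq (chartAt (Eucl m) c).target fun y ↦
      (inner ℝ (X ((chartAt (Eucl m) c).symm y)) (coordVector m c i y) : ℝ))
    {η : Eucl m → ℝ} (hη : IsTest (chartAt (Eucl m) c).target η) (i j : Fin m) :
    ∫ y, (h ((chartAt (Eucl m) c).symm y) (coordVector m c i y) (coordVector m c j y)
        + ∑ k, christoffel m c k i j y *
          inner ℝ (X ((chartAt (Eucl m) c).symm y)) (coordVector m c k y)) * η y
      = ∫ y, u ((chartAt (Eucl m) c).symm y) * partialDeriv i (partialDeriv j η) y := by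
  set T := (chartAt (Eucl m) c).target
  have hO : IsOpen T := (chartAt (Eucl m) c).open_target
  set K := tsupport η
  have hK : IsCompact K := hη.compact
  have hKT : K ⊆ T := hη.support_subset
  set U : Eucl m → ℝ := fun y ↦ u ((chartAt (Eucl m) c).symm y)
  set H : Eucl m → ℝ := fun y ↦
    h ((chartAt (Eucl m) c).symm y) (coordVector m c i y) (coordVector m c j y)
  set G : Fin m → Eucl m → ℝ := fun k y ↦
    inner ℝ (X ((chartAt (Eucl m) c).symm y)) (coordVector m c k y)
  have z0 : ∀ y, y ∉ K → η y = 0 := fun y hy ↦ image_eq_zero_of_notMem_tsupport hy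
  have z2 : ∀ y, y ∉ K → partialDeriv i (partialDeriv j η) y = 0 := fun y hy ↦
    partialDeriv_eq_zero_of_notMem (fun h ↦ hy (tsupport_partialDeriv_subset _ _ h)) i
  have hΓη : ∀ k, IsTest T (fun y ↦ christoffel m c k i j y * η y) := fun k ↦ by
    have e : (fun y ↦ christoffel m c k i j y * η y) = fun y ↦ η y * christoffel m c k i j y := by
      ext y; ring
    refine ⟨e ▸ contDiff_mul_of_tsupport hO hη.smooth hKT (contDiffOn_christoffel c k i j),
      hη.compact.mul_left, tsupport_mul_subset_right.trans hKT⟩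
  have zk : ∀ k y, y ∉ K → partialDeriv k (fun z ↦ christoffel m c k i j z * η z) y = 0 :=
    fun k y hy ↦ partialDeriv_eq_zero_of_notMem (fun h ↦ hy (tsupport_mul_subset_right h)) k
  -- the Christoffel terms of the Hessian equation are `Γ^k_ij` times the weak derivative `∂_k u`
  have hG : ∀ k, ∫ y in K, christoffel m c k i j y * G k y * η y
      = - ∫ y in K, U y * partialDeriv k (fun z ↦ christoffel m c k i j z * η z) y := fun k ↦ by
    have h1 := hX.integral_eq c _ ⟨(hΓη k).smooth, (hΓη k).compact, (hΓη k).support_subset⟩ k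
    rw [integral_mul_eq_setIntegral (K := K) (fun y hy ↦ by rw [z0 y hy, mul_zero]),
      integral_mul_eq_setIntegral (zk k)] at h1
    rw [← h1]
    exact integral_congr_ae (.of_forall fun y ↦ by ring)
  have iH : IntegrableOn (fun y ↦ H y * η y) K :=
    (hh2 i j).integrableOn_mul hη.smooth.continuous.continuousOn hK hKT
  have iG : ∀ k, IntegrableOn (fun y ↦ christoffel m c k i j y * G k y * η y) K := fun k ↦
    ((hX2 k).continuousOn_mul (contDiffOn_christoffel c k i j).continuousOn).integrableOn_mul
      hη.smooth.continuous.continuousOn hK hKT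
  have iU : IntegrableOn (fun y ↦ U y * partialDeriv i (partialDeriv j η) y) K :=
    hu.integrableOn_mul (contDiff_partialDeriv
      (contDiff_partialDeriv hη.smooth j) i).continuous.continuousOn hK hKT
  have iU' : ∀ k, IntegrableOn (fun y ↦
      U y * partialDeriv k (fun z ↦ christoffel m c k i j z * η z) y) K := fun k ↦
    hu.integrableOn_mul (contDiff_partialDeriv (hΓη k).smooth k).continuous.continuousOn hK hKT
  have h1 := hh.integral_eq c η ⟨hη.smooth, hη.compact, hη.support_subset⟩ i j
  rw [integral_mul_eq_setIntegral z0, integral_mul_eq_setIntegral (K := K) fun y hy ↦ by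
    rw [z2 y hy, Finset.sum_eq_zero fun k _ ↦ zk k y hy, add_zero]] at h1
  simp only [mul_add, Finset.mul_sum] at h1
  rw [integral_add iU (integrable_finsetSum _ fun k _ ↦ iU' k),
    integral_finsetSum _ fun k _ ↦ iU' k] at h1
  rw [integral_mul_eq_setIntegral z0, integral_mul_eq_setIntegral z2]
  simp only [add_mul, Finset.sum_mul]
  rw [integral_add iH (integrable_finsetSum _ fun k _ ↦ iG k),
    integral_finsetSum _ fun k _ ↦ iG k, Finset.sum_congr rfl fun k _ ↦ hG k,
    Finset.sum_neg_distrib, h1]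
  ring

/-- Locally, `u` is approximated by smooth functions, together with its gradient and its Hessian. -/
theorem exists_smooth_approximation_hessian {u : M → ℝ}
    {h : ∀ x : M, TangentSpace (𝓡 m) x →L[ℝ] TangentSpace (𝓡 m) x →L[ℝ] ℝ}
    {X : ∀ x : M, TangentSpace (𝓡 m) x} (hh : IsWeakHessian m u h) (hX : IsWeakGradient m u X)
    (c : M) (hu : LocallySq (chartAt (Eucl m) c).target fun y ↦ u ((chartAt (Eucl m) c).symm y))
    (hh2 : ∀ i j, LocallySq (chartAt (Eucl m) c).target fun y ↦
      h ((chartAt (Eucl m) c).symm y) (coordVector m c i y) (coordVector m c j y))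
    (hX2 : ∀ i, LocallySq (chartAt (Eucl m) c).target fun y ↦
      (inner ℝ (X ((chartAt (Eucl m) c).symm y)) (coordVector m c i y) : ℝ))
    {K : Set (Eucl m)} (hK : IsCompact K) (hKc : K ⊆ (chartAt (Eucl m) c).target) :
    ∃ V : ℕ → Eucl m → ℝ, (∀ n, ContDiff ℝ ∞ (V n)) ∧
      TendstoSq (volume.restrict K) V (fun y ↦ u ((chartAt (Eucl m) c).symm y)) ∧
      (∀ i, TendstoSq (volume.restrict K) (fun n ↦ partialDeriv i (V n))
        (fun y ↦ inner ℝ (X ((chartAt (Eucl m) c).symm y)) (coordVector m c i y))) ∧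
      (∀ i j, TendstoSq (volume.restrict K) (fun n ↦ hessCoord c (V n) i j)
        (fun y ↦ h ((chartAt (Eucl m) c).symm y) (coordVector m c i y) (coordVector m c j y))) ∧
      ∀ᵐ y ∂(volume.restrict K), ∀ i, Filter.Tendsto (fun n ↦ partialDeriv i (V n) y) Filter.atTop
        (𝓝 (inner ℝ (X ((chartAt (Eucl m) c).symm y)) (coordVector m c i y))) := by
  set T := (chartAt (Eucl m) c).target
  have hO : IsOpen T := (chartAt (Eucl m) c).open_target
  obtain ⟨K', hK', hKK', hK'T⟩ := exists_compact_between hK hO hKc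
  set U : Eucl m → ℝ := fun y ↦ u ((chartAt (Eucl m) c).symm y)
  set H : Fin m → Fin m → Eucl m → ℝ := fun i j y ↦
    h ((chartAt (Eucl m) c).symm y) (coordVector m c i y) (coordVector m c j y)
  set G : Fin m → Eucl m → ℝ := fun k y ↦
    inner ℝ (X ((chartAt (Eucl m) c).symm y)) (coordVector m c k y)
  -- the approximations are the mollifications of `u`, cut off outside a neighbourhood of `K`
  set W := K'.indicator U
  have hW : MemLp W 2 volume := hu.memLp_indicator hK' hK'T
  have hWl : LocallyIntegrable W := hW.locallyIntegrable (by norm_num)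
  set V : ℕ → Eucl m → ℝ := fun n ↦ mollify n W
  have hV : ∀ n, ContDiff ℝ ∞ (V n) := fun n ↦ contDiff_mollify n hWl
  have hev := eventually_closedBall_subset hK isOpen_interior hKK'
  have hsub : ∀ {η}, IsTest (interior K') η → tsupport η ⊆ K' := fun hη ↦
    hη.support_subset.trans interior_subset
  have z0 : ∀ {η}, IsTest (interior K') η → ∀ y, y ∉ K' → η y = 0 := fun hη y hy ↦
    image_eq_zero_of_notMem_tsupport fun h ↦ hy (hsub hη h)
  have z1 : ∀ {η}, IsTest (interior K') η → ∀ k y, y ∉ K' → partialDeriv k η y = 0 :=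
    fun hη k y hy ↦ partialDeriv_eq_zero_of_notMem (fun h ↦ hy (hsub hη h)) k
  have z2 : ∀ {η}, IsTest (interior K') η → ∀ k l y, y ∉ K' →
      partialDeriv k (partialDeriv l η) y = 0 := fun hη k l y hy ↦
    partialDeriv_eq_zero_of_notMem (fun h ↦ hy (hsub hη (tsupport_partialDeriv_subset _ _ h))) k
  set Q : Fin m → Fin m → Eucl m → ℝ := fun i j y ↦
    H i j y + ∑ k, christoffel m c k i j y * G k y
  have hQ : ∀ i j, LocallySq T (Q i j) := fun i j ↦ (hh2 i j).add (LocallySq.sum _ fun k _ ↦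
    (hX2 k).continuousOn_mul (contDiffOn_christoffel c k i j).continuousOn)
  have hVu : TendstoSq (volume.restrict K) V U := tendstoSq_of_mollify hK hW
    (fun y hy ↦ Set.indicator_of_mem (interior_subset (hKK' hy)) _) (.of_forall fun n y _ ↦ rfl)
  have hVG : ∀ i, TendstoSq (volume.restrict K) (fun n ↦ partialDeriv i (V n)) (G i) := by
    intro i
    refine tendstoSq_of_mollify hK ((hX2 i).memLp_indicator hK' hK'T)
      (fun y hy ↦ Set.indicator_of_mem (interior_subset (hKK' hy)) _) ?_
    filter_upwards [hev] with n hn y hy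
    refine partialDeriv_mollify_of_weak hWl (fun η hη ↦ ?_) n (hn y hy)
    rw [integral_indicator_mul (z0 hη), integral_indicator_mul (z1 hη i)]
    exact hX.integral_eq c η ⟨hη.smooth, hη.compact, (hsub hη).trans hK'T⟩ i
  have hVQ : ∀ i j, TendstoSq (volume.restrict K) (fun n ↦ partialDeriv i (partialDeriv j (V n)))
      (Q i j) := by
    intro i j
    refine tendstoSq_of_mollify hK ((hQ i j).memLp_indicator hK' hK'T)
      (fun y hy ↦ Set.indicator_of_mem (interior_subset (hKK' hy)) _) ?_
    filter_upwards [hev] with n hn y hy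
    refine partialDeriv_partialDeriv_mollify_of_weak hWl (fun η hη ↦ ?_) n (hn y hy)
    rw [integral_indicator_mul (z0 hη), integral_indicator_mul (z2 hη i j)]
    exact integral_partialDeriv_partialDeriv hh hX c hu hh2 hX2
      ⟨hη.smooth, hη.compact, (hsub hη).trans hK'T⟩ i j
  have m1 : ∀ i n, MemLp (partialDeriv i (V n)) 2 (volume.restrict K) := fun i n ↦
    memLp_of_continuousOn hK (contDiff_partialDeriv (hV n) i).continuous.continuousOn 2
  have m2 : ∀ i j n, MemLp (partialDeriv i (partialDeriv j (V n))) 2 (volume.restrict K) :=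
    fun i j n ↦ memLp_of_continuousOn hK
      (contDiff_partialDeriv (contDiff_partialDeriv (hV n) j) i).continuous.continuousOn 2
  have hVH : ∀ i j, TendstoSq (volume.restrict K) (fun n ↦ hessCoord c (V n) i j) (H i j) := by
    intro i j
    have hcΓ : ∀ k, ContinuousOn (christoffel m c k i j) T := fun k ↦
      (contDiffOn_christoffel c k i j).continuousOn
    have mΓ : ∀ k n, MemLp (fun y ↦ christoffel m c k i j y * partialDeriv k (V n) y) 2
        (volume.restrict K) := fun k n ↦ memLp_of_continuousOn hK (((hcΓ k).mono hKc).mul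
          (contDiff_partialDeriv (hV n) k).continuous.continuousOn) 2
    have mΓ' : ∀ k, MemLp (fun y ↦ christoffel m c k i j y * G k y) 2 (volume.restrict K) :=
      fun k ↦ (hX2 k).continuousOn_mul (hcΓ k) K hK hKc
    have hsum : TendstoSq (volume.restrict K)
        (fun n y ↦ ∑ k, christoffel m c k i j y * partialDeriv k (V n) y)
        (fun y ↦ ∑ k, christoffel m c k i j y * G k y) := by
      refine TendstoSq.sum _ (fun k _ ↦ ?_) (fun k _ n ↦ mΓ k n) fun k _ ↦ mΓ' k
      obtain ⟨C, hC⟩ := hK.exists_bound_of_continuousOn ((hcΓ k).mono hKc)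
      exact (hVG k).bdd_mul ((ae_restrict_iff' hK.measurableSet).2 (.of_forall hC))
    have := (hVQ i j).add hsum.neg (m2 i j) (hQ i j K hK hKc)
      (fun n ↦ (memLp_finsetSum _ fun k _ ↦ mΓ k n).neg) (memLp_finsetSum _ fun k _ ↦ mΓ' k).neg
    refine Filter.Tendsto.congr (fun n ↦ ?_) this
    congr 1
    ext y
    simp only [Q, hessCoord]
    ring
  -- almost everywhere convergence of the gradients holds along a subsequence
  obtain ⟨ns, hns, hae⟩ := TendstoSq.exists_subseq_ae hVG m1 fun i ↦ hX2 i K hK hKc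
  exact ⟨fun n ↦ V (ns n), fun n ↦ hV _, hVu.comp_subseq hns, fun i ↦ (hVG i).comp_subseq hns,
    fun i j ↦ (hVH i j).comp_subseq hns, hae⟩

end HessianApproximation

/-! ### The divergence theorem for `V a(|∇V|²) ∇V` with smooth `V` -/

section EnergyDensity

variable {m : ℕ} {M : Type*} [TopologicalSpace M] [ChartedSpace (Eucl m) M]
  [RiemannianBundle (fun x : M ↦ TangentSpace (𝓡 m) x)]

/-- The squared length `∑ g^{ij} p_i p_j` of a covector. -/
def covectorSq (c : M) (y : Eucl m) (p : Fin m → ℝ) : ℝ := ∑ i, raise c y p i * p i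

/-- The integrand `θ (a s + v (a tr H + 2 a' H(ξ, ξ))) + v a κ(ξ)` in coordinates, where `ξ` is the
vector dual to the covector `p`, where `s = |ξ|²`, and `a = a(s)`. It is the divergence of
`v a(s) ξ`, tested against `θ`, if `p = dv` and `H = Hess v` and `κ` is the differential of `θ`. -/
def energyDensity (c : M) (a : ℝ → ℝ) (θ : ℝ) (κ : Fin m → ℝ) (y : Eucl m) (v : ℝ)
    (p : Fin m → ℝ) (H : Fin m → Fin m → ℝ) : ℝ :=
  θ * (a (covectorSq c y p) * covectorSq c y p
      + v * (a (covectorSq c y p) * (∑ i, ∑ j, metricInv m c i j y * H i j)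
        + 2 * deriv a (covectorSq c y p) * ∑ i, ∑ j, raise c y p i * raise c y p j * H i j))
    + v * a (covectorSq c y p) * ∑ i, κ i * raise c y p i

/-- The density as a sum of terms, each of which is a coefficient depending on `p` alone times a
product of two components of `v`, `p` and `H`. -/
theorem energyDensity_eq_sum (c : M) (a : ℝ → ℝ) (θ : ℝ) (κ : Fin m → ℝ) (y : Eucl m) (v : ℝ)
    (p : Fin m → ℝ) (H : Fin m → Fin m → ℝ) :
    energyDensity c a θ κ y v p H = ∑ i, ∑ j,
      (θ * a (covectorSq c y p) * metricInv m c i j y * (p i * p j)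
        + θ * (a (covectorSq c y p) * metricInv m c i j y
            + 2 * (deriv a (covectorSq c y p) * (raise c y p i * raise c y p j))) * (v * H i j)
        + κ i * a (covectorSq c y p) * metricInv m c i j y * (v * p j)) := by
  have h1 : covectorSq c y p = ∑ i, ∑ j, metricInv m c i j y * (p i * p j) := by
    simp only [covectorSq, raise_apply, Finset.sum_mul]
    exact Finset.sum_congr rfl fun i _ ↦ Finset.sum_congr rfl fun j _ ↦ by ring
  have h2 : ∑ i, κ i * raise c y p i = ∑ i, ∑ j, κ i * (metricInv m c i j y * p j) := by
    simp only [raise_apply, Finset.mul_sum]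
  rw [energyDensity, h2]
  generalize ha : a (covectorSq c y p) = α
  generalize ha' : deriv a (covectorSq c y p) = β
  rw [h1]
  simp only [Finset.mul_sum, ← Finset.sum_add_distrib]
  exact Finset.sum_congr rfl fun i _ ↦ Finset.sum_congr rfl fun j _ ↦ by ring

theorem continuous_raise (c : M) (y : Eucl m) (i : Fin m) :
    Continuous fun p : Fin m → ℝ ↦ raise c y p i := by
  simp only [raise_apply]
  fun_prop

theorem continuous_covectorSq (c : M) (y : Eucl m) : Continuous (covectorSq c y) :=
  continuous_finsetSum _ fun i _ ↦ (continuous_raise c y i).mul (continuous_apply i)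

variable [IsManifold (𝓡 m) ∞ M]

theorem covectorSq_eq (c : M) {y : Eucl m} (hy : y ∈ (chartAt (Eucl m) c).target)
    (p : Fin m → ℝ) : covectorSq c y p = ‖chartDeriv c y (raise c y p)‖ ^ 2 := by
  rw [← real_inner_self_eq_norm_sq, inner_chartDeriv_raise c hy, covectorSq]
  exact Finset.sum_congr rfl fun i _ ↦ mul_comm _ _

theorem covectorSq_nonneg (c : M) {y : Eucl m} (hy : y ∈ (chartAt (Eucl m) c).target)
    (p : Fin m → ℝ) : 0 ≤ covectorSq c y p := by
  rw [covectorSq_eq c hy]; positivity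

/-- The Cauchy–Schwarz inequality for the coordinate differential `dy^i` and the covector `p`. -/
theorem raise_sq_le (c : M) {y : Eucl m} (hy : y ∈ (chartAt (Eucl m) c).target)
    (p : Fin m → ℝ) (i : Fin m) : raise c y p i ^ 2 ≤ metricInv m c i i y * covectorSq c y p := by
  have h1 := inner_chartDeriv_raise c hy (Pi.single i 1) (raise c y p)
  have h2 : ∑ j, (Pi.single i 1 : Fin m → ℝ) j * raise c y p j = raise c y p i := by
    simp [Pi.single_apply]
  have h3 : ‖chartDeriv c y (raise c y (Pi.single i 1))‖ ^ 2 = metricInv m c i i y := by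
    rw [norm_sq_chartDeriv_raise c hy]
    simp [Pi.single_apply]
  rw [← h2, ← h1, covectorSq_eq c hy, ← h3, ← mul_pow]
  refine sq_le_sq' ?_ (real_inner_le_norm _ _)
  have h4 := abs_real_inner_le_norm (chartDeriv c y (raise c y (Pi.single i 1)))
    (chartDeriv c y (raise c y p))
  exact neg_le_of_abs_le h4

variable [IsContMDiffRiemannianBundle (𝓡 m) ∞ (Eucl m) (fun x : M ↦ TangentSpace (𝓡 m) x)]

theorem continuousOn_raise (c : M) {p : Fin m → Eucl m → ℝ}
    (hp : ∀ j, ContinuousOn (p j) (chartAt (Eucl m) c).target) (i : Fin m) :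
    ContinuousOn (fun y ↦ raise c y (fun j ↦ p j y) i) (chartAt (Eucl m) c).target := by
  simp only [raise_apply]
  exact continuousOn_finsetSum _ fun j _ ↦ (contDiffOn_metricInv c i j).continuousOn.mul (hp j)

theorem continuousOn_covectorSq (c : M) {p : Fin m → Eucl m → ℝ}
    (hp : ∀ j, ContinuousOn (p j) (chartAt (Eucl m) c).target) :
    ContinuousOn (fun y ↦ covectorSq c y (fun j ↦ p j y)) (chartAt (Eucl m) c).target :=
  continuousOn_finsetSum _ fun i _ ↦ (continuousOn_raise c hp i).mul (hp i)

/-- The divergence theorem for the field `V a(|∇V|²) ∇V` of a smooth function `V`, tested against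
the product of a Lipschitz function `f` and a smooth function `χ`. -/
theorem integral_energyDensity_smooth (c : M) {V : Eucl m → ℝ} (hV : ContDiff ℝ ∞ V) {a : ℝ → ℝ}
    (ha : ContDiff ℝ 1 a) {χ : Eucl m → ℝ} (hχ : IsTest (chartAt (Eucl m) c).target χ)
    {f : Eucl m → ℝ} {C : NNReal} (hf : LipschitzWith C f) :
    ∫ y, energyDensity c a (f y * χ y * volDensity m c y)
      (fun i ↦ (f y * partialDeriv i χ y + χ y * lineDeriv ℝ f y (EuclideanSpace.single i 1))
        * volDensity m c y) y (V y) (fun i ↦ partialDeriv i V y) (fun i j ↦ hessCoord c V i j y)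
      = 0 := by
  set T := (chartAt (Eucl m) c).target
  have hO : IsOpen T := (chartAt (Eucl m) c).open_target
  set s : Eucl m → ℝ := fun y ↦ ∑ i, gradCoord c V i y * partialDeriv i V y
  set N : Fin m → Eucl m → ℝ := fun i y ↦ volDensity m c y * gradCoord c V i y
  set R : Eucl m → ℝ := fun y ↦ V y * a (s y)
  have cV : ∀ i, ContDiffOn ℝ 1 (partialDeriv i V) T := fun i ↦
    ((contDiff_partialDeriv hV i).of_le (by simp)).contDiffOn
  have cξ : ∀ i, ContDiffOn ℝ 1 (gradCoord c V i) T := fun i ↦ by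
    have h0 : gradCoord c V i = fun z ↦ ∑ j, metricInv m c i j z * partialDeriv j V z := rfl
    rw [h0]
    exact ContDiffOn.sum fun j _ ↦ ((contDiffOn_metricInv c i j).of_le (by simp)).mul (cV j)
  have cs : ContDiffOn ℝ 1 s T := ContDiffOn.sum fun i _ ↦ (cξ i).mul (cV i)
  have cN : ∀ i, ContDiffOn ℝ 1 (N i) T := fun i ↦
    ((contDiffOn_volDensity c).of_le (by simp)).mul (cξ i)
  have cR : ContDiffOn ℝ 1 R T :=
    (hV.of_le (by simp)).contDiffOn.mul (ha.comp_contDiffOn cs)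
  have cQ : ∀ i, ContDiffOn ℝ 1 (fun y ↦ N i y * R y) T := fun i ↦ (cN i).mul cR
  have hχ1 : ContDiff ℝ 1 χ := hχ.smooth.of_le (by simp)
  have cg : ∀ i, ContDiff ℝ 1 (fun y ↦ χ y * (N i y * R y)) := fun i ↦
    contDiff_mul_of_tsupport hO hχ1 hχ.support_subset (cQ i)
  have gc : ∀ i, HasCompactSupport (fun y ↦ χ y * (N i y * R y)) := fun i ↦ hχ.compact.mul_right
  have hdiff : ∀ {F : Eucl m → ℝ}, ContDiffOn ℝ 1 F T → ∀ {y}, y ∈ T → DifferentiableAt ℝ F y :=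
    fun hF y hy ↦ (hF.contDiffAt (hO.mem_nhds hy)).differentiableAt (by simp)
  -- integration by parts with the Lipschitz function `f`
  have hibp : ∀ i, ∫ y, lineDeriv ℝ f y (EuclideanSpace.single i 1) * (χ y * (N i y * R y))
      = - ∫ y, f y * partialDeriv i (fun y ↦ χ y * (N i y * R y)) y := by
    intro i
    obtain ⟨D, hD⟩ := ContDiff.lipschitzWith_of_hasCompactSupport (gc i) (cg i) (by simp)
    have h1 := hf.integral_lineDeriv_mul_eq (μ := volume) hD (gc i) (EuclideanSpace.single i 1)
    rw [h1, ← integral_neg]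
    refine integral_congr_ae (.of_forall fun y ↦ ?_)
    simp only
    rw [(((cg i).differentiable (by simp)) y).lineDeriv_eq_fderiv, map_neg, partialDeriv]
    ring
  have i1 : ∀ i, Integrable fun y ↦ lineDeriv ℝ f y (EuclideanSpace.single i 1) *
      (χ y * (N i y * R y)) := fun i ↦ by
    have h0 : Integrable fun y ↦ χ y * (N i y * R y) :=
      (cg i).continuous.integrable_of_hasCompactSupport (gc i)
    refine h0.bdd_mul (c := C * ‖(EuclideanSpace.single i (1:ℝ) : Eucl m)‖)
      (measurable_lineDeriv hf.continuous).aestronglyMeasurable (.of_forall fun y ↦ ?_)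
    exact norm_lineDeriv_le_of_lipschitz ℝ hf
  have i2 : ∀ i, Integrable fun y ↦ f y * partialDeriv i (fun y ↦ χ y * (N i y * R y)) y :=
    fun i ↦ (hf.continuous.mul (continuous_partialDeriv (cg i) i)).integrable_of_hasCompactSupport
      (hasCompactSupport_partialDeriv (gc i) i).mul_left
  have hzero : ∫ y, ∑ i, (lineDeriv ℝ f y (EuclideanSpace.single i 1) * (χ y * (N i y * R y))
      + f y * partialDeriv i (fun y ↦ χ y * (N i y * R y)) y) = 0 := by
    have i12 : ∀ i, Integrable fun y ↦
        lineDeriv ℝ f y (EuclideanSpace.single i 1) * (χ y * (N i y * R y))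
          + f y * partialDeriv i (fun y ↦ χ y * (N i y * R y)) y := fun i ↦ (i1 i).add (i2 i)
    rw [integral_finsetSum _ fun i _ ↦ i12 i]
    refine Finset.sum_eq_zero fun i _ ↦ ?_
    rw [integral_add (i1 i) (i2 i), hibp i]
    ring
  rw [← hzero]
  refine integral_congr_ae (.of_forall fun y ↦ ?_)
  simp only
  have hsy : covectorSq c y (fun i ↦ partialDeriv i V y) = s y := rfl
  have hry : ∀ i, raise c y (fun i ↦ partialDeriv i V y) i = gradCoord c V i y := fun i ↦ rfl
  by_cases hy : y ∈ tsupport χ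
  · have hyT : y ∈ T := hχ.support_subset hy
    have hdR : ∀ i, partialDeriv i R y
        = V y * (deriv a (s y) * partialDeriv i s y) + a (s y) * partialDeriv i V y := by
      intro i
      have h1 : HasFDerivAt (fun z ↦ a (s z)) _ y :=
        ((ha.differentiable (by simp)) (s y)).hasDerivAt.comp_hasFDerivAt y
          (hdiff cs hyT).hasFDerivAt
      have h2 : partialDeriv i (fun z ↦ a (s z)) y = deriv a (s y) * partialDeriv i s y := by
        rw [partialDeriv, h1.fderiv]; rfl
      have h3 := partialDeriv_mul ((hV.differentiable (by simp)) y) h1.differentiableAt i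
      rw [h2] at h3
      exact h3
    have hdg : ∀ i, partialDeriv i (fun y ↦ χ y * (N i y * R y)) y
        = χ y * (N i y * partialDeriv i R y + R y * partialDeriv i (N i) y)
          + N i y * R y * partialDeriv i χ y := by
      intro i
      rw [partialDeriv_mul (g := fun y ↦ N i y * R y) ((hχ1.differentiable (by simp)) y)
        (hdiff (cQ i) hyT), partialDeriv_mul (hdiff (cN i) hyT) (hdiff cR hyT)]
    -- `div (∇V) = tr Hess V` and `⟨∇|∇V|², ∇V⟩ = 2 Hess V(∇V, ∇V)`
    have e1 := sum_partialDeriv_volDensity_mul_gradCoord c hV hyT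
    have e2 := sum_gradCoord_mul_partialDeriv c hV hyT
    have e3 : ∀ i, lineDeriv ℝ f y (EuclideanSpace.single i 1) * (χ y * (N i y * R y))
        + f y * partialDeriv i (fun y ↦ χ y * (N i y * R y)) y
        = f y * χ y * volDensity m c y * V y * deriv a (s y) *
            (gradCoord c V i y * partialDeriv i s y)
          + f y * χ y * volDensity m c y * a (s y) * (gradCoord c V i y * partialDeriv i V y)
          + f y * χ y * R y * partialDeriv i (N i) y
          + R y * ((f y * partialDeriv i χ y + χ y * lineDeriv ℝ f y (EuclideanSpace.single i 1))
              * volDensity m c y * gradCoord c V i y) := by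
      intro i
      rw [hdg, hdR]
      simp only [N]
      ring
    simp only [e3, Finset.sum_add_distrib, ← Finset.mul_sum]
    rw [e1, e2, energyDensity, hsy]
    simp only [hry, R]
    have e4 : ∑ i, gradCoord c V i y * partialDeriv i V y = s y := rfl
    rw [e4]
    ring
  · have h0 := image_eq_zero_of_notMem_tsupport hy
    have h1 := fun i ↦ partialDeriv_eq_zero_of_notMem hy i
    have h2 : ∀ i, partialDeriv i (fun y ↦ χ y * (N i y * R y)) y = 0 := fun i ↦
      partialDeriv_eq_zero_of_notMem (fun h ↦ hy (tsupport_mul_subset_left h)) i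
    simp [energyDensity, h0, h1, h2]

end EnergyDensity

/-! ### Passage to the limit in the divergence theorem -/

section Limit

variable {m : ℕ}

/-- Passage to the limit in an integral with a bounded coefficient `B` depending continuously on an
almost everywhere convergent sequence. -/
theorem tendsto_integral_coefficient {K : Set (Eucl m)} (hK : IsCompact K)
    {B : Eucl m → (Fin m → ℝ) → ℝ} {C : ℝ} (hBc : ∀ y ∈ K, Continuous (B y))
    (hBC : ∀ y ∈ K, ∀ p, |B y p| ≤ C) {P : ℕ → Fin m → Eucl m → ℝ} {P' : Fin m → Eucl m → ℝ}
    (hBm : ∀ n, AEStronglyMeasurable (fun y ↦ B y fun i ↦ P n i y) (volume.restrict K))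
    (hP : ∀ᵐ y ∂(volume.restrict K), ∀ i,
      Filter.Tendsto (fun n ↦ P n i y) Filter.atTop (𝓝 (P' i y)))
    {F G : ℕ → Eucl m → ℝ} {F' G' : Eucl m → ℝ} (mF : ∀ n, MemLp (F n) 2 (volume.restrict K))
    (mF' : MemLp F' 2 (volume.restrict K)) (hF : TendstoSq (volume.restrict K) F F')
    (mG : ∀ n, MemLp (G n) 2 (volume.restrict K)) (mG' : MemLp G' 2 (volume.restrict K))
    (hG : TendstoSq (volume.restrict K) G G') :
    (∀ n, IntegrableOn (fun y ↦ B y (fun i ↦ P n i y) * (F n y * G n y)) K) ∧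
      IntegrableOn (fun y ↦ B y (fun i ↦ P' i y) * (F' y * G' y)) K ∧
      Filter.Tendsto (fun n ↦ ∫ y in K, B y (fun i ↦ P n i y) * (F n y * G n y)) Filter.atTop
        (𝓝 (∫ y in K, B y (fun i ↦ P' i y) * (F' y * G' y))) := by
  have hb : ∀ p : Eucl m → Fin m → ℝ, ∀ᵐ y ∂(volume.restrict K), |B y (p y)| ≤ C := fun p ↦
    (ae_restrict_iff' hK.measurableSet).2 (.of_forall fun y hy ↦ hBC y hy _)
  have hlim : ∀ᵐ y ∂(volume.restrict K), Filter.Tendsto (fun n ↦ B y fun i ↦ P n i y) Filter.atTop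
      (𝓝 (B y fun i ↦ P' i y)) := by
    filter_upwards [hP, ae_restrict_mem hK.measurableSet] with y hy hyK
    exact ((hBc y hyK).tendsto _).comp (tendsto_pi_nhds.2 hy)
  exact ⟨fun n ↦ ((mF n).integrable_mul (mG n)).bdd_mul (hBm n) (hb fun y i ↦ P n i y),
    (mF'.integrable_mul mG').bdd_mul (aestronglyMeasurable_of_tendsto_ae _ hBm hlim)
      (hb fun y i ↦ P' i y),
    tendsto_integral_mul_mul hBm (fun n ↦ hb fun y i ↦ P n i y) hlim mF mF' hF mG mG' hG⟩

variable {M : Type*} [TopologicalSpace M] [ChartedSpace (Eucl m) M]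
  [RiemannianBundle (fun x : M ↦ TangentSpace (𝓡 m) x)]
  [IsManifold (𝓡 m) ∞ M] [IsContMDiffRiemannianBundle (𝓡 m) ∞ (Eucl m)
      (fun x : M ↦ TangentSpace (𝓡 m) x)]

/-- The coefficient of the Hessian in the energy density is bounded, as `|ξ^i ξ^j| ≤ A |ξ|²` and
`s a'(s)` is bounded. -/
theorem abs_deriv_mul_raise_mul_raise_le (c : M) {y : Eucl m}
    (hy : y ∈ (chartAt (Eucl m) c).target) {a : ℝ → ℝ} {A C : ℝ} (hA : 0 ≤ A)
    (haC' : ∀ s, 0 ≤ s → |s * deriv a s| ≤ C) (hg : ∀ i, metricInv m c i i y ≤ A)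
    (p : Fin m → ℝ) (i j : Fin m) :
    |deriv a (covectorSq c y p) * (raise c y p i * raise c y p j)| ≤ A * C := by
  set s := covectorSq c y p
  have hs : 0 ≤ s := covectorSq_nonneg c hy p
  have h1 : ∀ i, raise c y p i ^ 2 ≤ A * s := fun i ↦
    (raise_sq_le c hy p i).trans (mul_le_mul_of_nonneg_right (hg i) hs)
  have h2 : |raise c y p i * raise c y p j| ≤ A * s := by
    refine abs_le_of_sq_le_sq ?_ (by positivity)
    calc (raise c y p i * raise c y p j) ^ 2 = raise c y p i ^ 2 * raise c y p j ^ 2 := by ring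
      _ ≤ (A * s) * (A * s) := mul_le_mul (h1 i) (h1 j) (sq_nonneg _) (by positivity)
      _ = _ := by ring
  rw [abs_mul]
  calc |deriv a s| * |raise c y p i * raise c y p j| ≤ |deriv a s| * (A * s) := by gcongr
    _ = A * |s * deriv a s| := by rw [abs_mul, abs_of_nonneg hs]; ring
    _ ≤ A * C := by gcongr; exact haC' s hs

/-- The divergence theorem passes to limits of smooth functions that converge in `L²` together with
their gradients and Hessians. -/
theorem integral_energyDensity_of_tendsto (c : M) {K : Set (Eucl m)} (hK : IsCompact K)
    (hKc : K ⊆ (chartAt (Eucl m) c).target) {θ : Eucl m → ℝ} {κ : Fin m → Eucl m → ℝ} {C : ℝ}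
    (mθ : AEStronglyMeasurable θ (volume.restrict K)) (hθ : ∀ y ∈ K, |θ y| ≤ C)
    (mκ : ∀ i, AEStronglyMeasurable (κ i) (volume.restrict K)) (hκ : ∀ i, ∀ y ∈ K, |κ i y| ≤ C)
    {a : ℝ → ℝ} (ha : ContDiff ℝ 1 a) {C' : ℝ} (haC : ∀ s, 0 ≤ s → |a s| ≤ C')
    (haC' : ∀ s, 0 ≤ s → |s * deriv a s| ≤ C') {V : ℕ → Eucl m → ℝ}
    (hV : ∀ n, ContDiff ℝ ∞ (V n)) {U : Eucl m → ℝ} {G : Fin m → Eucl m → ℝ}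
    {H : Fin m → Fin m → Eucl m → ℝ} (mU : MemLp U 2 (volume.restrict K))
    (mG : ∀ i, MemLp (G i) 2 (volume.restrict K)) (mH : ∀ i j, MemLp (H i j) 2 (volume.restrict K))
    (hU : TendstoSq (volume.restrict K) V U)
    (hG : ∀ i, TendstoSq (volume.restrict K) (fun n ↦ partialDeriv i (V n)) (G i))
    (hH : ∀ i j, TendstoSq (volume.restrict K) (fun n ↦ hessCoord c (V n) i j) (H i j))
    (hae : ∀ᵐ y ∂(volume.restrict K), ∀ i,
      Filter.Tendsto (fun n ↦ partialDeriv i (V n) y) Filter.atTop (𝓝 (G i y)))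
    (h0 : ∀ n, ∫ y in K, energyDensity c a (θ y) (fun i ↦ κ i y) y (V n y)
      (fun i ↦ partialDeriv i (V n) y) (fun i j ↦ hessCoord c (V n) i j y) = 0) :
    IntegrableOn (fun y ↦ energyDensity c a (θ y) (fun i ↦ κ i y) y (U y) (fun i ↦ G i y)
        (fun i j ↦ H i j y)) K ∧
      ∫ y in K, energyDensity c a (θ y) (fun i ↦ κ i y) y (U y) (fun i ↦ G i y)
        (fun i j ↦ H i j y) = 0 := by
  set T := (chartAt (Eucl m) c).target
  -- a common bound for the coefficients of the inverse metric
  have hA : ∃ A, 0 ≤ A ∧ ∀ y ∈ K, ∀ i j, |metricInv m c i j y| ≤ A := by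
    have := fun i j ↦ hK.exists_bound_of_continuousOn
      ((contDiffOn_metricInv c i j).continuousOn.mono hKc)
    choose A hA using this
    refine ⟨∑ i, ∑ j, |A i j|, by positivity, fun y hy i j ↦ (hA i j y hy).trans ?_⟩
    refine (le_abs_self _).trans ((Finset.single_le_sum (f := fun j ↦ |A i j|)
      (fun j _ ↦ abs_nonneg _) (Finset.mem_univ j)).trans ?_)
    exact Finset.single_le_sum (f := fun i ↦ ∑ j, |A i j|)
      (fun i _ ↦ Finset.sum_nonneg fun j _ ↦ abs_nonneg _) (Finset.mem_univ i)
  obtain ⟨A, hA0, hA⟩ := hA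
  have hC'0 : 0 ≤ C' := (abs_nonneg _).trans (haC 0 le_rfl)
  set s : Eucl m → (Fin m → ℝ) → ℝ := covectorSq c
  -- the coefficients, as functions of the point and of the covector `dV`
  set B₁ : Fin m → Fin m → Eucl m → (Fin m → ℝ) → ℝ := fun i j y p ↦
    θ y * a (s y p) * metricInv m c i j y
  set B₂ : Fin m → Fin m → Eucl m → (Fin m → ℝ) → ℝ := fun i j y p ↦
    θ y * (a (s y p) * metricInv m c i j y
      + 2 * (deriv a (s y p) * (raise c y p i * raise c y p j)))
  set B₃ : Fin m → Fin m → Eucl m → (Fin m → ℝ) → ℝ := fun i j y p ↦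
    κ i y * a (s y p) * metricInv m c i j y
  have cs : ∀ y, Continuous (s y) := continuous_covectorSq c
  have cr : ∀ y i, Continuous (fun p : Fin m → ℝ ↦ raise c y p i) := fun y i ↦
    continuous_raise c y i
  have cda : Continuous (deriv a) := ha.continuous_deriv le_rfl
  have c₁ : ∀ i j, ∀ y ∈ K, Continuous (B₁ i j y) := fun i j y _ ↦
    (continuous_const.mul (ha.continuous.comp (cs y))).mul continuous_const
  have c₂ : ∀ i j, ∀ y ∈ K, Continuous (B₂ i j y) := fun i j y _ ↦
    continuous_const.mul (((ha.continuous.comp (cs y)).mul continuous_const).add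
      (continuous_const.mul ((cda.comp (cs y)).mul ((cr y i).mul (cr y j)))))
  have c₃ : ∀ i j, ∀ y ∈ K, Continuous (B₃ i j y) := fun i j y _ ↦
    (continuous_const.mul (ha.continuous.comp (cs y))).mul continuous_const
  have hs0 : ∀ y ∈ K, ∀ p, 0 ≤ s y p := fun y hy p ↦ covectorSq_nonneg c (hKc hy) p
  have haA : ∀ y ∈ K, ∀ p i j, |a (s y p) * metricInv m c i j y| ≤ C' * A := fun y hy p i j ↦ by
    rw [abs_mul]
    exact mul_le_mul (haC _ (hs0 y hy p)) (hA y hy i j) (abs_nonneg _) hC'0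
  have b₁ : ∀ i j, ∀ y ∈ K, ∀ p, |B₁ i j y p| ≤ C * (C' * A) := fun i j y hy p ↦ by
    simp only [B₁, mul_assoc]
    rw [abs_mul]
    exact mul_le_mul (hθ y hy) (haA y hy p i j) (abs_nonneg _) ((abs_nonneg _).trans (hθ y hy))
  have b₃ : ∀ i j, ∀ y ∈ K, ∀ p, |B₃ i j y p| ≤ C * (C' * A) := fun i j y hy p ↦ by
    simp only [B₃, mul_assoc]
    rw [abs_mul]
    exact mul_le_mul (hκ i y hy) (haA y hy p i j) (abs_nonneg _) ((abs_nonneg _).trans (hκ i y hy))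
  have b₂ : ∀ i j, ∀ y ∈ K, ∀ p, |B₂ i j y p| ≤ C * (C' * A + 2 * (A * C')) := fun i j y hy p ↦ by
    simp only [B₂]
    rw [abs_mul]
    refine mul_le_mul (hθ y hy) ((abs_add_le _ _).trans (add_le_add (haA y hy p i j) ?_))
      (abs_nonneg _) ((abs_nonneg _).trans (hθ y hy))
    rw [abs_mul, abs_two]
    exact mul_le_mul_of_nonneg_left (abs_deriv_mul_raise_mul_raise_le c (hKc hy) hA0 haC'
      (fun i ↦ (le_abs_self _).trans (hA y hy i i)) p i j) (by norm_num)
  -- measurability of the coefficients along the sequence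
  have cp : ∀ n i, ContinuousOn (partialDeriv i (V n)) T := fun n i ↦
    (contDiff_partialDeriv (hV n) i).continuous.continuousOn
  have mK : ∀ {F : Eucl m → ℝ}, ContinuousOn F T → AEStronglyMeasurable F (volume.restrict K) :=
    fun hF ↦ (hF.mono hKc).aestronglyMeasurable hK.measurableSet
  have csn : ∀ n, ContinuousOn (fun y ↦ s y fun i ↦ partialDeriv i (V n) y) T := fun n ↦
    continuousOn_covectorSq c (cp n)
  have man : ∀ n, AEStronglyMeasurable (fun y ↦ a (s y fun i ↦ partialDeriv i (V n) y))
      (volume.restrict K) := fun n ↦ mK (ha.continuous.comp_continuousOn (csn n))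
  have mA : ∀ i j, AEStronglyMeasurable (metricInv m c i j) (volume.restrict K) := fun i j ↦
    mK (contDiffOn_metricInv c i j).continuousOn
  have m₁ : ∀ i j n, AEStronglyMeasurable (fun y ↦ B₁ i j y fun i ↦ partialDeriv i (V n) y)
      (volume.restrict K) := fun i j n ↦ (mθ.mul (man n)).mul (mA i j)
  have m₃ : ∀ i j n, AEStronglyMeasurable (fun y ↦ B₃ i j y fun i ↦ partialDeriv i (V n) y)
      (volume.restrict K) := fun i j n ↦ ((mκ i).mul (man n)).mul (mA i j)
  have m₂ : ∀ i j n, AEStronglyMeasurable (fun y ↦ B₂ i j y fun i ↦ partialDeriv i (V n) y)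
      (volume.restrict K) := fun i j n ↦ mθ.mul (((man n).mul (mA i j)).add
        (aestronglyMeasurable_const.mul (mK ((cda.comp_continuousOn (csn n)).mul
          ((continuousOn_raise c (cp n) i).mul (continuousOn_raise c (cp n) j))))))
  have mV : ∀ n, MemLp (V n) 2 (volume.restrict K) := fun n ↦
    memLp_of_continuousOn hK (hV n).continuous.continuousOn 2
  have mdV : ∀ i n, MemLp (partialDeriv i (V n)) 2 (volume.restrict K) := fun i n ↦
    memLp_of_continuousOn hK ((cp n i).mono hKc) 2
  have mhV : ∀ i j n, MemLp (hessCoord c (V n) i j) 2 (volume.restrict K) := fun i j n ↦ by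
    refine memLp_of_continuousOn hK ?_ 2
    refine ContinuousOn.sub (contDiff_partialDeriv
      (contDiff_partialDeriv (hV n) j) i).continuous.continuousOn (continuousOn_finsetSum _
        fun k _ ↦ ((contDiffOn_christoffel c k i j).continuousOn.mono hKc).mul ((cp n k).mono hKc))
  have t₁ := fun i j ↦ tendsto_integral_coefficient hK (c₁ i j) (b₁ i j) (m₁ i j) hae
    (mdV i) (mG i) (hG i) (mdV j) (mG j) (hG j)
  have t₂ := fun i j ↦ tendsto_integral_coefficient hK (c₂ i j) (b₂ i j) (m₂ i j) hae
    mV mU hU (mhV i j) (mH i j) (hH i j)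
  have t₃ := fun i j ↦ tendsto_integral_coefficient hK (c₃ i j) (b₃ i j) (m₃ i j) hae
    mV mU hU (mdV j) (mG j) (hG j)
  have iU : ∀ i j, IntegrableOn (fun y ↦ B₁ i j y (fun i ↦ G i y) * (G i y * G j y)
      + B₂ i j y (fun i ↦ G i y) * (U y * H i j y)
      + B₃ i j y (fun i ↦ G i y) * (U y * G j y)) K := fun i j ↦
    ((t₁ i j).2.1.add (t₂ i j).2.1).add (t₃ i j).2.1
  have iV : ∀ n i j, IntegrableOn (fun y ↦
      B₁ i j y (fun i ↦ partialDeriv i (V n) y) * (partialDeriv i (V n) y * partialDeriv j (V n) y)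
      + B₂ i j y (fun i ↦ partialDeriv i (V n) y) * (V n y * hessCoord c (V n) i j y)
      + B₃ i j y (fun i ↦ partialDeriv i (V n) y) * (V n y * partialDeriv j (V n) y)) K :=
    fun n i j ↦ (((t₁ i j).1 n).add ((t₂ i j).1 n)).add ((t₃ i j).1 n)
  simp only [energyDensity_eq_sum] at h0 ⊢
  refine ⟨integrable_finsetSum _ fun i _ ↦ integrable_finsetSum _ fun j _ ↦ iU i j, ?_⟩
  have hlim : ∀ i j, Filter.Tendsto (fun n ↦ ∫ y in K,
      (B₁ i j y (fun i ↦ partialDeriv i (V n) y) * (partialDeriv i (V n) y * partialDeriv j (V n) y)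
      + B₂ i j y (fun i ↦ partialDeriv i (V n) y) * (V n y * hessCoord c (V n) i j y)
      + B₃ i j y (fun i ↦ partialDeriv i (V n) y) * (V n y * partialDeriv j (V n) y))) Filter.atTop
      (𝓝 (∫ y in K, (B₁ i j y (fun i ↦ G i y) * (G i y * G j y)
      + B₂ i j y (fun i ↦ G i y) * (U y * H i j y)
      + B₃ i j y (fun i ↦ G i y) * (U y * G j y)))) := by
    intro i j
    have e : ∫ y in K, (B₁ i j y (fun i ↦ G i y) * (G i y * G j y)
      + B₂ i j y (fun i ↦ G i y) * (U y * H i j y)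
      + B₃ i j y (fun i ↦ G i y) * (U y * G j y)) = _ :=
      (integral_add ((t₁ i j).2.1.add (t₂ i j).2.1) (t₃ i j).2.1).trans
        (congrArg (· + _) (integral_add (t₁ i j).2.1 (t₂ i j).2.1))
    rw [e]
    refine Filter.Tendsto.congr (fun n ↦ ?_) (((t₁ i j).2.2.add (t₂ i j).2.2).add (t₃ i j).2.2)
    exact ((integral_add (((t₁ i j).1 n).add ((t₂ i j).1 n)) ((t₃ i j).1 n)).trans
        (congrArg (· + _) (integral_add ((t₁ i j).1 n) ((t₂ i j).1 n)))).symm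
  have hsum := tendsto_finsetSum Finset.univ fun i _ ↦ tendsto_finsetSum Finset.univ fun j _ ↦
    hlim i j
  have e0 : ∀ n, ∑ i, ∑ j, ∫ y in K,
      (B₁ i j y (fun i ↦ partialDeriv i (V n) y) * (partialDeriv i (V n) y * partialDeriv j (V n) y)
      + B₂ i j y (fun i ↦ partialDeriv i (V n) y) * (V n y * hessCoord c (V n) i j y)
      + B₃ i j y (fun i ↦ partialDeriv i (V n) y) * (V n y * partialDeriv j (V n) y)) = 0 := by
    intro n
    rw [← h0 n, integral_finsetSum _ fun i _ ↦ integrable_finsetSum _ fun j _ ↦ iV n i j]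
    exact Finset.sum_congr rfl fun i _ ↦ (integral_finsetSum _ fun j _ ↦ iV n i j).symm
  simp only [e0] at hsum
  have hU0 := tendsto_nhds_unique hsum tendsto_const_nhds
  rw [integral_finsetSum _ fun i _ ↦ integrable_finsetSum _ fun j _ ↦ iU i j, ← hU0]
  exact Finset.sum_congr rfl fun i _ ↦ integral_finsetSum _ fun j _ ↦ iU i j

end Limit

/-! ### Rademacher's theorem on a manifold -/

section Rademacher

variable {m : ℕ} {M : Type*} [MetricSpace M] [ChartedSpace (Eucl m) M] [IsManifold (𝓡 m) ∞ M]

theorem mdifferentiableAt_of_comp_chart_symm {φ : M → ℝ} (c : M) {y : Eucl m}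
    (hy : y ∈ (chartAt (Eucl m) c).target)
    (h : DifferentiableAt ℝ (fun z ↦ φ ((chartAt (Eucl m) c).symm z)) y) :
    MDifferentiableAt (𝓡 m) 𝓘(ℝ, ℝ) φ ((chartAt (Eucl m) c).symm y) := by
  set x := (chartAt (Eucl m) c).symm y
  have hx : x ∈ (chartAt (Eucl m) c).source := (chartAt (Eucl m) c).map_target hy
  have hxy : chartAt (Eucl m) c x = y := (chartAt (Eucl m) c).right_inv hy
  have h1 : MDifferentiableAt (𝓡 m) 𝓘(ℝ, ℝ)
      ((fun z ↦ φ ((chartAt (Eucl m) c).symm z)) ∘ chartAt (Eucl m) c) x :=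
    MDifferentiableAt.comp (I' := 𝓘(ℝ, Eucl m)) x (by rw [hxy]; exact h.mdifferentiableAt)
      (mdifferentiableAt_chart c hx)
  refine h1.congr_of_eventuallyEq ?_
  filter_upwards [(chartAt (Eucl m) c).open_source.mem_nhds hx] with z hz
  simp only [Function.comp_apply]
  rw [(chartAt (Eucl m) c).left_inv hz]

theorem differential_add {φ ψ : M → ℝ} {x : M} (hφ : MDifferentiableAt (𝓡 m) 𝓘(ℝ, ℝ) φ x)
    (hψ : MDifferentiableAt (𝓡 m) 𝓘(ℝ, ℝ) ψ x) :
    differential (m := m) (fun z ↦ φ z + ψ z) x = differential φ x + differential ψ x :=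
  mfderiv_add hφ hψ

theorem differential_congr {φ ψ : M → ℝ} {x : M} (h : φ =ᶠ[𝓝 x] ψ) :
    differential (m := m) φ x = differential ψ x :=
  h.mfderiv_eq

theorem differential_const (a : ℝ) (x : M) : differential (m := m) (fun _ : M ↦ a) x = 0 :=
  mfderiv_const

theorem differential_sum {ι : Type*} (t : Finset ι) {φ : ι → M → ℝ} {x : M}
    (h : ∀ i ∈ t, MDifferentiableAt (𝓡 m) 𝓘(ℝ, ℝ) (φ i) x) :
    MDifferentiableAt (𝓡 m) 𝓘(ℝ, ℝ) (fun z ↦ ∑ i ∈ t, φ i z) x ∧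
      differential (m := m) (fun z ↦ ∑ i ∈ t, φ i z) x = ∑ i ∈ t, differential (φ i) x := by
  classical
  induction t using Finset.induction_on with
  | empty => simpa using ⟨mdifferentiableAt_const, differential_const 0 x⟩
  | insert i t hi ih =>
    have h1 := h i (Finset.mem_insert_self _ _)
    have h2 := ih fun j hj ↦ h j (Finset.mem_insert_of_mem hj)
    simp only [Finset.sum_insert hi]
    refine ⟨h1.add h2.1, ?_⟩
    rw [differential_add h1 h2.1, h2.2]

theorem differential_eq_zero_of_notMem {φ : M → ℝ} {x : M} (hx : x ∉ tsupport φ) :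
    differential (m := m) φ x = 0 := by
  rw [differential_congr (ψ := fun _ ↦ 0), differential_const]
  exact notMem_tsupport_iff_eventuallyEq.1 hx

variable [RiemannianBundle (fun x : M ↦ TangentSpace (𝓡 m) x)]
  [IsContMDiffRiemannianBundle (𝓡 m) ∞ (Eucl m) (fun x : M ↦ TangentSpace (𝓡 m) x)]
  [IsRiemannianManifold (𝓡 m) M]

/-- Rademacher's theorem in a chart. -/
theorem ae_mdifferentiableAt_chart {φ : M → ℝ} {C : NNReal} (hφ : LipschitzWith C φ) (c : M) :
    ∀ᵐ y ∂(volume.restrict (chartAt (Eucl m) c).target),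
      MDifferentiableAt (𝓡 m) 𝓘(ℝ, ℝ) φ ((chartAt (Eucl m) c).symm y) := by
  set T := (chartAt (Eucl m) c).target
  have hT : IsOpen T := (chartAt (Eucl m) c).open_target
  rw [ae_restrict_iff' hT.measurableSet, ae_iff]
  refine measure_null_of_locally_null _ fun y hy ↦ ?_
  simp only [Set.mem_ofPred_eq, Classical.not_imp] at hy
  obtain ⟨K, hK, hyK, hKT⟩ := exists_compact_subset hT hy.1
  obtain ⟨C', f, hf, hfK⟩ := exists_lipschitz_eqOn hφ c hK hKT
  refine ⟨_, inter_mem_nhdsWithin _ (isOpen_interior.mem_nhds hyK), ?_⟩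
  have hd : ∀ᵐ z, DifferentiableAt ℝ f z := hf.ae_differentiableAt
  rw [ae_iff] at hd
  refine measure_mono_null (t := {z | ¬ DifferentiableAt ℝ f z}) (fun z hz ↦ ?_) hd
  intro hfz
  simp only [Set.mem_inter_iff, Set.mem_ofPred_eq, Classical.not_imp] at hz
  refine hz.1.2 (mdifferentiableAt_of_comp_chart_symm c hz.1.1 (hfz.congr_of_eventuallyEq ?_))
  filter_upwards [isOpen_interior.mem_nhds hz.2] with w hw
  exact (hfK (interior_subset hw)).symm

theorem ae_mdifferentiableAt [MeasurableSpace M] [BorelSpace M] [SecondCountableTopology M]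
    {φ : M → ℝ} {C : NNReal} (hφ : LipschitzWith C φ) :
    ∀ᵐ x ∂(riemannianVolume m M), MDifferentiableAt (𝓡 m) 𝓘(ℝ, ℝ) φ x := by
  rw [ae_iff]
  refine measure_null_of_locally_null _ fun x _ ↦ ?_
  refine ⟨_, inter_mem_nhdsWithin _ ((chartAt (Eucl m) x).open_source.mem_nhds
    (mem_chart_source _ x)), ?_⟩
  have h := (ae_source_iff (m := m) x _).2 (ae_mdifferentiableAt_chart hφ x)
  rw [ae_restrict_iff' (chartAt (Eucl m) x).open_source.measurableSet, ae_iff] at h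
  refine measure_mono_null (fun z hz ↦ ?_) h
  simp only [Set.mem_ofPred_eq, Classical.not_imp]
  exact ⟨hz.2, hz.1⟩

end Rademacher

/-! ### The energy identity -/

section EnergyForm

variable {m : ℕ} {M : Type*} [MetricSpace M] [ChartedSpace (Eucl m) M] [IsManifold (𝓡 m) ∞ M]
  [RiemannianBundle (fun x : M ↦ TangentSpace (𝓡 m) x)]

/-- The integrand `θ (a |X|² + v (a tr h + 2 a' h(X, X))) + v a ℓ(X)`, where `a` and `a'` are
evaluated at `|X|²`. For `v = u`, `X = ∇u`, `h = Hess u` and `ℓ = dθ` it is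
`div (θ u a(|∇u|²) ∇u)`. -/
def energyForm (a : ℝ → ℝ) {x : M} (v : ℝ) (X : TangentSpace (𝓡 m) x)
    (h : TangentSpace (𝓡 m) x →L[ℝ] TangentSpace (𝓡 m) x →L[ℝ] ℝ) (θ : ℝ)
    (ℓ : TangentSpace (𝓡 m) x →L[ℝ] ℝ) : ℝ :=
  θ * (a (‖X‖ ^ 2) * ‖X‖ ^ 2 + v * (a (‖X‖ ^ 2) * tensorTrace h
    + 2 * deriv a (‖X‖ ^ 2) * h X X)) + v * a (‖X‖ ^ 2) * ℓ X

theorem energyDensity_eq_energyForm (c : M) (a : ℝ → ℝ) {y : Eucl m}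
    (hy : y ∈ (chartAt (Eucl m) c).target) (v : ℝ)
    (X : TangentSpace (𝓡 m) ((chartAt (Eucl m) c).symm y))
    (h : TangentSpace (𝓡 m) ((chartAt (Eucl m) c).symm y) →L[ℝ]
      TangentSpace (𝓡 m) ((chartAt (Eucl m) c).symm y) →L[ℝ] ℝ) (θ : ℝ)
    (ℓ : TangentSpace (𝓡 m) ((chartAt (Eucl m) c).symm y) →L[ℝ] ℝ) (w : ℝ) :
    energyDensity c a (θ * w) (fun i ↦ ℓ (coordVector m c i y) * w) y v
      (fun i ↦ inner ℝ X (coordVector m c i y))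
      (fun i j ↦ h (coordVector m c i y) (coordVector m c j y))
    = w * energyForm a v X h θ ℓ := by
  set p : Fin m → ℝ := fun i ↦ inner ℝ X (coordVector m c i y)
  set ξ := raise c y p
  have hX : X = chartDeriv c y ξ := eq_chartDeriv_raise c hy X
  have e1 : covectorSq c y p = ‖X‖ ^ 2 := by rw [covectorSq_eq c hy, ← hX]
  have e2 : ∑ i, ∑ j, ξ i * ξ j * h (coordVector m c i y) (coordVector m c j y) = h X X := by
    rw [← apply_chartDeriv, ← hX]
  have e3 : ∑ i, ℓ (coordVector m c i y) * w * ξ i = w * ℓ X := by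
    conv_rhs => rw [hX, chartDeriv_apply, map_sum]
    rw [Finset.mul_sum]
    refine Finset.sum_congr rfl fun i _ ↦ ?_
    rw [map_smul, smul_eq_mul]
    ring
  rw [energyDensity, e1, e2, e3, ← tensorTrace_eq c hy, energyForm]
  ring

variable [IsContMDiffRiemannianBundle (𝓡 m) ∞ (Eucl m) (fun x : M ↦ TangentSpace (𝓡 m) x)]
  [MeasurableSpace M] [BorelSpace M] [SecondCountableTopology M]

theorem integrableOn_source (c : M) {F : M → ℝ}
    (h : IntegrableOn (fun y ↦ volDensity m c y * F ((chartAt (Eucl m) c).symm y))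
      (chartAt (Eucl m) c).target) :
    IntegrableOn F (chartAt (Eucl m) c).source (riemannianVolume m M) := by
  have hT := (chartAt (Eucl m) c).open_target.measurableSet
  refine ⟨(aestronglyMeasurable_source_iff c F).2 ?_, ?_⟩
  · refine ((aemeasurable_volDensity c).inv.aestronglyMeasurable.mul h.1).congr ?_
    refine (ae_restrict_iff' hT).2 (.of_forall fun y hy ↦ ?_)
    exact inv_mul_cancel_left₀ (volDensity_pos c hy).ne' _
  · rw [HasFiniteIntegral, lintegral_source c fun x ↦ ‖F x‖ₑ]
    refine lt_of_eq_of_lt (lintegral_congr fun y ↦ ?_) h.2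
    rw [enorm_mul, Real.enorm_eq_ofReal (show 0 ≤ volDensity m c y from Real.sqrt_nonneg _)]

variable [IsRiemannianManifold (𝓡 m) M]

/-- The energy identity, tested against the product of a smooth function supported in a chart and a
Lipschitz function. -/
theorem integral_energyForm_chart {u : M → ℝ}
    {h : ∀ x : M, TangentSpace (𝓡 m) x →L[ℝ] TangentSpace (𝓡 m) x →L[ℝ] ℝ}
    {X : ∀ x : M, TangentSpace (𝓡 m) x} (hh : IsWeakHessian m u h) (hX : IsWeakGradient m u X)
    (c : M) (hu : LocallySq (chartAt (Eucl m) c).target fun y ↦ u ((chartAt (Eucl m) c).symm y))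
    (hh2 : ∀ i j, LocallySq (chartAt (Eucl m) c).target fun y ↦
      h ((chartAt (Eucl m) c).symm y) (coordVector m c i y) (coordVector m c j y))
    (hX2 : ∀ i, LocallySq (chartAt (Eucl m) c).target fun y ↦
      (inner ℝ (X ((chartAt (Eucl m) c).symm y)) (coordVector m c i y) : ℝ))
    {a : ℝ → ℝ} (ha : ContDiff ℝ 1 a) {A : ℝ} (haA : ∀ s, 0 ≤ s → |a s| ≤ A)
    (haA' : ∀ s, 0 ≤ s → |s * deriv a s| ≤ A) {S : Set (Eucl m)} (hS : IsCompact S)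
    (hSc : S ⊆ (chartAt (Eucl m) c).target) {ρ : M → ℝ} (hρ : ContMDiff (𝓡 m) 𝓘(ℝ, ℝ) ∞ ρ)
    (hρS : tsupport ρ ⊆ chartInterior c S) {φ : M → ℝ} {C : NNReal} (hφ : LipschitzWith C φ) :
    Integrable (fun x ↦ energyForm a (u x) (X x) (h x) (φ x * ρ x)
        (φ x • differential ρ x + ρ x • differential φ x)) (riemannianVolume m M) ∧
      ∫ x, energyForm a (u x) (X x) (h x) (φ x * ρ x)
        (φ x • differential ρ x + ρ x • differential φ x) ∂(riemannianVolume m M) = 0 := by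
  set T := (chartAt (Eucl m) c).target
  have hT : IsOpen T := (chartAt (Eucl m) c).open_target
  set F : M → ℝ := fun x ↦ energyForm a (u x) (X x) (h x) (φ x * ρ x)
        (φ x • differential ρ x + ρ x • differential φ x)
  have hF0 : ∀ x, x ∉ tsupport ρ → F x = 0 := fun x hx ↦ by
    have h1 : ρ x = 0 := image_eq_zero_of_notMem_tsupport hx
    simp [F, energyForm, h1, differential_eq_zero_of_notMem hx]
  have hFsymm : ∀ y ∈ T \ S, volDensity m c y * F ((chartAt (Eucl m) c).symm y) = 0 :=
    fun y hy ↦ by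
      rw [hF0 _ fun hmem ↦ hy.2 ?_, mul_zero]
      have := interior_subset (hρS hmem).2
      rwa [(chartAt (Eucl m) c).right_inv hy.1] at this
  -- the test function in coordinates
  set χ : Eucl m → ℝ := T.indicator fun y ↦ ρ ((chartAt (Eucl m) c).symm y)
  have hχT : ∀ y ∈ T, χ y = ρ ((chartAt (Eucl m) c).symm y) := fun y hy ↦
    Set.indicator_of_mem hy _
  have hχS : Function.support χ ⊆ S := fun y hy ↦ by
    have hyT : y ∈ T := by
      by_contra h; exact hy (Set.indicator_of_notMem h _)
    have h1 : ρ ((chartAt (Eucl m) c).symm y) ≠ 0 := by rw [← hχT y hyT]; exact hy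
    have := interior_subset (hρS (subset_tsupport _ h1)).2
    rwa [(chartAt (Eucl m) c).right_inv hyT] at this
  have hχS' : tsupport χ ⊆ S := closure_minimal hχS hS.isClosed
  have hχ : IsTest T χ := by
    refine ⟨contDiff_iff_contDiffAt.2 fun y ↦ ?_,
      hS.of_isClosed_subset (isClosed_tsupport _) hχS', hχS'.trans hSc⟩
    by_cases hy : y ∈ T
    · have h1 : ContMDiffAt 𝓘(ℝ, Eucl m) 𝓘(ℝ, ℝ) ∞
          (ρ ∘ (chartAt (Eucl m) c).symm) y :=
        hρ.contMDiffAt.comp y ((contMDiffOn_chart_symm (I := 𝓡 m) (n := ∞) (x := c)).contMDiffAt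
          (hT.mem_nhds hy))
      refine h1.contDiffAt.congr_of_eventuallyEq ?_
      filter_upwards [hT.mem_nhds hy] with z hz
      exact hχT z hz
    · refine contDiffAt_const (c := (0:ℝ)).congr_of_eventuallyEq ?_
      filter_upwards [hS.isClosed.isOpen_compl.mem_nhds fun h ↦ hy (hSc h)] with z hz
      by_contra h0
      exact hz (hχS h0)
  -- a Lipschitz function on `ℝ^m` that equals `φ` near the support, so that it has the same
  -- derivatives there
  obtain ⟨S', hS', hSS', hS'T⟩ := exists_compact_between hS hT hSc
  obtain ⟨L, f, hf, hfS'⟩ := exists_lipschitz_eqOn hφ c hS' hS'T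
  set w := volDensity m c
  set e : Fin m → Eucl m := fun i ↦ EuclideanSpace.single i (1:ℝ)
  set θ : Eucl m → ℝ := fun y ↦ f y * χ y * w y
  set κ : Fin m → Eucl m → ℝ := fun i y ↦
    (f y * partialDeriv i χ y + χ y * lineDeriv ℝ f y (e i)) * w y
  obtain ⟨V, hV, hVu, hVG, hVH, hVae⟩ :=
    exists_smooth_approximation_hessian hh hX c hu hh2 hX2 hS hSc
  have cw : ContinuousOn w S := (contDiffOn_volDensity c).continuousOn.mono hSc
  have cf : ContinuousOn f S := hf.continuous.continuousOn
  have cχ : ContinuousOn χ S := hχ.smooth.continuous.continuousOn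
  have cdχ : ∀ i, ContinuousOn (partialDeriv i χ) S := fun i ↦
    (contDiff_partialDeriv hχ.smooth i).continuous.continuousOn
  obtain ⟨C₀, hC₀⟩ := hS.exists_bound_of_continuousOn ((cf.mul cχ).mul cw)
  have hbd := fun i ↦ hS.exists_bound_of_continuousOn ((cf.mul (cdχ i)).mul cw)
  choose C₁ hC₁ using hbd
  obtain ⟨C₂, hC₂⟩ := hS.exists_bound_of_continuousOn (cχ.mul cw)
  have hline : ∀ i y, |lineDeriv ℝ f y (e i)| ≤ L := fun i y ↦ by
    have := norm_lineDeriv_le_of_lipschitz ℝ hf (x₀ := y) (v := e i)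
    simpa [e] using this
  have hκ : ∀ i, ∀ y ∈ S, |κ i y| ≤ |C₀| + (∑ i, |C₁ i|) + L * |C₂| := fun i y hy ↦ by
    have e1 : κ i y = f y * partialDeriv i χ y * w y + lineDeriv ℝ f y (e i) * (χ y * w y) := by
      simp only [κ]; ring
    have e2 : |f y * partialDeriv i χ y * w y| ≤ ∑ i, |C₁ i| :=
      (hC₁ i y hy).trans ((le_abs_self _).trans (Finset.single_le_sum (f := fun i ↦ |C₁ i|)
        (fun i _ ↦ abs_nonneg _) (Finset.mem_univ i)))
    have e3 : |lineDeriv ℝ f y (e i) * (χ y * w y)| ≤ L * |C₂| := by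
      rw [abs_mul]
      exact mul_le_mul (hline i y) ((hC₂ y hy).trans (le_abs_self _)) (abs_nonneg _) L.2
    rw [e1]
    refine (abs_add_le _ _).trans ?_
    linarith [abs_nonneg C₀]
  have hθ : ∀ y ∈ S, |θ y| ≤ |C₀| + (∑ i, |C₁ i|) + L * |C₂| := fun y hy ↦ by
    have h1 : |θ y| ≤ |C₀| := (hC₀ y hy).trans (le_abs_self _)
    have h2 : 0 ≤ ∑ i, |C₁ i| := Finset.sum_nonneg fun i _ ↦ abs_nonneg _
    have h3 : 0 ≤ L * |C₂| := mul_nonneg L.2 (abs_nonneg _)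
    linarith
  have mS : ∀ {g : Eucl m → ℝ}, ContinuousOn g S → AEStronglyMeasurable g (volume.restrict S) :=
    fun hg ↦ hg.aestronglyMeasurable hS.measurableSet
  have hlim := integral_energyDensity_of_tendsto c hS hSc (θ := θ) (κ := κ)
    (mS ((cf.mul cχ).mul cw)) hθ
    (fun i ↦ ((mS (cf.mul (cdχ i))).add ((mS cχ).mul
      (measurable_lineDeriv hf.continuous).aestronglyMeasurable)).mul (mS cw)) hκ ha haA haA' hV
    (hu S hS hSc) (fun i ↦ hX2 i S hS hSc) (fun i j ↦ hh2 i j S hS hSc) hVu hVG hVH hVae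
    (fun n ↦ by
      rw [setIntegral_eq_integral_of_forall_compl_eq_zero fun y hy ↦ ?_]
      · exact integral_energyDensity_smooth c (hV n) ha hχ hf
      · have hy' : y ∉ tsupport χ := fun h ↦ hy (hχS' h)
        simp [energyDensity, θ, κ, image_eq_zero_of_notMem_tsupport hy',
          partialDeriv_eq_zero_of_notMem hy'])
  -- the coordinate density of the limit is `energyForm`, wherever the Lipschitz factor is
  -- differentiable
  have hae : ∀ᵐ y ∂(volume.restrict S), energyDensity c a (θ y) (fun i ↦ κ i y) y
      (u ((chartAt (Eucl m) c).symm y))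
      (fun i ↦ inner ℝ (X ((chartAt (Eucl m) c).symm y)) (coordVector m c i y))
      (fun i j ↦ h ((chartAt (Eucl m) c).symm y) (coordVector m c i y) (coordVector m c j y))
      = w y * F ((chartAt (Eucl m) c).symm y) := by
    have hd : ∀ᵐ z, DifferentiableAt ℝ f z := hf.ae_differentiableAt
    filter_upwards [ae_restrict_mem hS.measurableSet, ae_restrict_of_ae hd] with y hyS hfy
    have hyT := hSc hyS
    have hff : (fun z ↦ φ ((chartAt (Eucl m) c).symm z)) =ᶠ[𝓝 y] f := by
      filter_upwards [isOpen_interior.mem_nhds (hSS' hyS)] with z hz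
      exact (hfS' (interior_subset hz)).symm
    have hφd : MDifferentiableAt (𝓡 m) 𝓘(ℝ, ℝ) φ ((chartAt (Eucl m) c).symm y) :=
      mdifferentiableAt_of_comp_chart_symm c hyT (hfy.congr_of_eventuallyEq hff)
    have h1 : ∀ i, differential φ _ (coordVector m c i y) = lineDeriv ℝ f y (e i) := fun i ↦ by
      rw [coordVector_eq, differential_chartDeriv c hyT hφd, hfy.lineDeriv_eq_fderiv]
      exact congrArg (fun B : Eucl m →L[ℝ] ℝ ↦ B (e i)) hff.fderiv_eq
    have h2 : ∀ i, differential ρ _ (coordVector m c i y) = partialDeriv i χ y := fun i ↦ by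
      rw [coordVector_eq, differential_chartDeriv c hyT (hρ.mdifferentiable (by simp) _)]
      refine congrArg (fun B : Eucl m →L[ℝ] ℝ ↦ B (e i)) (Filter.EventuallyEq.fderiv_eq ?_)
      filter_upwards [hT.mem_nhds hyT] with z hz
      exact (hχT z hz).symm
    have h3 : f y = φ ((chartAt (Eucl m) c).symm y) := hff.self_of_nhds.symm
    rw [← energyDensity_eq_energyForm c a hyT]
    simp only [θ, κ, h3, hχT y hyT, ← h1, ← h2, add_apply, smul_apply, smul_eq_mul]
  have hI : IntegrableOn (fun y ↦ w y * F ((chartAt (Eucl m) c).symm y)) S := hlim.1.congr hae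
  have hI0 : ∫ y in S, w y * F ((chartAt (Eucl m) c).symm y) = 0 := by
    rw [← hlim.2]
    exact (integral_congr_ae hae).symm
  have hIT := IntegrableOn.of_forall_sdiff_eq_zero hI hT.measurableSet hFsymm
  have hFs : ∀ x, x ∉ (chartAt (Eucl m) c).source → F x = 0 := fun x hx ↦
    hF0 x fun hmem ↦ hx (hρS hmem).1
  refine ⟨?_, ?_⟩
  · refine (integrableOn_iff_integrable_of_support_subset fun x hx ↦ ?_).1
      (integrableOn_source c hIT)
    by_contra hxs
    exact hx (hFs x hxs)
  · rw [← setIntegral_eq_integral_of_forall_compl_eq_zero hFs, integral_source, ← hI0]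
    exact setIntegral_eq_of_subset_of_forall_sdiff_eq_zero hT.measurableSet hSc hFsymm

/-- The energy identity `∫ div (φ u a(|∇u|²) ∇u) = 0` for Lipschitz functions `φ` with compact
support. -/
theorem integral_energyForm {u : M → ℝ}
    {h : ∀ x : M, TangentSpace (𝓡 m) x →L[ℝ] TangentSpace (𝓡 m) x →L[ℝ] ℝ}
    {X : ∀ x : M, TangentSpace (𝓡 m) x} (hh : IsWeakHessian m u h) (hX : IsWeakGradient m u X)
    (hu : ∀ c : M, LocallySq (chartAt (Eucl m) c).target fun y ↦ u ((chartAt (Eucl m) c).symm y))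
    (hh2 : ∀ c i j, LocallySq (chartAt (Eucl m) c).target fun y ↦
      h ((chartAt (Eucl m) c).symm y) (coordVector m c i y) (coordVector m c j y))
    (hX2 : ∀ c i, LocallySq (chartAt (Eucl m) c).target fun y ↦
      (inner ℝ (X ((chartAt (Eucl m) c).symm y)) (coordVector m c i y) : ℝ))
    {a : ℝ → ℝ} (ha : ContDiff ℝ 1 a) {A : ℝ} (haA : ∀ s, 0 ≤ s → |a s| ≤ A)
    (haA' : ∀ s, 0 ≤ s → |s * deriv a s| ≤ A) {φ : M → ℝ} {C : NNReal} (hφ : LipschitzWith C φ)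
    (hφc : HasCompactSupport φ) :
    Integrable (fun x ↦ energyForm a (u x) (X x) (h x) (φ x) (differential φ x))
        (riemannianVolume m M) ∧
      ∫ x, energyForm a (u x) (X x) (h x) (φ x) (differential φ x) ∂(riemannianVolume m M) = 0 := by
  have : LocallyCompactSpace M := ChartedSpace.locallyCompactSpace (Eucl m) M
  obtain ⟨L, hL, hφL⟩ := exists_compact_superset hφc.isCompact
  have hK : ∀ x : M, ∃ K : Set (Eucl m), IsCompact K ∧ K ⊆ (chartAt (Eucl m) x).target ∧
      x ∈ chartInterior x K := by
    intro x
    obtain ⟨K, hK, hxK, hKT⟩ := exists_compact_subset (chartAt (Eucl m) x).open_target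
      (mem_chart_target (Eucl m) x)
    exact ⟨K, hK, hKT, mem_chart_source _ x, hxK⟩
  choose K hK hKT hKx using hK
  -- a partition of unity near the support of `φ`; the integrand is linear in the test function
  -- and its differential
  obtain ⟨t, ρ, hρ, hρK, hρ1⟩ := exists_finite_partition (m := m)
    (U := fun x : M ↦ chartInterior x (K x)) (fun x ↦ isOpen_chartInterior x _) hL
    (fun x _ ↦ Set.mem_iUnion.2 ⟨x, hKx x⟩)
  have hi := fun i : t ↦ integral_energyForm_chart hh hX (i : M) (hu i) (hh2 i) (hX2 i) ha haA haA'
    (hK i) (hKT i) (hρ i) (hρK i) hφ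
  have hsum : ∀ x, energyForm a (u x) (X x) (h x) (φ x) (differential φ x)
      = ∑ i, energyForm a (u x) (X x) (h x) (φ x * ρ i x)
        (φ x • differential (ρ i) x + ρ i x • differential φ x) := by
    intro x
    have h1 : φ x * ∑ i, ρ i x = φ x ∧
        φ x • ∑ i, differential (m := m) (ρ i) x + (∑ i, ρ i x) • differential φ x =
          differential φ x := by
      by_cases hx : x ∈ tsupport φ
      · have h2 : (fun z ↦ ∑ i, ρ i z) =ᶠ[𝓝 x] fun _ ↦ 1 := by
          filter_upwards [isOpen_interior.mem_nhds (hφL hx)] with z hz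
          exact hρ1 z (interior_subset hz)
        have h3 := (differential_sum Finset.univ (φ := ρ) (x := x)
          fun i _ ↦ (hρ i).mdifferentiable (by simp) x).2
        rw [differential_congr h2, differential_const] at h3
        rw [← h3, hρ1 x (interior_subset (hφL hx))]
        simp
      · simp [image_eq_zero_of_notMem_tsupport hx, differential_eq_zero_of_notMem hx]
    conv_lhs => rw [← h1.1, ← h1.2]
    simp only [energyForm, add_apply, smul_apply, sum_apply, smul_eq_mul, Finset.sum_add_distrib,
      mul_add, ← Finset.mul_sum, ← Finset.sum_mul]
  simp only [hsum]
  refine ⟨integrable_finsetSum _ fun i _ ↦ (hi i).1, ?_⟩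
  rw [integral_finsetSum _ fun i _ ↦ (hi i).1]
  exact Finset.sum_eq_zero fun i _ ↦ (hi i).2

end EnergyForm

/-! ### Regularized powers -/

section RegularizedPower

/-- A regularization of the power `s ^ q` on `[0, ∞)`: it is smooth, bounded, at most `s ^ q`, and
converges to `s ^ q` as `δ → 0`, while its logarithmic derivative stays bounded by `k / s`. -/
def regularizedPower (q : ℝ) (k : ℕ) (δ s : ℝ) : ℝ :=
  s ^ k * (s ^ 2 + δ) ^ ((q - k) / 2) * (1 + δ * s ^ 2) ^ (-(q / 2))

variable {q : ℝ} {k : ℕ} {δ : ℝ}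

theorem contDiff_regularizedPower (hδ : 0 < δ) {n : WithTop ℕ∞} :
    ContDiff ℝ n (regularizedPower q k δ) := by
  unfold regularizedPower
  refine ContDiff.mul (ContDiff.mul (by fun_prop) (ContDiff.rpow_const_of_ne (by fun_prop) ?_))
    (ContDiff.rpow_const_of_ne (by fun_prop) ?_) <;> intro s <;> positivity

theorem regularizedPower_nonneg (hδ : 0 < δ) {s : ℝ} (hs : 0 ≤ s) :
    0 ≤ regularizedPower q k δ s := by
  unfold regularizedPower
  positivity

theorem sq_rpow_half {s : ℝ} (hs : 0 ≤ s) (t : ℝ) : (s ^ 2) ^ (t / 2) = s ^ t := by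
  rw [← Real.rpow_natCast, ← Real.rpow_mul hs]
  congr 1
  push_cast
  ring

theorem pow_mul_rpow_le_rpow (hδ : 0 < δ) (hk : q ≤ k) (hk1 : 1 ≤ k) {s : ℝ} (hs : 0 ≤ s) :
    s ^ k * (s ^ 2 + δ) ^ ((q - k) / 2) ≤ s ^ q := by
  rcases hs.eq_or_lt with rfl | hs'
  · rw [zero_pow (by omega), zero_mul]
    positivity
  calc s ^ k * (s ^ 2 + δ) ^ ((q - k) / 2) ≤ s ^ k * (s ^ 2) ^ ((q - k) / 2) := by
        refine mul_le_mul_of_nonneg_left (Real.rpow_le_rpow_of_nonpos ?_ ?_ ?_) (by positivity)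
        · positivity
        · linarith
        · linarith
    _ = s ^ q := by
        rw [sq_rpow_half hs, ← Real.rpow_natCast, ← Real.rpow_add hs']
        congr 1
        ring

theorem regularizedPower_le_rpow (hq : 0 ≤ q) (hδ : 0 < δ) (hk : q ≤ k) (hk1 : 1 ≤ k) {s : ℝ}
    (hs : 0 ≤ s) : regularizedPower q k δ s ≤ s ^ q := by
  refine (mul_le_of_le_one_right (by positivity) ?_).trans (pow_mul_rpow_le_rpow hδ hk hk1 hs)
  exact Real.rpow_le_one_of_one_le_of_nonpos (by nlinarith [sq_nonneg s]) (by linarith)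

theorem regularizedPower_le (hq : 0 ≤ q) (hδ : 0 < δ) (hk : q ≤ k) (hk1 : 1 ≤ k) {s : ℝ}
    (hs : 0 ≤ s) : regularizedPower q k δ s ≤ δ ^ (-(q / 2)) := by
  have h0 : 0 ≤ s ^ q := by positivity
  calc regularizedPower q k δ s ≤ s ^ q * (1 + δ * s ^ 2) ^ (-(q / 2)) := by
        unfold regularizedPower
        gcongr
        exact pow_mul_rpow_le_rpow hδ hk hk1 hs
    _ = (s ^ 2 / (1 + δ * s ^ 2)) ^ (q / 2) := by
        rw [Real.div_rpow (by positivity) (by positivity), sq_rpow_half hs,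
          Real.rpow_neg (x := 1 + δ * s ^ 2) (by positivity), ← div_eq_mul_inv]
    _ ≤ (δ⁻¹) ^ (q / 2) := by
        refine Real.rpow_le_rpow (by positivity) ?_ (by linarith)
        rw [div_le_iff₀ (by positivity), mul_add, ← mul_assoc, inv_mul_cancel₀ hδ.ne']
        have : 0 < δ⁻¹ := by positivity
        linarith
    _ = δ ^ (-(q / 2)) := by rw [Real.inv_rpow hδ.le, Real.rpow_neg hδ.le]

/-- The logarithmic derivative of the regularized power. -/
theorem mul_deriv_regularizedPower (hδ : 0 < δ) (s : ℝ) :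
    s * deriv (regularizedPower q k δ) s = regularizedPower q k δ s *
      (k + (q - k) * (s ^ 2 / (s ^ 2 + δ)) - q * (δ * s ^ 2 / (1 + δ * s ^ 2))) := by
  have p1 : 0 < s ^ 2 + δ := by positivity
  have p2 : 0 < 1 + δ * s ^ 2 := by positivity
  have h0 : HasDerivAt (fun s : ℝ ↦ s ^ 2 + δ) (2 * s) s := by
    simpa using (hasDerivAt_pow 2 s).add_const δ
  have h0' : HasDerivAt (fun s : ℝ ↦ 1 + δ * s ^ 2) (δ * (2 * s)) s := by
    simpa using ((hasDerivAt_pow 2 s).const_mul δ).const_add 1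
  have h1 := ((hasDerivAt_pow k s).mul (h0.rpow_const (p := (q - k) / 2) (.inl p1.ne'))).mul
    (h0'.rpow_const (p := -(q / 2)) (.inl p2.ne'))
  have h2 : deriv (regularizedPower q k δ) s = _ := h1.deriv
  have h3 : s * (k * s ^ (k - 1)) = k * s ^ k := by
    rcases k with _ | k
    · simp
    · rw [Nat.add_sub_cancel, pow_succ]; ring
  rw [h2, regularizedPower, Real.rpow_sub_one p1.ne', Real.rpow_sub_one p2.ne']
  simp only [Pi.mul_apply]
  set P := (s ^ 2 + δ) ^ ((q - k) / 2)
  set Q := (1 + δ * s ^ 2) ^ (-(q / 2))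
  calc _ = (s * (k * s ^ (k - 1))) * P * Q
        + s ^ k * P * Q * ((q - k) * (s ^ 2 / (s ^ 2 + δ)))
        - s ^ k * P * Q * (q * (δ * s ^ 2 / (1 + δ * s ^ 2))) := by field_simp; ring
    _ = _ := by rw [h3]; ring

theorem abs_mul_deriv_regularizedPower_le (hq : 0 ≤ q) (hδ : 0 < δ) (hk : q ≤ k) {s : ℝ}
    (hs : 0 ≤ s) : |s * deriv (regularizedPower q k δ) s| ≤ k * regularizedPower q k δ s := by
  have ha := regularizedPower_nonneg (q := q) (k := k) hδ hs
  rw [mul_deriv_regularizedPower hδ, abs_mul, abs_of_nonneg ha, mul_comm]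
  refine mul_le_mul_of_nonneg_right ?_ ha
  have a1 : s ^ 2 / (s ^ 2 + δ) ≤ 1 := (div_le_one (by positivity)).2 (by linarith)
  have a0 : 0 ≤ s ^ 2 / (s ^ 2 + δ) := by positivity
  have b1 : δ * s ^ 2 / (1 + δ * s ^ 2) ≤ 1 := (div_le_one (by positivity)).2 (by linarith)
  have b0 : 0 ≤ δ * s ^ 2 / (1 + δ * s ^ 2) := by positivity
  rw [abs_le]
  constructor <;> nlinarith

theorem tendsto_regularizedPower {δ : ℕ → ℝ} (hδ : Filter.Tendsto δ Filter.atTop (𝓝 0)) {s : ℝ}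
    (hs : 0 ≤ s) : Filter.Tendsto (fun n ↦ regularizedPower q k (δ n) s * s) Filter.atTop
      (𝓝 (s ^ q * s)) := by
  rcases hs.eq_or_lt with rfl | hs'
  · simp
  refine Filter.Tendsto.mul_const _ ?_
  have h1 : Filter.Tendsto (fun n ↦ s ^ 2 + δ n) Filter.atTop (𝓝 (s ^ 2)) := by
    simpa using hδ.const_add (s ^ 2)
  have h2 : Filter.Tendsto (fun n ↦ 1 + δ n * s ^ 2) Filter.atTop (𝓝 1) := by
    simpa using (hδ.mul_const (s ^ 2)).const_add 1
  have h3 := ((h1.rpow_const (p := (q - k) / 2) (.inl (by positivity))).const_mul (s ^ k)).mul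
    (h2.rpow_const (p := -(q / 2)) (.inl one_ne_zero))
  rw [Real.one_rpow, mul_one, sq_rpow_half hs, ← Real.rpow_natCast s k, ← Real.rpow_add hs',
    add_sub_cancel] at h3
  refine h3.congr fun n ↦ ?_
  rw [regularizedPower, Real.rpow_natCast]

end RegularizedPower

/-! ### Young's inequalities -/

section Young

/-- Young's inequality for the Hessian terms of the energy identity. -/
theorem mul_mul_weight_le {q c A K a s w : ℝ} (hq : 0 ≤ q) (hc : 0 ≤ c) (hA : 0 ≤ A) (hK : 0 ≤ K)
    (ha : 0 ≤ a) (hs : 0 ≤ s) (has : a ≤ s ^ q) (hw : 0 ≤ w) (hw1 : w ≤ 1) :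
    w * (c * A * K * a) ≤ w * a * s / 4
      + c * (4 * c) ^ q * (A ^ (2 * q + 2) + K ^ (2 * q + 2)) := by
  have h0 : 0 ≤ c * (4 * c) ^ q * (A ^ (2 * q + 2) + K ^ (2 * q + 2)) := by positivity
  -- either the term is absorbed, or `s` and hence the weight are controlled by `A K`
  rcases le_total (4 * (c * A * K)) s with h | h
  · have : w * a * (4 * (c * A * K)) ≤ w * a * s := by gcongr
    linarith
  have h1 : (A * K) ^ (q + 1) ≤ A ^ (2 * q + 2) + K ^ (2 * q + 2) := by
    have key : ∀ {x y : ℝ}, 0 ≤ x → x ≤ y → (x * y) ^ (q + 1) ≤ y ^ (2 * q + 2) := by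
      intro x y hx hxy
      have hy := hx.trans hxy
      calc (x * y) ^ (q + 1) ≤ (y ^ 2) ^ ((2 * q + 2) / 2) := by
            rw [show (2 * q + 2) / 2 = q + 1 by ring]
            refine Real.rpow_le_rpow (by positivity) (by nlinarith) (by linarith)
        _ = y ^ (2 * q + 2) := sq_rpow_half hy _
    have hA0 : 0 ≤ A ^ (2 * q + 2) := by positivity
    have hK0 : 0 ≤ K ^ (2 * q + 2) := by positivity
    rcases le_total A K with hAK | hAK
    · exact (key hA hAK).trans (by linarith)
    · rw [mul_comm]
      exact (key hK hAK).trans (by linarith)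
  have h2 : a ≤ (4 * c) ^ q * (A * K) ^ q := by
    rw [← Real.mul_rpow (by positivity) (by positivity)]
    refine has.trans (Real.rpow_le_rpow hs (by linarith) hq)
  have h3 : (A * K) ^ (q + 1) = (A * K) ^ q * (A * K) := by
    rw [Real.rpow_add_one' (by positivity) (by linarith)]
  have h4 : w * (c * A * K * a) ≤ c * (4 * c) ^ q * (A * K) ^ (q + 1) := by
    calc w * (c * A * K * a) ≤ 1 * (c * A * K * ((4 * c) ^ q * (A * K) ^ q)) := by gcongr
      _ = _ := by rw [h3]; ring
  have h5 : 0 ≤ w * a * s / 4 := by positivity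
  have h6 : c * (4 * c) ^ q * (A * K) ^ (q + 1)
      ≤ c * (4 * c) ^ q * (A ^ (2 * q + 2) + K ^ (2 * q + 2)) := by gcongr
  linarith

/-- Young's inequality for the cutoff term of the energy identity. -/
theorem cutoff_mul_weight_le {q A a σ ψ : ℝ} {N : ℕ} (hq : 0 ≤ q) (hA : 0 ≤ A)
    (ha : 0 ≤ a) (hσ : 0 ≤ σ) (has : a ≤ σ ^ (2 * q)) (hψ : 0 ≤ ψ) (hψ1 : ψ ≤ 1)
    (hN : 2 * q + 2 ≤ N) :
    N * ψ ^ (N - 1) * A * a * σ ≤ ψ ^ N * a * σ ^ 2 / 4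
      + N * (4 * N) ^ (2 * q + 1) * A ^ (2 * q + 2) := by
  have h0 : 0 ≤ N * (4 * N) ^ (2 * q + 1) * A ^ (2 * q + 2) := by positivity
  have hN1 : 1 ≤ N := by
    have : (1:ℝ) ≤ N := by linarith
    exact_mod_cast this
  have hψN : ψ ^ N = ψ ^ (N - 1) * ψ := by rw [← pow_succ, Nat.sub_add_cancel hN1]
  -- either the term is absorbed, or `ψ σ` is controlled by `A`; the power `N` of the cutoff
  -- function is large enough to turn all the powers of `σ` into powers of `ψ σ`
  rcases le_total (4 * (N * A)) (ψ * σ) with h | h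
  · have h1 : ψ ^ (N - 1) * a * σ * (4 * (N * A)) ≤ ψ ^ (N - 1) * a * σ * (ψ * σ) := by gcongr
    rw [hψN]
    linarith
  have h1 : ψ ^ (N - 1) ≤ ψ ^ (2 * q + 1) := by
    rw [← Real.rpow_natCast]
    refine Real.rpow_le_rpow_of_exponent_ge' hψ hψ1 (by linarith) ?_
    rw [Nat.cast_sub hN1]
    push_cast
    linarith
  have h2 : ψ ^ (2 * q + 1) * σ ^ (2 * q) * σ ≤ (4 * N) ^ (2 * q + 1) * A ^ (2 * q + 1) := by
    rw [mul_assoc, ← Real.rpow_add_one' hσ (by linarith), ← Real.mul_rpow hψ hσ,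
      ← Real.mul_rpow (by positivity) hA]
    exact Real.rpow_le_rpow (by positivity) (by linarith) (by linarith)
  have h3 : A ^ (2 * q + 2) = A ^ (2 * q + 1) * A := by
    rw [← Real.rpow_add_one' hA (by linarith)]
    congr 1
    ring
  have h4 : 0 ≤ ψ ^ N * a * σ ^ 2 / 4 := by positivity
  calc N * ψ ^ (N - 1) * A * a * σ ≤ N * ψ ^ (2 * q + 1) * A * σ ^ (2 * q) * σ := by gcongr
    _ = N * A * (ψ ^ (2 * q + 1) * σ ^ (2 * q) * σ) := by ring
    _ ≤ N * A * ((4 * N) ^ (2 * q + 1) * A ^ (2 * q + 1)) := by gcongr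
    _ = N * (4 * N) ^ (2 * q + 1) * A ^ (2 * q + 2) := by rw [h3]; ring
    _ ≤ _ := by linarith

end Young

/-! ### Cutoff functions -/

section Cutoff

variable {M : Type*} [MetricSpace M]

/-- The cutoff function equal to `1` on the ball of radius `R` and to `0` outside the ball of
radius `R + 1`, linear in the distance in between. -/
def cutoff (x₀ : M) (R : ℝ) (x : M) : ℝ := max 0 (min 1 (R + 1 - dist x x₀))

theorem cutoff_nonneg (x₀ : M) (R : ℝ) (x : M) : 0 ≤ cutoff x₀ R x := le_max_left _ _

theorem cutoff_le_one (x₀ : M) (R : ℝ) (x : M) : cutoff x₀ R x ≤ 1 :=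
  max_le zero_le_one (min_le_left _ _)

theorem cutoff_eq_one {x₀ : M} {R : ℝ} {x : M} (h : dist x x₀ ≤ R) : cutoff x₀ R x = 1 := by
  rw [cutoff, min_eq_left (by linarith), max_eq_right zero_le_one]

theorem lipschitzWith_cutoff (x₀ : M) (R : ℝ) : LipschitzWith 1 (cutoff x₀ R) := by
  refine LipschitzWith.const_max (LipschitzWith.const_min ?_ _) _
  refine LipschitzWith.of_dist_le_mul fun x y ↦ ?_
  rw [Real.dist_eq, NNReal.coe_one, one_mul, sub_sub_sub_cancel_left, abs_sub_comm]
  exact abs_dist_sub_le x y x₀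

theorem hasCompactSupport_cutoff [ProperSpace M] (x₀ : M) (R : ℝ) :
    HasCompactSupport (cutoff x₀ R) := by
  refine HasCompactSupport.intro (isCompact_closedBall x₀ (R + 1)) fun x hx ↦ ?_
  rw [Metric.mem_closedBall, not_le] at hx
  exact max_eq_left ((min_le_right _ _).trans (by linarith))

theorem lipschitzWith_cutoff_pow (x₀ : M) (R : ℝ) (N : ℕ) :
    LipschitzWith N (fun x ↦ cutoff x₀ R x ^ N) := by
  refine LipschitzWith.of_dist_le_mul fun x y ↦ ?_
  rw [Real.dist_eq, NNReal.coe_natCast]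
  have h1 : |cutoff x₀ R x - cutoff x₀ R y| ≤ dist x y := by
    simpa [Real.dist_eq] using (lipschitzWith_cutoff x₀ R).dist_le_mul x y
  have h2 : ∀ z, |cutoff x₀ R z| ≤ 1 := fun z ↦ by
    rw [abs_of_nonneg (cutoff_nonneg _ _ _)]; exact cutoff_le_one _ _ _
  have h3 : max |cutoff x₀ R x| |cutoff x₀ R y| ^ (N - 1) ≤ 1 :=
    pow_le_one₀ ((abs_nonneg _).trans (le_max_left _ _)) (max_le (h2 x) (h2 y))
  calc _ ≤ |cutoff x₀ R x - cutoff x₀ R y| * N * max |cutoff x₀ R x| |cutoff x₀ R y| ^ (N - 1) :=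
        abs_pow_sub_pow_le ..
    _ ≤ dist x y * N * 1 := by gcongr
    _ = N * dist x y := by ring

end Cutoff

/-! ### Local consequences of `L^p` bounds -/

section LocalBounds

variable {m : ℕ} {M : Type*} [MetricSpace M] [ChartedSpace (Eucl m) M] [IsManifold (𝓡 m) ∞ M]
  [RiemannianBundle (fun x : M ↦ TangentSpace (𝓡 m) x)]
  [IsContMDiffRiemannianBundle (𝓡 m) ∞ (Eucl m) (fun x : M ↦ TangentSpace (𝓡 m) x)]

theorem abs_differential_le [IsRiemannianManifold (𝓡 m) M] {φ : M → ℝ} {C : NNReal}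
    (hφ : LipschitzWith C φ) (x : M) (X : TangentSpace (𝓡 m) x) :
    |differential φ x X| ≤ C * ‖X‖ := by
  have key : ∀ y ∈ (chartAt (Eucl m) x).target,
      ∀ X : TangentSpace (𝓡 m) ((chartAt (Eucl m) x).symm y), |differential φ _ X| ≤ C * ‖X‖ := by
    intro y hy X
    obtain ⟨v, rfl⟩ := chartDeriv_surjective x hy X
    exact abs_differential_chartDeriv_le hφ x hy v
  have h := key _ (mem_chart_target (Eucl m) x)
  rw [(chartAt (Eucl m) x).left_inv (mem_chart_source _ x)] at h
  exact h X

theorem differential_pow {ψ : M → ℝ} {x : M} (h : MDifferentiableAt (𝓡 m) 𝓘(ℝ, ℝ) ψ x) (N : ℕ)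
    (X : TangentSpace (𝓡 m) x) :
    differential (fun z ↦ ψ z ^ N) x X = N * ψ x ^ (N - 1) * differential ψ x X := by
  have h1 := (hasDerivAt_pow N (ψ x)).hasFDerivAt.hasMFDerivAt.comp x h.hasMFDerivAt
  have h2 : differential (fun z ↦ ψ z ^ N) x = _ := h1.mfderiv
  rw [h2]
  change (differential ψ x X) • (N * ψ x ^ (N - 1)) = _
  rw [smul_eq_mul, mul_comm]

variable [MeasurableSpace M] [BorelSpace M] [SecondCountableTopology M]

theorem locallySq_of_memLp {p : ℝ≥0∞} (hp2 : 2 ≤ p) {F : M → ℝ}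
    (hF : MemLp F p (riemannianVolume m M)) (c : M) :
    LocallySq (chartAt (Eucl m) c).target fun y ↦ F ((chartAt (Eucl m) c).symm y) := by
  intro K hK hKc
  have : IsFiniteMeasure (volume.restrict K) := ⟨by
    rw [Measure.restrict_apply_univ]; exact hK.measure_lt_top⟩
  exact (memLp_chart hK hKc (hF.restrict _)).mono_exponent hp2

theorem locallySq_hessian {p : ℝ≥0∞} (hp2 : 2 ≤ p) [IsRiemannianManifold (𝓡 m) M] {u : M → ℝ}
    {h : ∀ x : M, TangentSpace (𝓡 m) x →L[ℝ] TangentSpace (𝓡 m) x →L[ℝ] ℝ}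
    (hh : IsWeakHessian m u h) (hp : MemLp (fun x ↦ tensorNorm (h x)) p (riemannianVolume m M))
    (c : M) (i j : Fin m) : LocallySq (chartAt (Eucl m) c).target fun y ↦
      h ((chartAt (Eucl m) c).symm y) (coordVector m c i y) (coordVector m c j y) := by
  intro K hK hKc
  have h1 := ((locallySq_of_memLp hp2 hp c).continuousOn_mul
    ((continuousOn_norm_chartDeriv c (EuclideanSpace.single i 1)).mul
      (continuousOn_norm_chartDeriv c (EuclideanSpace.single j 1)))) K hK hKc
  refine h1.mono ((hh.locallyIntegrable c i j).aestronglyMeasurable.mono_measure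
    (Measure.restrict_mono_set _ hKc)) (.of_forall fun y ↦ ?_)
  refine (abs_apply_le_tensorNorm _ _ _).trans ((le_abs_self _).trans_eq ?_)
  rw [mul_comm]
  rfl

theorem aestronglyMeasurable_norm_of_isWeakGradient {u : M → ℝ}
    {X : ∀ x : M, TangentSpace (𝓡 m) x}
    (hX : IsWeakGradient m u X) : AEStronglyMeasurable (fun x ↦ ‖X x‖) (riemannianVolume m M) := by
  obtain ⟨s, hs, hsU⟩ := TopologicalSpace.countable_cover_nhds
    fun x : M ↦ (chartAt (Eucl m) x).open_source.mem_nhds (mem_chart_source _ x)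
  have : Countable s := hs.to_subtype
  rw [← Measure.restrict_univ (μ := riemannianVolume m M), ← hsU, Set.biUnion_eq_iUnion,
    aestronglyMeasurable_iUnion_iff]
  intro c
  rw [aestronglyMeasurable_source_iff]
  have hT := (chartAt (Eucl m) (c : M)).open_target.measurableSet
  have h1 : AEStronglyMeasurable (fun y ↦ ∑ i, ∑ j, metricInv m (c : M) i j y
      * inner ℝ (X ((chartAt (Eucl m) (c : M)).symm y)) (coordVector m (c : M) i y)
      * inner ℝ (X ((chartAt (Eucl m) (c : M)).symm y)) (coordVector m (c : M) j y))
      (volume.restrict (chartAt (Eucl m) (c : M)).target) :=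
    Finset.aestronglyMeasurable_fun_sum _ fun i _ ↦ Finset.aestronglyMeasurable_fun_sum _ fun j _ ↦
      (((contDiffOn_metricInv (c : M) i j).continuousOn.aestronglyMeasurable hT).mul
        (hX.locallyIntegrable c i).aestronglyMeasurable).mul
        (hX.locallyIntegrable c j).aestronglyMeasurable
  refine (Real.continuous_sqrt.comp_aestronglyMeasurable h1).congr
    ((ae_restrict_iff' hT).2 (.of_forall fun y hy ↦ ?_))
  have h2 := norm_sq_chartDeriv_raise (c : M) hy fun i ↦
    inner ℝ (X ((chartAt (Eucl m) (c : M)).symm y)) (coordVector m (c : M) i y)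
  rw [← eq_chartDeriv_raise _ hy] at h2
  simp only [← h2]
  exact Real.sqrt_sq (norm_nonneg _)

end LocalBounds

/-! ### The gradient estimate -/

section GlobalEstimate

variable {m : ℕ} {M : Type*} [MetricSpace M] [ChartedSpace (Eucl m) M] [IsManifold (𝓡 m) ∞ M]
  [RiemannianBundle (fun x : M ↦ TangentSpace (𝓡 m) x)]
  [IsContMDiffRiemannianBundle (𝓡 m) ∞ (Eucl m) (fun x : M ↦ TangentSpace (𝓡 m) x)]
  [IsRiemannianManifold (𝓡 m) M]

/-- The pointwise form of the estimate: up to the exact term `energyForm`, the density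
`ψ ^ N a(|X|²) |X|²` is controlled by `|v| ^ p + |h| ^ p` with `p = 2 q + 2`. -/
theorem cutoff_pow_mul_le_energyForm {q : ℝ} (hq : 0 ≤ q) {k N : ℕ} (hN : 2 * q + 2 ≤ N)
    (x₀ : M) (R : ℝ) {x : M} (hd : MDifferentiableAt (𝓡 m) 𝓘(ℝ, ℝ) (cutoff x₀ R) x)
    {a : ℝ → ℝ} (v : ℝ) (X : TangentSpace (𝓡 m) x)
    (h : TangentSpace (𝓡 m) x →L[ℝ] TangentSpace (𝓡 m) x →L[ℝ] ℝ)
    (ha : 0 ≤ a (‖X‖ ^ 2)) (has : a (‖X‖ ^ 2) ≤ (‖X‖ ^ 2) ^ q)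
    (ha' : |‖X‖ ^ 2 * deriv a (‖X‖ ^ 2)| ≤ k * a (‖X‖ ^ 2)) :
    cutoff x₀ R x ^ N * (a (‖X‖ ^ 2) * ‖X‖ ^ 2)
      ≤ 2 * energyForm a v X h (cutoff x₀ R x ^ N) (differential (fun z ↦ cutoff x₀ R z ^ N) x)
        + 2 * ((m + 2 * k) * (4 * (m + 2 * k)) ^ q + N * (4 * N) ^ (2 * q + 1))
          * (|v| ^ (2 * q + 2) + tensorNorm h ^ (2 * q + 2)) := by
  set ψ := cutoff x₀ R x
  have hψ : 0 ≤ ψ := cutoff_nonneg _ _ _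
  have hψ1 : ψ ≤ 1 := cutoff_le_one _ _ _
  set b := a (‖X‖ ^ 2)
  set K := tensorNorm h
  have hK : 0 ≤ K := tensorNorm_nonneg h
  have hψN : 0 ≤ ψ ^ N := by positivity
  have e1 : |b * tensorTrace h| ≤ b * (m * K) := by
    rw [abs_mul, abs_of_nonneg ha]
    refine mul_le_mul_of_nonneg_left ?_ ha
    simpa only [finrank_tangentSpace] using abs_tensorTrace_le h
  have e2 : |2 * deriv a (‖X‖ ^ 2) * h X X| ≤ 2 * (k * b) * K := by
    calc |2 * deriv a (‖X‖ ^ 2) * h X X| ≤ 2 * |deriv a (‖X‖ ^ 2)| * (K * (‖X‖ * ‖X‖)) := by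
          rw [abs_mul, abs_mul, abs_two]
          gcongr
          exact abs_apply_le_tensorNorm h X X
      _ = 2 * |‖X‖ ^ 2 * deriv a (‖X‖ ^ 2)| * K := by
          rw [abs_mul, abs_of_nonneg (sq_nonneg ‖X‖)]; ring
      _ ≤ 2 * (k * b) * K := by gcongr
  have e3 : |v * b * differential (fun z ↦ cutoff x₀ R z ^ N) x X|
      ≤ N * ψ ^ (N - 1) * |v| * b * ‖X‖ := by
    rw [differential_pow hd, abs_mul, abs_mul, abs_of_nonneg ha, abs_mul,
      abs_of_nonneg (show (0:ℝ) ≤ N * ψ ^ (N - 1) by positivity)]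
    have h1 := abs_differential_le (lipschitzWith_cutoff x₀ R) x X
    rw [NNReal.coe_one, one_mul] at h1
    calc _ ≤ |v| * b * (N * ψ ^ (N - 1) * ‖X‖) := by gcongr
      _ = _ := by ring
  have e4 : |v * (b * tensorTrace h + 2 * deriv a (‖X‖ ^ 2) * h X X)|
      ≤ (m + 2 * k) * |v| * K * b := by
    rw [abs_mul]
    calc _ ≤ |v| * (b * (m * K) + 2 * (k * b) * K) := by
          gcongr
          exact (abs_add_le _ _).trans (add_le_add e1 e2)
      _ = _ := by ring
  -- the two error terms are absorbed by Young's inequality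
  have y1 := mul_mul_weight_le (c := m + 2 * k) hq (by positivity) (abs_nonneg v) hK ha
    (sq_nonneg ‖X‖) has hψN (pow_le_one₀ hψ hψ1)
  have hsq : (‖X‖ ^ 2) ^ q = ‖X‖ ^ (2 * q) := by
    rw [← sq_rpow_half (norm_nonneg X), mul_div_cancel_left₀ q two_ne_zero]
  have y2 := cutoff_mul_weight_le hq (abs_nonneg v) ha (norm_nonneg X) (has.trans_eq hsq) hψ hψ1 hN
  have hv : |v| ^ (2 * q + 2) ≤ |v| ^ (2 * q + 2) + K ^ (2 * q + 2) :=
    le_add_of_nonneg_right (by positivity)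
  have y3 : N * (4 * N) ^ (2 * q + 1) * |v| ^ (2 * q + 2)
      ≤ N * (4 * N) ^ (2 * q + 1) * (|v| ^ (2 * q + 2) + K ^ (2 * q + 2)) := by gcongr
  have z1 := mul_le_mul_of_nonneg_left (neg_le_of_abs_le e4) hψN
  have z2 := neg_le_of_abs_le e3
  rw [energyForm]
  change ψ ^ N * (b * ‖X‖ ^ 2) ≤ 2 * (ψ ^ N * (b * ‖X‖ ^ 2 + v * (b * tensorTrace h
    + 2 * deriv a (‖X‖ ^ 2) * h X X)) + v * b * differential (fun z ↦ cutoff x₀ R z ^ N) x X) + _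
  linarith

variable [MeasurableSpace M] [BorelSpace M] [ProperSpace M]

/-- The estimate for a regularized weight and a cutoff function. -/
theorem lintegral_cutoff_pow_mul_le {u : M → ℝ}
    {h : ∀ x : M, TangentSpace (𝓡 m) x →L[ℝ] TangentSpace (𝓡 m) x →L[ℝ] ℝ}
    {X : ∀ x : M, TangentSpace (𝓡 m) x} (hh : IsWeakHessian m u h) (hX : IsWeakGradient m u X)
    (hu : ∀ c : M, LocallySq (chartAt (Eucl m) c).target fun y ↦ u ((chartAt (Eucl m) c).symm y))
    (hh2 : ∀ c i j, LocallySq (chartAt (Eucl m) c).target fun y ↦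
      h ((chartAt (Eucl m) c).symm y) (coordVector m c i y) (coordVector m c j y))
    (hX2 : ∀ c i, LocallySq (chartAt (Eucl m) c).target fun y ↦
      (inner ℝ (X ((chartAt (Eucl m) c).symm y)) (coordVector m c i y) : ℝ))
    {q : ℝ} (hq : 0 ≤ q) {k N : ℕ} (hk : q ≤ k) (hk1 : 1 ≤ k) (hN : 2 * q + 2 ≤ N)
    (hG : Integrable (fun x ↦ |u x| ^ (2 * q + 2) + tensorNorm (h x) ^ (2 * q + 2))
      (riemannianVolume m M)) {δ : ℝ} (hδ : 0 < δ) (x₀ : M) (R : ℝ) :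
    ∫⁻ x, ENNReal.ofReal (cutoff x₀ R x ^ N * (regularizedPower q k δ (‖X x‖ ^ 2) * ‖X x‖ ^ 2))
        ∂(riemannianVolume m M)
      ≤ ENNReal.ofReal (2 * ((m + 2 * k) * (4 * (m + 2 * k)) ^ q + N * (4 * N) ^ (2 * q + 1))
          * ∫ x, (|u x| ^ (2 * q + 2) + tensorNorm (h x) ^ (2 * q + 2))
              ∂(riemannianVolume m M)) := by
  set a := regularizedPower q k δ
  set D : ℝ := 2 * ((m + 2 * k) * (4 * (m + 2 * k)) ^ q + N * (4 * N) ^ (2 * q + 1))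
  have ha0 : ∀ s, 0 ≤ s → 0 ≤ a s := fun s hs ↦ regularizedPower_nonneg hδ hs
  have haB : ∀ s, 0 ≤ s → a s ≤ δ ^ (-(q / 2)) := fun s hs ↦ regularizedPower_le hq hδ hk hk1 hs
  have hk1' : (1:ℝ) ≤ k := by exact_mod_cast hk1
  obtain ⟨hI, hI0⟩ := integral_energyForm hh hX hu hh2 hX2 (contDiff_regularizedPower hδ)
    (A := k * δ ^ (-(q / 2)))
    (fun s hs ↦ by
      rw [abs_of_nonneg (ha0 s hs)]
      exact (haB s hs).trans (le_mul_of_one_le_left (by positivity) hk1'))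
    (fun s hs ↦ (abs_mul_deriv_regularizedPower_le hq hδ hk hs).trans
      (mul_le_mul_of_nonneg_left (haB s hs) (by positivity)))
    (lipschitzWith_cutoff_pow x₀ R N) ((hasCompactSupport_cutoff x₀ R).comp_left
      (g := fun t : ℝ ↦ t ^ N) (zero_pow fun h0 ↦ by
        rw [h0, Nat.cast_zero] at hN; linarith))
  have hle : ∀ᵐ x ∂(riemannianVolume m M), cutoff x₀ R x ^ N * (a (‖X x‖ ^ 2) * ‖X x‖ ^ 2)
      ≤ 2 * energyForm a (u x) (X x) (h x) (cutoff x₀ R x ^ N)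
          (differential (fun z ↦ cutoff x₀ R z ^ N) x)
        + D * (|u x| ^ (2 * q + 2) + tensorNorm (h x) ^ (2 * q + 2)) := by
    filter_upwards [ae_mdifferentiableAt (m := m) (lipschitzWith_cutoff x₀ R)] with x hx
    exact cutoff_pow_mul_le_energyForm hq hN x₀ R hx _ _ _ (ha0 _ (sq_nonneg _))
      (regularizedPower_le_rpow hq hδ hk hk1 (sq_nonneg _))
      (abs_mul_deriv_regularizedPower_le hq hδ hk (sq_nonneg _))
  have hint := (hI.const_mul 2).add (hG.const_mul D)
  calc _ ≤ ∫⁻ x, ENNReal.ofReal (2 * energyForm a (u x) (X x) (h x) (cutoff x₀ R x ^ N)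
          (differential (fun z ↦ cutoff x₀ R z ^ N) x)
        + D * (|u x| ^ (2 * q + 2) + tensorNorm (h x) ^ (2 * q + 2))) ∂(riemannianVolume m M) :=
      lintegral_mono_ae (hle.mono fun x hx ↦ ENNReal.ofReal_le_ofReal hx)
    _ = ENNReal.ofReal (∫ x, (2 * energyForm a (u x) (X x) (h x) (cutoff x₀ R x ^ N)
          (differential (fun z ↦ cutoff x₀ R z ^ N) x)
        + D * (|u x| ^ (2 * q + 2) + tensorNorm (h x) ^ (2 * q + 2))) ∂(riemannianVolume m M)) :=
      (ofReal_integral_eq_lintegral_ofReal hint (hle.mono fun x hx ↦ le_trans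
        (mul_nonneg (pow_nonneg (cutoff_nonneg _ _ _) _)
          (mul_nonneg (ha0 _ (sq_nonneg _)) (sq_nonneg _))) hx)).symm
    _ = _ := by
      rw [integral_add (hI.const_mul 2) (hG.const_mul D), integral_const_mul, integral_const_mul,
        hI0, mul_zero, zero_add]

/-- The a priori estimate without regularization, by Fatou's lemma. -/
theorem lintegral_norm_rpow_le [Nonempty M] {u : M → ℝ}
    {h : ∀ x : M, TangentSpace (𝓡 m) x →L[ℝ] TangentSpace (𝓡 m) x →L[ℝ] ℝ}
    {X : ∀ x : M, TangentSpace (𝓡 m) x} (hh : IsWeakHessian m u h) (hX : IsWeakGradient m u X)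
    (hu : ∀ c : M, LocallySq (chartAt (Eucl m) c).target fun y ↦ u ((chartAt (Eucl m) c).symm y))
    (hh2 : ∀ c i j, LocallySq (chartAt (Eucl m) c).target fun y ↦
      h ((chartAt (Eucl m) c).symm y) (coordVector m c i y) (coordVector m c j y))
    (hX2 : ∀ c i, LocallySq (chartAt (Eucl m) c).target fun y ↦
      (inner ℝ (X ((chartAt (Eucl m) c).symm y)) (coordVector m c i y) : ℝ))
    {q : ℝ} (hq : 0 ≤ q) {k N : ℕ} (hk : q ≤ k) (hk1 : 1 ≤ k) (hN : 2 * q + 2 ≤ N)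
    (hG : Integrable (fun x ↦ |u x| ^ (2 * q + 2) + tensorNorm (h x) ^ (2 * q + 2))
      (riemannianVolume m M)) :
    ∫⁻ x, ENNReal.ofReal (‖X x‖ ^ (2 * q + 2)) ∂(riemannianVolume m M)
      ≤ ENNReal.ofReal (2 * ((m + 2 * k) * (4 * (m + 2 * k)) ^ q + N * (4 * N) ^ (2 * q + 1))
          * ∫ x, (|u x| ^ (2 * q + 2) + tensorNorm (h x) ^ (2 * q + 2))
              ∂(riemannianVolume m M)) := by
  obtain ⟨x₀⟩ := ‹Nonempty M›
  set δ : ℕ → ℝ := fun n ↦ 1 / ((n:ℝ) + 1)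
  have hδ : Filter.Tendsto δ Filter.atTop (𝓝 0) := tendsto_one_div_add_atTop_nhds_zero_nat
  have hδ0 : ∀ n, 0 < δ n := fun n ↦ by positivity
  set f : ℕ → M → ℝ := fun n x ↦
    cutoff x₀ n x ^ N * (regularizedPower q k (δ n) (‖X x‖ ^ 2) * ‖X x‖ ^ 2)
  have hf : ∀ n, AEMeasurable (fun x ↦ ENNReal.ofReal (f n x)) (riemannianVolume m M) := by
    intro n
    have h1 := aestronglyMeasurable_norm_of_isWeakGradient hX
    have h2 : Continuous fun t : ℝ ↦ regularizedPower q k (δ n) (t ^ 2) * t ^ 2 :=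
      ((contDiff_regularizedPower (n := 0) (hδ0 n)).continuous.comp (continuous_pow 2)).mul
        (continuous_pow 2)
    exact ((((lipschitzWith_cutoff x₀ n).continuous.pow N).aestronglyMeasurable).mul
      (h2.comp_aestronglyMeasurable h1)).aemeasurable.ennreal_ofReal
  have hlim : ∀ x, Filter.Tendsto (fun n ↦ f n x) Filter.atTop (𝓝 (‖X x‖ ^ (2 * q + 2))) := by
    intro x
    have h1 := tendsto_regularizedPower (q := q) (k := k) hδ (sq_nonneg ‖X x‖)
    have h2 : (‖X x‖ ^ 2) ^ q * ‖X x‖ ^ 2 = ‖X x‖ ^ (2 * q + 2) := by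
      rw [← Real.rpow_add_one' (sq_nonneg _) (by linarith), ← sq_rpow_half (norm_nonneg _)]
      congr 1
      ring
    rw [h2] at h1
    refine h1.congr' ?_
    obtain ⟨n₀, hn₀⟩ := exists_nat_ge (dist x x₀)
    filter_upwards [Filter.eventually_ge_atTop n₀] with n hn
    simp only [f]
    rw [cutoff_eq_one (hn₀.trans (by exact_mod_cast hn)), one_pow, one_mul]
  calc ∫⁻ x, ENNReal.ofReal (‖X x‖ ^ (2 * q + 2)) ∂(riemannianVolume m M)
      = ∫⁻ x, Filter.liminf (fun n ↦ ENNReal.ofReal (f n x)) Filter.atTop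
          ∂(riemannianVolume m M) :=
        lintegral_congr fun x ↦ ((ENNReal.tendsto_ofReal (hlim x)).liminf_eq).symm
    _ ≤ Filter.liminf (fun n ↦ ∫⁻ x, ENNReal.ofReal (f n x) ∂(riemannianVolume m M))
          Filter.atTop := lintegral_liminf_le' hf
    _ ≤ _ := by
        refine Filter.liminf_le_of_le (by isBoundedDefault) fun b hb ↦ ?_
        obtain ⟨n, hn⟩ := hb.exists
        exact hn.trans (lintegral_cutoff_pow_mul_le hh hX hu hh2 hX2 hq hk hk1 hN hG (hδ0 n) x₀ n)

/-- A function in `L^p` whose Hessian is in `L^p` has its gradient in `L^p`. -/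
theorem exists_eLpNorm_gradient_le (m : ℕ) (M : Type*) [MetricSpace M] [ChartedSpace (Eucl m) M]
    [IsManifold (𝓡 m) ∞ M] [RiemannianBundle (fun x : M ↦ TangentSpace (𝓡 m) x)]
    [IsContMDiffRiemannianBundle (𝓡 m) ∞ (Eucl m) (fun x : M ↦ TangentSpace (𝓡 m) x)]
    [IsRiemannianManifold (𝓡 m) M] [MeasurableSpace M] [BorelSpace M] [ProperSpace M] [Nonempty M]
    {p : ℝ≥0∞} (hp2 : 2 ≤ p) (hp : p ≠ ⊤) :
    ∃ D : ℝ, 0 < D ∧ ∀ (u : M → ℝ)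
      (h : ∀ x : M, TangentSpace (𝓡 m) x →L[ℝ] TangentSpace (𝓡 m) x →L[ℝ] ℝ),
      IsWeakHessian m u h → MemLp u p (riemannianVolume m M) →
      MemLp (fun x ↦ tensorNorm (h x)) p (riemannianVolume m M) →
      ∃ X : ∀ x : M, TangentSpace (𝓡 m) x, IsWeakGradient m u X ∧
        MemLp (fun x ↦ ‖X x‖) p (riemannianVolume m M) ∧
        eLpNorm (fun x ↦ ‖X x‖) p (riemannianVolume m M) ≤ ENNReal.ofReal D *
          (eLpNorm u p (riemannianVolume m M)
            + eLpNorm (fun x ↦ tensorNorm (h x)) p (riemannianVolume m M)) := by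
  have hp0 : p ≠ 0 := fun h ↦ by simp [h] at hp2
  set r := p.toReal
  have hr2 : 2 ≤ r := by
    simpa using ENNReal.toReal_mono hp hp2
  -- the weight is `|X|^(p - 2) = (|X|²)^q`
  set q := (r - 2) / 2
  have hq : 0 ≤ q := by simp only [q]; linarith
  have hqr : 2 * q + 2 = r := by simp only [q]; ring
  obtain ⟨k, hk⟩ := exists_nat_ge (max q 1)
  have hkq : q ≤ k := (le_max_left _ _).trans hk
  have hk1 : 1 ≤ k := by exact_mod_cast (le_max_right _ _).trans hk
  obtain ⟨N, hN⟩ := exists_nat_ge (2 * q + 2)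
  set D₀ : ℝ := 2 * ((m + 2 * k) * (4 * (m + 2 * k)) ^ q + N * (4 * N) ^ (2 * q + 1))
  have hD₀ : 0 < D₀ := by
    have : (0:ℝ) < k := by exact_mod_cast hk1
    positivity
  refine ⟨D₀ ^ (1 / r), by positivity, fun u h hh hu hK ↦ ?_⟩
  have hu2 := locallySq_of_memLp hp2 hu
  have hh2 := locallySq_hessian hp2 hh hK
  obtain ⟨X, hX, hX2⟩ := exists_isWeakGradient hh hu2 hh2
  have i1 : Integrable (fun x ↦ |u x| ^ r) (riemannianVolume m M) := hu.integrable_norm_rpow hp0 hp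
  have i2 : Integrable (fun x ↦ tensorNorm (h x) ^ r) (riemannianVolume m M) := by
    refine (hK.integrable_norm_rpow hp0 hp).congr (.of_forall fun x ↦ ?_)
    simp only [Real.norm_of_nonneg (tensorNorm_nonneg (h x))]
    rfl
  have key := lintegral_norm_rpow_le hh hX hu2 hh2 hX2 hq hkq hk1 hN (by rw [hqr]; exact i1.add i2)
  rw [hqr] at key
  have hpow : ∀ {F : M → ℝ}, (∀ x, 0 ≤ F x) → ∫⁻ x, ENNReal.ofReal (F x ^ r) ∂(riemannianVolume m M)
      = ∫⁻ x, ‖F x‖ₑ ^ r ∂(riemannianVolume m M) := fun {F} hF ↦ lintegral_congr fun x ↦ by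
    rw [Real.enorm_of_nonneg (hF x), ENNReal.ofReal_rpow_of_nonneg (hF x) (by linarith)]
  have hr0 : 0 < r := by linarith
  have hnorm : eLpNorm (fun x ↦ ‖X x‖) p (riemannianVolume m M) ≤ ENNReal.ofReal (D₀ ^ (1 / r)) *
          (eLpNorm u p (riemannianVolume m M)
            + eLpNorm (fun x ↦ tensorNorm (h x)) p (riemannianVolume m M)) := by
    have hre : ∀ F : M → ℝ, eLpNorm F p (riemannianVolume m M)
        = (∫⁻ x, ‖F x‖ₑ ^ r ∂(riemannianVolume m M)) ^ (1 / r) := fun F ↦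
      eLpNorm_eq_lintegral_rpow_enorm_toReal hp0 hp
    rw [← ENNReal.rpow_le_rpow_iff hr0, hre fun x ↦ ‖X x‖, ← ENNReal.rpow_mul,
      one_div_mul_cancel hr0.ne', ENNReal.rpow_one, ← hpow fun x ↦ norm_nonneg _]
    refine key.trans ?_
    rw [ENNReal.mul_rpow_of_nonneg _ _ hr0.le, ENNReal.ofReal_rpow_of_pos (by positivity),
      ← Real.rpow_mul hD₀.le, one_div_mul_cancel hr0.ne', Real.rpow_one,
      ENNReal.ofReal_mul hD₀.le]
    gcongr
    refine le_trans (le_of_eq ?_) (ENNReal.add_rpow_le_rpow_add _ _ (by linarith))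
    have hi1 : ENNReal.ofReal (∫ x, |u x| ^ r ∂(riemannianVolume m M))
        = eLpNorm u p (riemannianVolume m M) ^ r := by
      rw [hre, ← ENNReal.rpow_mul, one_div_mul_cancel hr0.ne', ENNReal.rpow_one,
        ofReal_integral_eq_lintegral_ofReal i1 (.of_forall fun x ↦ by positivity),
        hpow fun x ↦ abs_nonneg (u x)]
      simp
    have hi2 : ENNReal.ofReal (∫ x, tensorNorm (h x) ^ r ∂(riemannianVolume m M))
        = eLpNorm (fun x ↦ tensorNorm (h x)) p (riemannianVolume m M) ^ r := by
      rw [hre, ← ENNReal.rpow_mul, one_div_mul_cancel hr0.ne', ENNReal.rpow_one,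
        ofReal_integral_eq_lintegral_ofReal i2
          (.of_forall fun x ↦ Real.rpow_nonneg (tensorNorm_nonneg _) _),
        hpow fun x ↦ tensorNorm_nonneg (h x)]
    rw [integral_add i1 i2, ENNReal.ofReal_add
      (integral_nonneg fun x ↦ by positivity)
      (integral_nonneg fun x ↦ Real.rpow_nonneg (tensorNorm_nonneg _) _), hi1, hi2]
  exact ⟨X, hX, ⟨aestronglyMeasurable_norm_of_isWeakGradient hX, hnorm.trans_lt
    (ENNReal.mul_lt_top ENNReal.ofReal_lt_top (ENNReal.add_lt_top.2 ⟨hu.2, hK.2⟩))⟩, hnorm⟩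

end GlobalEstimate

end RiemannianSobolev

end

theorem mainTheorem4 (m : ℕ) (hm : 2 ≤ m)
    {M : Type*} [MetricSpace M] [ConnectedSpace M]
    [ChartedSpace (EuclideanSpace ℝ (Fin m)) M] [IsManifold (𝓡 m) ∞ M]
    [RiemannianBundle (fun x : M ↦ TangentSpace (𝓡 m) x)]
    [IsContMDiffRiemannianBundle (𝓡 m) ∞ (EuclideanSpace ℝ (Fin m))
      (fun x : M ↦ TangentSpace (𝓡 m) x)]
    [IsRiemannianManifold (𝓡 m) M]
    [CompleteSpace M]
    [MeasurableSpace M] [BorelSpace M]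
    (p : ℝ≥0∞) (hp2 : 2 ≤ p) (hp : p ≠ ⊤)
    (hHess : ∃ C : ℝ, 0 < C ∧ ∀ u f : M → ℝ, RiemannianSobolev.MemSobolevTilde m p u f →
      ∃ h : ∀ x : M, TangentSpace (𝓡 m) x →L[ℝ] TangentSpace (𝓡 m) x →L[ℝ] ℝ,
        RiemannianSobolev.IsWeakHessian m u h ∧
        MemLp (fun x ↦ RiemannianSobolev.tensorNorm (h x)) p
          (RiemannianSobolev.riemannianVolume m M) ∧
        eLpNorm (fun x ↦ RiemannianSobolev.tensorNorm (h x)) p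
            (RiemannianSobolev.riemannianVolume m M)
          ≤ ENNReal.ofReal C * (eLpNorm u p (RiemannianSobolev.riemannianVolume m M)
              + eLpNorm f p (RiemannianSobolev.riemannianVolume m M))) :
    ∃ C' : ℝ, 0 < C' ∧ ∀ u f : M → ℝ, RiemannianSobolev.MemSobolevTilde m p u f →
      ∃ X : ∀ x : M, TangentSpace (𝓡 m) x,
        RiemannianSobolev.IsWeakGradient m u X ∧
        MemLp (fun x ↦ ‖X x‖) p (RiemannianSobolev.riemannianVolume m M) ∧
        eLpNorm (fun x ↦ ‖X x‖) p (RiemannianSobolev.riemannianVolume m M)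
          ≤ ENNReal.ofReal C' * (eLpNorm u p (RiemannianSobolev.riemannianVolume m M)
              + eLpNorm f p (RiemannianSobolev.riemannianVolume m M)) := by
  have : ProperSpace M := RiemannianSobolev.properSpace_of_complete m
  obtain ⟨C, hC, hHess⟩ := hHess
  obtain ⟨D, hD, hgrad⟩ := RiemannianSobolev.exists_eLpNorm_gradient_le m M hp2 hp
  refine ⟨D * (1 + C), by positivity, fun u f huf ↦ ?_⟩
  obtain ⟨h, hh, hhp, hle⟩ := hHess u f huf
  obtain ⟨X, hX, hXp, hXle⟩ := hgrad u h hh huf.memLp hhp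
  refine ⟨X, hX, hXp, hXle.trans ?_⟩
  rw [ENNReal.ofReal_mul hD.le, mul_assoc, ENNReal.ofReal_add zero_le_one hC.le, add_mul,
    ENNReal.ofReal_one, one_mul]
  gcongr
  exact le_self_add
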